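/- Let $K$ be a number field with ring of integers $R$, and put $R^\times=R\setminus\{0\}$, $K^*=K\setminus\{0\}$. Write $R\rtimes R^\times$ for the semigroup of pairs $(m,k)$ with $(m,k)(n,l)=(m+kn,kl)$, and $K\rtimes K^*$ for the group of pairs over $K$ with the same multiplication. All ideals are nonzero. The Toeplitz algebra $\mathfrak T[R]$ is the universal unital C*-algebra generated by unitaries $u^x$ $(x\in R)$, isometries $s_a$ $(a\in R^\times)$ and projections $e_I$ ($I$ an ideal of $R$) subject to the relations: $u^xu^y=u^{x+y}$, $s_as_b=s_{ab}$, $s_au^x=u^{ax}s_a$; $e_{I\cap J}=e_Ie_J$, $e_R=1$; $s_ae_Is_a^*=e_{aI}$; $u^xe_I=e_Iu^x$ if $x\in I$, and $e_Iu^xe_I=0$ if $x\notin I$. Let $\mathbb A_f$ be the ring of finite adeles of $K$, let $\hat R\subset\mathbb A_f$ be the subring of integral adeles, and let $\hat R^*$ be its group of units. For $a \in \mathbb A_f$ and a prime $P$ let $\epsilon_P(a)\in\mathbb Z\cup\{\infty\}$ be the $P$-adic exponent of $a$; for an ideal $I$ let $\epsilon_P(I)$ be the exponent of $P$ in $I$,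 and let $I\hat R=\{x\in\mathbb A_f:\epsilon_P(x)\ge\epsilon_P(I)\text{ for all }P\}$. Let $\Omega_{\mathbb A_f}$ be the quotient space of $\mathbb A_f\times\mathbb A_f$ by the equivalence relation $(r,a)\sim(s,b)$ if and only if $b\in a\hat R^*$ and $s-r\in a\hat R$; write $\omega_{r,a}$ for the class of $(r,a)$. The group $K\rtimes K^*$ acts on $\Omega_{\mathbb A_f}$ by $(m,k)\,\omega_{r,a}=\omega_{m+kr,ka}$. The compact open subset $\Omega_R=\{\omega_{r,a}: r,a\in\hat R\}$ is mapped into itself by $R\rtimes R^\times$, so that $g\in R\rtimes R^\times$ acts on $C(\Omega_R)$ by the endomorphism $\alpha_g$ for which $\alpha_g(f)(\omega)$ is $f(g^{-1}\omega)$ if $\omega\in g\,\Omega_R$ and is $0$ otherwise. The semigroup crossed product $C(\Omega_R)\rtimes(R\rtimes R^\times)$ is the universal unital C*-algebra generated by the image of a unital $*$-homomorphism on $C(\Omega_R)$ and by isometries $v_g$, $g\in R\rtimes R^\times$, with $v_gv_h=v_{gh}$ and $v_gfv_g^*=\alpha_g(f)$ for $f\in C(\Omega_R)$. For an ideal $I$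 let $E_I\in C(\Omega_R)$ be the characteristic function of the closed and open set of all $\omega_{s,b}\in\Omega_R$ such that $\epsilon_P(b)\ge\epsilon_P(I)$ for all $P$ and $s\equiv 0$ modulo $I\hat R$. Finally, $K\rtimes K^*$ acts on $C_0(\Omega_{\mathbb A_f})$ by $(gf)(\omega)=f(g^{-1}\omega)$; let $U_g$ be the canonical unitaries implementing this action for the full crossed product $B=C_0(\Omega_{\mathbb A_f})\rtimes(K\rtimes K^*)$, with $K \rtimes K^*$ discrete. Then: (1) The assignments $u^x\mapsto v_{(x,1)}$, $s_k\mapsto v_{(0,k)}$, $e_I\mapsto E_I$ extend to a $*$-isomorphism of $\mathfrak T[R]$ onto $C(\Omega_R)\rtimes(R\rtimes R^\times)$. (2) The characteristic function $p=1_{\Omega_R}$ is a full projection in $B$ (that is, the closed linear span of $BpB$ is $B$), and there is an injective $*$-homomorphism of $\mathfrak T[R]$ into $B$ with range the corner $pBp$ and with $u^x\mapsto pU_{(x,1)}p$, $s_k\mapsto pU_{(0,k)}p$ and $e_I\mapsto E_I$, where $E_I$ is extended by $0$ to $\Omega_{\mathbb A_f}$. -/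

import Mathlib

noncomputable section

/-! ## Universal C*-algebras of generators and relations -/

/-- The free unital complex `*`-algebra on a set `X`: the monoid algebra over `ℂ` of words in the
letters `(x, false)`, standing for `x`, and `(x, true)`, standing for `x*`. -/
abbrev FreeStarAlg (X : Type*) : Type _ := MonoidAlgebra ℂ (FreeMonoid (X × Bool))

namespace FreeStarAlg

variable {X : Type*}

/-- A letter, as an element of the free `*`-algebra. -/
def letter (l : X × Bool) : FreeStarAlg X := MonoidAlgebra.single (FreeMonoid.of l) 1

/-- The generator `x`, as an element of the free `*`-algebra. -/
def gen (x : X) : FreeStarAlg X := letter (x, false)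

theorem induction {P : FreeStarAlg X → Prop} (hz : ∀ z : ℂ, P (algebraMap ℂ _ z))
    (hl : ∀ l, P (letter l)) (ha : ∀ a b, P a → P b → P (a + b))
    (hm : ∀ a b, P a → P b → P (a * b)) (a : FreeStarAlg X) : P a := by
  induction a using MonoidAlgebra.induction_on with
  | of w =>
    rw [MonoidAlgebra.of_apply]
    induction w using FreeMonoid.inductionOn' with
    | one => simpa using hz 1
    | of_mul x w ih =>
      have := hm _ _ (hl x) ih
      rwa [letter, MonoidAlgebra.single_mul_single, one_mul] at this
  | add a b iha ihb => exact ha a b iha ihb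
  | smul z a iha => rw [Algebra.smul_def]; exact hm _ _ (hz z) iha

/-- The conjugate-linear anti-homomorphism which interchanges `x` and `x*`. -/
def starHom (X : Type*) : FreeStarAlg X →+* (FreeStarAlg X)ᵐᵒᵖ :=
  MonoidAlgebra.liftNCRingHom
    (((algebraMap ℂ (FreeStarAlg X)ᵐᵒᵖ)).comp (starRingEnd ℂ))
    (FreeMonoid.lift fun l : X × Bool => MulOpposite.op (letter (l.1, !l.2)))
    (fun z _ => Algebra.commute_algebraMap_left (starRingEnd ℂ z) _)

theorem starHom_algebraMap (z : ℂ) :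
    starHom X (algebraMap ℂ (FreeStarAlg X) z) =
      MulOpposite.op (algebraMap ℂ (FreeStarAlg X) (starRingEnd ℂ z)) := by
  simp [starHom, MonoidAlgebra.liftNCRingHom]

theorem starHom_letter (l : X × Bool) :
    starHom X (letter l) = MulOpposite.op (letter (l.1, !l.2)) := by
  rw [letter, starHom, MonoidAlgebra.liftNCRingHom_single, map_one, one_mul, FreeMonoid.lift_eval_of]

instance instStarRing : StarRing (FreeStarAlg X) where
  star a := (starHom X a).unop
  star_involutive a := by
    induction a using induction with
    | hz z => beta_reduce; rw [starHom_algebraMap, MulOpposite.unop_op, starHom_algebraMap]; simp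
    | hl l => simp [starHom_letter]
    | ha a b iha ihb => simp_all
    | hm a b iha ihb => simp_all
  star_mul a b := by simp
  star_add a b := by simp

theorem star_algebraMap (z : ℂ) :
    star (algebraMap ℂ (FreeStarAlg X) z) = algebraMap ℂ (FreeStarAlg X) (star z) :=
  congrArg MulOpposite.unop (starHom_algebraMap z)

theorem star_letter (l : X × Bool) : star (letter l) = letter (l.1, !l.2) :=
  congrArg MulOpposite.unop (starHom_letter l)

instance instStarModule : StarModule ℂ (FreeStarAlg X) where
  star_smul z a := by
    rw [Algebra.smul_def, star_mul, star_algebraMap, ← Algebra.commutes, ← Algebra.smul_def]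

end FreeStarAlg

/-- A C*-seminorm on a complex `*`-algebra. -/
structure CStarSeminorm (A : Type*) [Ring A] [StarRing A] [Algebra ℂ A] extends
    Seminorm ℂ A where
  mul_le' : ∀ a b, toFun (a * b) ≤ toFun a * toFun b
  star_mul_self' : ∀ a, toFun (star a * a) = toFun a * toFun a

namespace CStarSeminorm

variable {A : Type*} [Ring A] [StarRing A] [Algebra ℂ A]

instance : CoeFun (CStarSeminorm A) fun _ => A → ℝ := ⟨fun p => p.toSeminorm⟩

variable (p : CStarSeminorm A)

theorem mul_le (a b : A) : p (a * b) ≤ p a * p b := p.mul_le' a b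

theorem star_mul_self (a : A) : p (star a * a) = p a * p a := p.star_mul_self' a

theorem nonneg (a : A) : 0 ≤ p a := apply_nonneg p.toSeminorm a

theorem le_star (a : A) : p a ≤ p (star a) := by
  rcases (p.nonneg a).eq_or_lt with h | h
  · rw [← h]; exact p.nonneg _
  · exact le_of_mul_le_mul_right ((p.star_mul_self a).symm.le.trans (p.mul_le _ _)) h

theorem star_eq (a : A) : p (star a) = p a :=
  le_antisymm (by simpa using p.le_star (star a)) (p.le_star a)

theorem one_le : p 1 ≤ 1 := by
  have h := p.star_mul_self 1
  rw [star_one, one_mul] at h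
  nlinarith [p.nonneg 1]

theorem eq_of_sub {a b : A} (h : p (a - b) = 0) : p a = p b :=
  le_antisymm
    (by simpa [h] using map_add_le_add p.toSeminorm (a - b) b)
    (by simpa [h, map_sub_rev p.toSeminorm] using map_add_le_add p.toSeminorm (b - a) a)

/-- The algebra `A`, equipped with the C*-seminorm `p`. -/
@[nolint unusedArguments]
def Pre (_ : CStarSeminorm A) : Type _ := A

instance : Ring p.Pre := inferInstanceAs (Ring A)
instance : StarRing p.Pre := inferInstanceAs (StarRing A)
instance : Algebra ℂ p.Pre := inferInstanceAs (Algebra ℂ A)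
instance [StarModule ℂ A] : StarModule ℂ p.Pre := inferInstanceAs (StarModule ℂ A)

instance : SeminormedRing p.Pre :=
  RingSeminorm.toSeminormedRing (R := p.Pre)
    { toFun := p
      map_zero' := map_zero p.toSeminorm
      add_le' := map_add_le_add p.toSeminorm
      neg' := map_neg_eq_map p.toSeminorm
      mul_le' := p.mul_le }

instance : NormedAlgebra ℂ p.Pre where
  norm_smul_le z a := (map_smul_eq_mul p.toSeminorm z a).le

instance : NormedStarGroup p.Pre where
  norm_star_le a := (p.star_eq a).le

/-- The C*-algebra obtained from `A` by dividing out the null space of `p` and completing. -/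
def Completion : Type _ := UniformSpace.Completion p.Pre

namespace Completion

instance : NormedRing p.Completion := inferInstanceAs (NormedRing (UniformSpace.Completion p.Pre))
instance : CompleteSpace p.Completion :=
  inferInstanceAs (CompleteSpace (UniformSpace.Completion p.Pre))

instance : Algebra ℂ p.Completion := inferInstanceAs (Algebra ℂ (UniformSpace.Completion p.Pre))

instance : NormedAlgebra ℂ p.Completion where
  norm_smul_le z a := norm_smul_le (α := ℂ) (β := UniformSpace.Completion p.Pre) z a

/-- The canonical map of `A` into the completion. -/
def of (a : A) : p.Completion := ((show p.Pre from a) : UniformSpace.Completion p.Pre)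

theorem induction {P : p.Completion → Prop} (a : p.Completion) (hc : IsClosed {a | P a})
    (h : ∀ a, P (of p a)) : P a :=
  UniformSpace.Completion.induction_on a hc h

theorem induction₂ {P : p.Completion → p.Completion → Prop} (a b : p.Completion)
    (hc : IsClosed {x : p.Completion × p.Completion | P x.1 x.2})
    (h : ∀ a b, P (of p a) (of p b)) : P a b :=
  UniformSpace.Completion.induction_on₂ a b hc h

theorem norm_of (a : A) : ‖of p a‖ = p a := UniformSpace.Completion.norm_coe _
theorem of_add (a b : A) : of p (a + b) = of p a + of p b := UniformSpace.Completion.coe_add _ _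
theorem of_mul (a b : A) : of p (a * b) = of p a * of p b := UniformSpace.Completion.coe_mul _ _
theorem of_one : of p 1 = 1 := rfl
theorem of_zero : of p 0 = 0 := rfl
theorem of_sub (a b : A) : of p (a - b) = of p a - of p b := UniformSpace.Completion.coe_sub _ _
theorem of_smul (z : ℂ) (a : A) : of p (z • a) = z • of p a := by
  rw [Algebra.smul_def, of_mul, Algebra.smul_def]; rfl

theorem of_eq_of {a b : A} (h : p (a - b) = 0) : of p a = of p b := by
  rw [← sub_eq_zero, ← of_sub, ← norm_eq_zero, norm_of, h]

instance : Star p.Completion := ⟨UniformSpace.Completion.map (star : p.Pre → p.Pre)⟩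

theorem star_of (a : A) : star (of p a) = of p (star a) :=
  UniformSpace.Completion.map_coe
    (isometry_iff_dist_eq.2 (dist_star_star (E := p.Pre))).uniformContinuous _

theorem continuous_star' : Continuous (star : p.Completion → p.Completion) :=
  UniformSpace.Completion.continuous_map

instance : StarRing p.Completion where
  star_involutive a := by
    induction a using induction with
    | hc => exact isClosed_eq ((continuous_star' p).comp (continuous_star' p)) continuous_id
    | h a => simp [star_of]
  star_mul a b := by
    induction a, b using induction₂ with
    | hc =>
      exact isClosed_eq ((continuous_star' p).comp (continuous_fst.mul continuous_snd))
        (((continuous_star' p).comp continuous_snd).mul ((continuous_star' p).comp continuous_fst))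
    | h a b => simp [star_of, ← of_mul]
  star_add a b := by
    induction a, b using induction₂ with
    | hc =>
      exact isClosed_eq ((continuous_star' p).comp (continuous_fst.add continuous_snd))
        (((continuous_star' p).comp continuous_fst).add ((continuous_star' p).comp continuous_snd))
    | h a b => simp [star_of, ← of_add]

instance [StarModule ℂ A] : StarModule ℂ p.Completion where
  star_smul z a := by
    induction a using induction with
    | hc =>
      exact isClosed_eq ((continuous_star' p).comp (continuous_const_smul z))
        ((continuous_star' p).const_smul (star z))
    | h a => simp [star_of, ← of_smul]

instance : CStarRing p.Completion where
  norm_mul_self_le a := by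
    induction a using induction with
    | hc =>
      exact isClosed_le (continuous_norm.mul continuous_norm)
        (((continuous_star' p).mul continuous_id).norm)
    | h a => rw [star_of, ← of_mul, norm_of, norm_of, p.star_mul_self]

instance [StarModule ℂ A] : CStarAlgebra p.Completion where

end Completion

/-- The pointwise supremum of a pointwise bounded nonempty family of C*-seminorms. -/
def sup {ι : Type*} [Nonempty ι] (q : ι → CStarSeminorm A)
    (hq : ∀ a, BddAbove (Set.range fun i => q i a)) : CStarSeminorm A where
  toFun a := ⨆ i, q i a
  map_zero' := by simp
  add_le' a b := ciSup_le fun i => (map_add_le_add (q i).toSeminorm a b).trans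
    (add_le_add (le_ciSup (hq a) i) (le_ciSup (hq b) i))
  neg' a := by simp
  smul' z a := by
    simp only [map_smul_eq_mul]
    exact (Real.mul_iSup_of_nonneg (norm_nonneg z) _).symm
  mul_le' a b := ciSup_le fun i => ((q i).mul_le a b).trans
    (mul_le_mul (le_ciSup (hq a) i) (le_ciSup (hq b) i) ((q i).nonneg b)
      (((q i).nonneg a).trans (le_ciSup (hq a) i)))
  star_mul_self' a := by
    simp only [star_mul_self]
    have h0 : 0 ≤ ⨆ i, q i a := Real.iSup_nonneg fun i => (q i).nonneg a
    have hb : BddAbove (Set.range fun i => q i a * q i a) := by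
      simpa only [star_mul_self] using hq (star a * a)
    apply le_antisymm
    · exact ciSup_le fun i => mul_self_le_mul_self ((q i).nonneg a) (le_ciSup (hq a) i)
    · rw [← sq, ← Real.le_sqrt h0 (Real.iSup_nonneg fun i => mul_self_nonneg _)]
      exact ciSup_le fun i => Real.le_sqrt_of_sq_le (by rw [sq]; exact le_ciSup hb i)

/-- The zero seminorm. -/
instance : Inhabited (CStarSeminorm A) :=
  ⟨{ toSeminorm := 0,
      mul_le' := fun _ _ => (by change (0 : ℝ) ≤ 0 * 0; simp),
      star_mul_self' := fun _ => (by change (0 : ℝ) = 0 * 0; simp) }⟩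

end CStarSeminorm

/-- Generators and relations for a unital C*-algebra: a family of relations `a = b` between
elements of the free `*`-algebra which forces an upper bound on the norm of every generator. -/
structure CStarPresentation (X : Type*) where
  rel : FreeStarAlg X → FreeStarAlg X → Prop
  bounded : ∀ x, ∃ C : ℝ, ∀ p : CStarSeminorm (FreeStarAlg X),
    (∀ a b, rel a b → p (a - b) = 0) → p (FreeStarAlg.gen x) ≤ C

namespace CStarPresentation

variable {X : Type*} (P : CStarPresentation X)

/-- The C*-seminorms on the free `*`-algebra modulo which the relations hold. -/
def Admissible : Type _ :=
  {p : CStarSeminorm (FreeStarAlg X) // ∀ a b, P.rel a b → p (a - b) = 0}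

instance : Nonempty P.Admissible := ⟨⟨default, fun _ _ _ => rfl⟩⟩

theorem bddAbove (a : FreeStarAlg X) :
    BddAbove (Set.range fun p : P.Admissible => p.1 a) := by
  suffices h : ∃ C : ℝ, ∀ p : P.Admissible, p.1 a ≤ C by
    obtain ⟨C, hC⟩ := h
    exact ⟨C, by rintro _ ⟨p, rfl⟩; exact hC p⟩
  induction a using FreeStarAlg.induction with
  | hz z =>
    refine ⟨‖z‖, fun p => ?_⟩
    rw [Algebra.algebraMap_eq_smul_one, map_smul_eq_mul]
    exact mul_le_of_le_one_right (norm_nonneg z) p.1.one_le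
  | hl l =>
    obtain ⟨x, _ | _⟩ := l
    · obtain ⟨C, hC⟩ := P.bounded x
      exact ⟨C, fun p => hC p.1 p.2⟩
    · obtain ⟨C, hC⟩ := P.bounded x
      refine ⟨C, fun p => ?_⟩
      rw [← p.1.star_eq, FreeStarAlg.star_letter]
      exact hC p.1 p.2
  | ha a b iha ihb =>
    obtain ⟨C, hC⟩ := iha
    obtain ⟨D, hD⟩ := ihb
    exact ⟨C + D, fun p => (map_add_le_add p.1.toSeminorm a b).trans (add_le_add (hC p) (hD p))⟩
  | hm a b iha ihb =>
    obtain ⟨C, hC⟩ := iha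
    obtain ⟨D, hD⟩ := ihb
    exact ⟨C * D, fun p => (p.1.mul_le a b).trans
      (mul_le_mul (hC p) (hD p) (p.1.nonneg b) ((p.1.nonneg a).trans (hC p)))⟩

/-- The largest C*-seminorm on the free `*`-algebra modulo which the relations hold. -/
def universalSeminorm : CStarSeminorm (FreeStarAlg X) :=
  CStarSeminorm.sup (fun p : P.Admissible => p.1) P.bddAbove

/-- The universal unital C*-algebra with the given generators and relations. -/
abbrev Universal : Type _ := P.universalSeminorm.Completion

/-- The generators of the universal C*-algebra. -/
def universalGen (x : X) : P.Universal :=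
  CStarSeminorm.Completion.of P.universalSeminorm (FreeStarAlg.gen x)

end CStarPresentation

/-! ## Crossed products -/

section CrossedProducts

variable {A S : Type*} [NonUnitalCStarAlgebra A] [Monoid S]

/-- The relations of a covariant pair, for an action `α` of a monoid `S` by `*`-endomorphisms of a
C*-algebra `A`: a `*`-homomorphism on `A` (the generators `Sum.inl a`) and a representation of `S`
by isometries `V s` (the generators `Sum.inr s`), with `α s a = V s * a * (V s)*`.
If `S` is a group, then the isometries `V s` are unitaries. -/
inductive CovariantRel (α : S →* (A →⋆ₙₐ[ℂ] A)) : FreeStarAlg (A ⊕ S) → FreeStarAlg (A ⊕ S) → Prop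
  | add (a b : A) : CovariantRel α (.gen (.inl (a + b))) (.gen (.inl a) + .gen (.inl b))
  | smul (z : ℂ) (a : A) : CovariantRel α (.gen (.inl (z • a))) (z • .gen (.inl a))
  | mul (a b : A) : CovariantRel α (.gen (.inl (a * b))) (.gen (.inl a) * .gen (.inl b))
  | star (a : A) : CovariantRel α (.gen (.inl (star a))) (star (.gen (.inl a)))
  | isometry (s : S) : CovariantRel α (star (.gen (.inr s)) * .gen (.inr s)) 1
  | semigroup (s t : S) : CovariantRel α (.gen (.inr (s * t))) (.gen (.inr s) * .gen (.inr t))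
  | covariant (s : S) (a : A) : CovariantRel α (.gen (.inl (α s a)))
      (.gen (.inr s) * .gen (.inl a) * star (.gen (.inr s)))

theorem CStarSeminorm.le_one_of_isometry {X : Type*} (p : CStarSeminorm (FreeStarAlg X))
    {a : FreeStarAlg X} (h : p (star a * a - 1) = 0) : p a ≤ 1 := by
  have h1 := p.eq_of_sub h
  rw [p.star_mul_self] at h1
  nlinarith [p.nonneg a, p.one_le]

theorem CovariantRel.bounded (α : S →* (A →⋆ₙₐ[ℂ] A)) (x : A ⊕ S) :
    ∃ C : ℝ, ∀ p : CStarSeminorm (FreeStarAlg (A ⊕ S)),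
      (∀ a b, CovariantRel α a b → p (a - b) = 0) → p (FreeStarAlg.gen x) ≤ C := by
  obtain a | s := x
  · refine ⟨‖a‖, fun p hp => ?_⟩
    let φ : A →⋆ₙₐ[ℂ] p.Completion :=
      { toFun := fun a => CStarSeminorm.Completion.of p (.gen (.inl a))
        map_smul' := fun z a => by
          rw [MonoidHom.id_apply, ← CStarSeminorm.Completion.of_smul]
          exact CStarSeminorm.Completion.of_eq_of p (hp _ _ (.smul z a))
        map_zero' := by
          rw [← CStarSeminorm.Completion.of_zero]
          refine CStarSeminorm.Completion.of_eq_of p ?_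
          simpa using hp _ _ (.smul 0 0)
        map_add' := fun a b => by
          rw [← CStarSeminorm.Completion.of_add]
          exact CStarSeminorm.Completion.of_eq_of p (hp _ _ (.add a b))
        map_mul' := fun a b => by
          rw [← CStarSeminorm.Completion.of_mul]
          exact CStarSeminorm.Completion.of_eq_of p (hp _ _ (.mul a b))
        map_star' := fun a => by
          rw [CStarSeminorm.Completion.star_of]
          exact CStarSeminorm.Completion.of_eq_of p (hp _ _ (.star a)) }
    rw [← CStarSeminorm.Completion.norm_of]
    exact NonUnitalStarAlgHom.norm_apply_le φ a
  · exact ⟨1, fun p hp => p.le_one_of_isometry (hp _ _ (.isometry s))⟩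

end CrossedProducts

section SemigroupCrossedProduct

variable {A S : Type*} [CStarAlgebra A] [Monoid S]

/-- The relations of a covariant pair for a unital C*-algebra, where in addition the
`*`-homomorphism on `A` is unital. -/
inductive UnitalCovariantRel (α : S →* (A →⋆ₙₐ[ℂ] A)) :
    FreeStarAlg (A ⊕ S) → FreeStarAlg (A ⊕ S) → Prop
  | covariantRel {a b : FreeStarAlg (A ⊕ S)} (h : CovariantRel α a b) : UnitalCovariantRel α a b
  | one : UnitalCovariantRel α (.gen (.inl 1)) 1

/-- The presentation of the semigroup crossed product. -/
def semigroupCrossedPresentation (α : S →* (A →⋆ₙₐ[ℂ] A)) : CStarPresentation (A ⊕ S) where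
  rel := UnitalCovariantRel α
  bounded x := by
    obtain ⟨C, hC⟩ := CovariantRel.bounded α x
    exact ⟨C, fun p hp => hC p fun a b h => hp a b (.covariantRel h)⟩

/-- The semigroup crossed product `A ⋊ S` of a unital C*-algebra `A` by an action `α` of a
semigroup `S` by (not necessarily unital) endomorphisms: the universal C*-algebra for covariant
pairs, consisting of a unital `*`-homomorphism on `A` and a representation of `S` by isometries. -/
abbrev SemigroupCrossedProduct (α : S →* (A →⋆ₙₐ[ℂ] A)) : Type _ :=
  (semigroupCrossedPresentation α).Universal

namespace SemigroupCrossedProduct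

/-- The canonical map of `A` into `A ⋊ S`. -/
def ofAlg (α : S →* (A →⋆ₙₐ[ℂ] A)) (a : A) : SemigroupCrossedProduct α :=
  (semigroupCrossedPresentation α).universalGen (.inl a)

/-- The isometries in `A ⋊ S` which implement the action. -/
def isom (α : S →* (A →⋆ₙₐ[ℂ] A)) (s : S) : SemigroupCrossedProduct α :=
  (semigroupCrossedPresentation α).universalGen (.inr s)

end SemigroupCrossedProduct

end SemigroupCrossedProduct

section GroupCrossedProduct

variable {A G : Type*} [NonUnitalCStarAlgebra A] [Group G]

/-- The presentation of the universal unital C*-algebra of covariant pairs for an action of a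
discrete group. -/
def covariantPresentation (α : G →* (A →⋆ₙₐ[ℂ] A)) : CStarPresentation (A ⊕ G) where
  rel := CovariantRel α
  bounded := CovariantRel.bounded α

namespace CrossedProduct

/-- The universal unital C*-algebra generated by a covariant pair; it contains both the crossed
product and its implementing unitaries. -/
abbrev Ambient (α : G →* (A →⋆ₙₐ[ℂ] A)) : Type _ := (covariantPresentation α).Universal

/-- The canonical map on `A`. -/
def ofAlg (α : G →* (A →⋆ₙₐ[ℂ] A)) (a : A) : Ambient α :=
  (covariantPresentation α).universalGen (.inl a)

/-- The unitaries which implement the action. -/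
def unit (α : G →* (A →⋆ₙₐ[ℂ] A)) (g : G) : Ambient α :=
  (covariantPresentation α).universalGen (.inr g)

end CrossedProduct

/-- The (full) crossed product `A ⋊ G` by an action of a discrete group: the C*-algebra generated
by the products `a * U g` of the universal covariant pair. -/
def CrossedProduct (α : G →* (A →⋆ₙₐ[ℂ] A)) :
    NonUnitalStarSubalgebra ℂ (CrossedProduct.Ambient α) :=
  (NonUnitalStarAlgebra.adjoin ℂ
    {b | ∃ a g, b = CrossedProduct.ofAlg α a * CrossedProduct.unit α g}).topologicalClosure

end GroupCrossedProduct

/-! ## The Toeplitz algebra of the `ax+b`-semigroup of a ring -/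

section Toeplitz

open scoped nonZeroDivisors

variable (R : Type*) [CommRing R] [IsDomain R]

/-- The nonzero ideals of `R`. -/
abbrev NonzeroIdeal : Type _ := {I : Ideal R // I ≠ ⊥}

variable {R}

namespace NonzeroIdeal

/-- The ideal `I ∩ J`. -/
def inter (I J : NonzeroIdeal R) : NonzeroIdeal R :=
  ⟨I.1 ⊓ J.1, fun h => mul_ne_zero I.2 J.2 (le_bot_iff.1 (Ideal.mul_le_inf.trans h.le))⟩

/-- The ideal `aI`. -/
def dilate (a : R⁰) (I : NonzeroIdeal R) : NonzeroIdeal R :=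
  ⟨Ideal.span {(a : R)} * I.1,
    mul_ne_zero (by simp) I.2⟩

/-- The ideal `R`. -/
def whole : NonzeroIdeal R := ⟨⊤, top_ne_bot⟩

end NonzeroIdeal

/-- The generators `u^x`, `s_a` and `e_I` of the Toeplitz algebra. -/
inductive ToeplitzGen (R : Type*) [CommRing R] [IsDomain R]
  | u (x : R)
  | s (a : R⁰)
  | e (I : NonzeroIdeal R)

open FreeStarAlg (gen) in
/-- The relations defining the Toeplitz algebra. -/
inductive ToeplitzRel : FreeStarAlg (ToeplitzGen R) → FreeStarAlg (ToeplitzGen R) → Prop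
  | u_star_mul (x : R) : ToeplitzRel (star (gen (.u x)) * gen (.u x)) 1
  | u_mul_star (x : R) : ToeplitzRel (gen (.u x) * star (gen (.u x))) 1
  | u_add (x y : R) : ToeplitzRel (gen (.u x) * gen (.u y)) (gen (.u (x + y)))
  | s_isometry (a : R⁰) : ToeplitzRel (star (gen (.s a)) * gen (.s a)) 1
  | s_mul (a b : R⁰) : ToeplitzRel (gen (.s a) * gen (.s b)) (gen (.s (a * b)))
  | s_u (a : R⁰) (x : R) :
      ToeplitzRel (gen (.s a) * gen (.u x)) (gen (.u (a * x)) * gen (.s a))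
  | e_star (I : NonzeroIdeal R) : ToeplitzRel (star (gen (.e I))) (gen (.e I))
  | e_idem (I : NonzeroIdeal R) : ToeplitzRel (gen (.e I) * gen (.e I)) (gen (.e I))
  | e_inter (I J : NonzeroIdeal R) :
      ToeplitzRel (gen (.e (I.inter J))) (gen (.e I) * gen (.e J))
  | e_whole : ToeplitzRel (gen (.e .whole)) 1
  | s_e (a : R⁰) (I : NonzeroIdeal R) :
      ToeplitzRel (gen (.s a) * gen (.e I) * star (gen (.s a))) (gen (.e (I.dilate a)))
  | u_e_mem (x : R) (I : NonzeroIdeal R) (h : x ∈ I.1) :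
      ToeplitzRel (gen (.u x) * gen (.e I)) (gen (.e I) * gen (.u x))
  | u_e_notMem (x : R) (I : NonzeroIdeal R) (h : x ∉ I.1) :
      ToeplitzRel (gen (.e I) * gen (.u x) * gen (.e I)) 0

variable (R) in
/-- The presentation of the Toeplitz algebra. -/
def toeplitzPresentation : CStarPresentation (ToeplitzGen R) where
  rel := ToeplitzRel
  bounded x := by
    refine ⟨1, fun p hp => ?_⟩
    cases x with
    | u x => exact p.le_one_of_isometry (hp _ _ (.u_star_mul x))
    | s a => exact p.le_one_of_isometry (hp _ _ (.s_isometry a))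
    | e I =>
      have h1 := p.star_mul_self (.gen (.e I))
      have h2 : p (star (.gen (.e I)) * .gen (.e I)) ≤ p (.gen (.e I)) := by
        have h3 : p ((star (.gen (.e I)) - .gen (.e I)) * .gen (.e I)) = 0 :=
          le_antisymm ((p.mul_le _ _).trans (by rw [hp _ _ (.e_star I), zero_mul])) (p.nonneg _)
        rw [sub_mul] at h3
        rw [p.eq_of_sub h3, p.eq_of_sub (hp _ _ (.e_idem I))]
      rw [h1] at h2
      nlinarith [p.nonneg (.gen (.e I))]

variable (R) in
/-- The Toeplitz algebra of `R`: the universal C*-algebra generated by unitaries `u^x` (`x ∈ R`),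
isometries `s_a` (`a ≠ 0`) and projections `e_I` (`I` a nonzero ideal) with the relations above. -/
abbrev ToeplitzAlgebra : Type _ := (toeplitzPresentation R).Universal

namespace ToeplitzAlgebra

/-- The unitary `u^x`. -/
def u (x : R) : ToeplitzAlgebra R := (toeplitzPresentation R).universalGen (.u x)

/-- The isometry `s_a`. -/
def s (a : R⁰) : ToeplitzAlgebra R := (toeplitzPresentation R).universalGen (.s a)

/-- The projection `e_I`. -/
def e (I : NonzeroIdeal R) : ToeplitzAlgebra R := (toeplitzPresentation R).universalGen (.e I)

end ToeplitzAlgebra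

end Toeplitz

/-! ## The `ax+b`-semigroup -/

section AxB

open scoped nonZeroDivisors

/-- The semidirect product of the additive group `R` by the multiplicative semigroup of nonzero
elements of the domain `R`, acting by multiplication. -/
@[ext]
structure AxB (R : Type*) [CommRing R] [IsDomain R] where
  /-- the additive component `m` of `(m, k)` -/
  add : R
  /-- the multiplicative component `k` of `(m, k)` -/
  mul : R⁰

namespace AxB

variable {R : Type*} [CommRing R] [IsDomain R]

instance : Mul (AxB R) := ⟨fun g h => ⟨g.add + g.mul * h.add, g.mul * h.mul⟩⟩
instance : One (AxB R) := ⟨⟨0, 1⟩⟩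

@[simp] theorem mul_add' (g h : AxB R) : (g * h).add = g.add + g.mul * h.add := rfl
@[simp] theorem mul_mul' (g h : AxB R) : (g * h).mul = g.mul * h.mul := rfl
@[simp] theorem one_add' : (1 : AxB R).add = 0 := rfl
@[simp] theorem one_mul' : (1 : AxB R).mul = 1 := rfl

instance : Monoid (AxB R) where
  mul_assoc g h k := by
    ext
    · simp; ring
    · simp [mul_assoc]
  one_mul g := by ext <;> simp
  mul_one g := by ext <;> simp

/-- For a field `K`, this is the group `K ⋊ K*`. -/
instance {K : Type*} [Field K] : Group (AxB K) where
  inv g := ⟨-((g.mul : K)⁻¹ * g.add), ⟨(g.mul : K)⁻¹, mem_nonZeroDivisors_of_ne_zero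
    (inv_ne_zero (nonZeroDivisors.ne_zero g.mul.2))⟩⟩
  inv_mul_cancel g := by
    have h := nonZeroDivisors.ne_zero g.mul.2
    ext
    · change -((g.mul : K)⁻¹ * g.add) + (g.mul : K)⁻¹ * g.add = 0
      ring
    · change (g.mul : K)⁻¹ * g.mul = 1
      exact inv_mul_cancel₀ h

/-- The inclusion of the `ax+b`-semigroup of `R` into the `ax+b`-group of a field containing `R`. -/
def map (R K : Type*) [CommRing R] [IsDomain R] [Field K] [Algebra R K] [FaithfulSMul R K] :
    AxB R →* AxB K where
  toFun g := ⟨algebraMap R K g.add, ⟨algebraMap R K g.mul, mem_nonZeroDivisors_of_ne_zero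
    (by simp)⟩⟩
  map_one' := by
    ext
    · exact map_zero _
    · exact map_one _
  map_mul' g h := by
    ext
    · change algebraMap R K (g.add + g.mul * h.add) = _
      simp
    · change algebraMap R K (g.mul * h.mul) = _
      simp

end AxB

end AxB

/-! ## Finite adeles and the space `Ω` -/

section Adeles

open IsDedekindDomain NumberField
open scoped NumberField nonZeroDivisors WithZero Topology ZeroAtInfty

variable (K : Type*) [Field K] [NumberField K]

theorem finite_residueField_adicCompletionIntegers (v : HeightOneSpectrum (𝓞 K)) :
    Finite (IsLocalRing.ResidueField (v.adicCompletionIntegers K)) := by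
  have hfin : Finite (𝓞 K ⧸ v.asIdeal) := v.asIdeal.finiteQuotientOfFreeOfNeBot v.ne_bot
  let f : 𝓞 K →+* IsLocalRing.ResidueField (v.adicCompletionIntegers K) :=
    (IsLocalRing.residue _).comp (algebraMap (𝓞 K) (v.adicCompletionIntegers K))
  have key : ∀ y : v.adicCompletionIntegers K, Valued.v (y : v.adicCompletion K) < 1 →
      IsLocalRing.residue _ y = 0 := by
    intro y hy
    rw [IsLocalRing.residue_eq_zero_iff, IsLocalRing.mem_maximalIdeal, mem_nonunits_iff,
      HeightOneSpectrum.adicCompletionIntegers.isUnit_iff_valued_eq_one]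
    exact hy.ne
  have hf : ∀ r ∈ v.asIdeal, f r = 0 := by
    intro r hr
    refine key _ ?_
    rw [HeightOneSpectrum.algebraMap_adicCompletionIntegers_apply,
      HeightOneSpectrum.valuedAdicCompletion_eq_valuation']
    exact (v.valuation_lt_one_iff_mem (K := K) r).2 hr
  have hs : Function.Surjective (Ideal.Quotient.lift v.asIdeal f hf) := by
    intro y
    obtain ⟨y, rfl⟩ := IsLocalRing.residue_surjective y
    have hd : DenseRange (algebraMap K (v.adicCompletion K)) := v.denseRange_algebraMap K
    have ho : IsOpen {z : v.adicCompletion K | Valued.v (z - (y : v.adicCompletion K)) < 1} := by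
      have h1 : IsOpen {x : v.adicCompletion K | Valued.v x < 1} := by
        simpa only [Valuation.restrict_lt_one_iff] using Valued.isOpen_ball (v.adicCompletion K) 1
      exact h1.preimage (continuous_id.sub continuous_const)
    obtain ⟨x, hx⟩ := hd.exists_mem_open ho ⟨y, by simp⟩
    have hx1 : v.valuation K x ≤ 1 := by
      rw [← HeightOneSpectrum.valuedAdicCompletion_eq_valuation']
      have := Valued.v.map_add ((x : v.adicCompletion K) - y) y
      rw [sub_add_cancel] at this
      exact this.trans (max_le (le_of_lt hx) y.2)
    obtain ⟨a, ha⟩ := v.exists_valuation_sub_lt_of_integer hx1 1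
    refine ⟨Ideal.Quotient.mk _ a, ?_⟩
    rw [Ideal.Quotient.lift_mk, ← sub_eq_zero]
    simp only [f, RingHom.comp_apply]
    rw [← map_sub]
    refine key _ ?_
    have h2 : ((algebraMap (𝓞 K) (v.adicCompletionIntegers K) a - y :
        v.adicCompletionIntegers K) : v.adicCompletion K) =
        ((algebraMap (𝓞 K) K a - x : K) : v.adicCompletion K) + ((x : v.adicCompletion K) - y) := by
      have h3 := map_sub (algebraMap K (v.adicCompletion K)) (algebraMap (𝓞 K) K a) x
      have h4 : ((algebraMap (𝓞 K) K a - x : K) : v.adicCompletion K) =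
        ((algebraMap (𝓞 K) K a : K) : v.adicCompletion K) - (x : v.adicCompletion K) := h3
      rw [h4]
      simp
    rw [h2]
    refine (Valued.v.map_add _ _).trans_lt (max_lt ?_ hx)
    rw [HeightOneSpectrum.valuedAdicCompletion_eq_valuation']
    exact ha
  exact Finite.of_surjective _ hs

instance compactSpace_adicCompletionIntegers (v : HeightOneSpectrum (𝓞 K)) :
    CompactSpace (v.adicCompletionIntegers K) := by
  have h1 : IsDiscreteValuationRing (Valued.integer (v.adicCompletion K)) :=
    inferInstanceAs (IsDiscreteValuationRing (v.adicCompletionIntegers K))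
  have h2 : Finite (Valued.ResidueField (v.adicCompletion K)) :=
    finite_residueField_adicCompletionIntegers K v
  have h3 : CompleteSpace (Valued.integer (v.adicCompletion K)) :=
    (Valued.isClosed_integer _).completeSpace_coe
  exact Valued.integer.compactSpace_iff_completeSpace_and_isDiscreteValuationRing_and_finite_residueField.2 ⟨h3, h1, h2⟩

/-- The ring of finite adeles of `K`. -/
abbrev FinAdele : Type _ := FiniteAdeleRing (𝓞 K) K

/-- The ring of integral adeles, as a subring of the finite adeles. -/
def integralAdeles : Subring (FinAdele K) where
  carrier := {x | ∀ v, x v ∈ v.adicCompletionIntegers K}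
  mul_mem' hx hy v := mul_mem (hx v) (hy v)
  one_mem' _ := one_mem _
  add_mem' hx hy v := add_mem (hx v) (hy v)
  zero_mem' _ := zero_mem _
  neg_mem' hx v := neg_mem (hx v)

theorem isOpen_integralAdeles : IsOpen (integralAdeles K : Set (FinAdele K)) :=
  RestrictedProduct.isOpen_forall_mem
    (R := fun v : HeightOneSpectrum (𝓞 K) => v.adicCompletion K)
    (A := fun v : HeightOneSpectrum (𝓞 K) => (v.adicCompletionIntegers K :
      Set (v.adicCompletion K)))
    fun v => Valued.isOpen_valuationSubring (v.adicCompletion K)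

theorem isClopen_integralAdeles : IsClopen (integralAdeles K : Set (FinAdele K)) :=
  ⟨AddSubgroup.isClosed_of_isOpen (integralAdeles K).toAddSubgroup (isOpen_integralAdeles K),
    isOpen_integralAdeles K⟩

theorem isCompact_integralAdeles : IsCompact (integralAdeles K : Set (FinAdele K)) := by
  have h0 : ∀ v : HeightOneSpectrum (𝓞 K), CompactSpace (v.adicCompletionIntegers K :
      Set (v.adicCompletion K)) := fun v => compactSpace_adicCompletionIntegers K v
  have h := isCompact_range (RestrictedProduct.isEmbedding_structureMap
    (R := fun v : HeightOneSpectrum (𝓞 K) => v.adicCompletion K)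
    (A := fun v : HeightOneSpectrum (𝓞 K) => (v.adicCompletionIntegers K :
      Set (v.adicCompletion K))) (𝓕 := Filter.cofinite)).continuous
  rw [RestrictedProduct.range_structureMap] at h
  exact h

variable {K}

/-- For a nonzero ideal `I` of the ring of integers, the additive group `I R̂` of those integral
adeles `x` for which the exponent of `x` at every prime `P` is at least the exponent of `P` in `I`.
(The valuation at `P` is written multiplicatively, so an exponent `n` corresponds to the valuation
`exp (-n)`.) -/
def idealAdeles (I : NonzeroIdeal (𝓞 K)) : AddSubgroup (FinAdele K) where
  carrier := {x | ∀ v : HeightOneSpectrum (𝓞 K),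
    Valued.v (x v) ≤ WithZero.exp (-(multiplicity v.asIdeal I.1 : ℤ))}
  add_mem' {x y} hx hy v := (Valued.v.map_add (x v) (y v)).trans (max_le (hx v) (hy v))
  zero_mem' v := by
    change Valued.v (0 : v.adicCompletion K) ≤ _
    rw [map_zero]
    exact zero_le
  neg_mem' {x} hx v := by
    change Valued.v (-(x v)) ≤ _
    rw [Valuation.map_neg]
    exact hx v

theorem idealAdeles_mul_mem {I : NonzeroIdeal (𝓞 K)} {x c : FinAdele K}
    (hx : x ∈ idealAdeles I) (hc : c ∈ integralAdeles K) : x * c ∈ idealAdeles I := by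
  intro v
  change Valued.v (x v * c v) ≤ _
  rw [map_mul]
  exact (mul_le_of_le_one_right' (hc v)).trans (hx v)

theorem algebraMap_mem_idealAdeles {I : NonzeroIdeal (𝓞 K)} {y : 𝓞 K} (hy : y ∈ I.1) :
    algebraMap K (FinAdele K) y ∈ idealAdeles I := by
  intro v
  rw [FiniteAdeleRing.algebraMap_apply, HeightOneSpectrum.valuedAdicCompletion_eq_valuation']
  change v.valuation K (algebraMap (𝓞 K) K y) ≤ _
  rw [HeightOneSpectrum.valuation_of_algebraMap, HeightOneSpectrum.intValuation_le_pow_iff_dvd]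
  exact (pow_multiplicity_dvd _ _).trans (Ideal.dvd_span_singleton.2 hy)

/-- An element of the ring of integers lies in `I R̂` if and only if it lies in `I`. -/
theorem algebraMap_mem_idealAdeles_iff {I : NonzeroIdeal (𝓞 K)} {y : 𝓞 K} :
    algebraMap K (FinAdele K) y ∈ idealAdeles I ↔ y ∈ I.1 := by
  refine ⟨fun h => ?_, algebraMap_mem_idealAdeles⟩
  rw [← Ideal.dvd_span_singleton, UniqueFactorizationMonoid.dvd_iff_emultiplicity_le I.2]
  intro p hp
  have hv := h ⟨p, Ideal.isPrime_of_prime hp, hp.ne_zero⟩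
  rw [FiniteAdeleRing.algebraMap_apply,
    HeightOneSpectrum.valuedAdicCompletion_eq_valuation'] at hv
  change HeightOneSpectrum.valuation K _ (algebraMap (𝓞 K) K y) ≤ _ at hv
  rw [HeightOneSpectrum.valuation_of_algebraMap,
    HeightOneSpectrum.intValuation_le_exp_iff_le_emultiplicity] at hv
  rwa [(FiniteMultiplicity.of_prime_left hp I.2).emultiplicity_eq_multiplicity]

theorem isClopen_idealAdeles (I : NonzeroIdeal (𝓞 K)) :
    IsClopen (idealAdeles I : Set (FinAdele K)) := by
  obtain ⟨y, hy, hy0⟩ := Submodule.exists_mem_ne_zero_of_ne_bot I.2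
  have hyK : (y : K) ≠ 0 := by exact_mod_cast hy0
  have hc : Continuous fun x : FinAdele K => algebraMap K (FinAdele K) (y : K)⁻¹ * x :=
    continuous_const.mul continuous_id
  have hn : (idealAdeles I : Set (FinAdele K)) ∈ 𝓝 (0 : FinAdele K) := by
    refine Filter.mem_of_superset (((isOpen_integralAdeles K).preimage hc).mem_nhds ?_) ?_
    · simp [zero_mem]
    · intro x hx
      have := idealAdeles_mul_mem (algebraMap_mem_idealAdeles hy) hx
      rwa [← mul_assoc, ← map_mul, mul_inv_cancel₀ hyK, map_one, one_mul] at this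
  have ho := AddSubgroup.isOpen_of_mem_nhds _ hn
  exact ⟨AddSubgroup.isClosed_of_isOpen _ ho, ho⟩

variable (K)

/-- The equivalence relation on pairs of finite adeles for which `(r, a)` and `(s, b)` are
equivalent if `b ∈ a R̂*` and `s - r ∈ a R̂`. -/
def omegaSetoid : Setoid (FinAdele K × FinAdele K) where
  r x y := (∃ w : (integralAdeles K)ˣ, y.2 = x.2 * (w : integralAdeles K)) ∧
    ∃ c ∈ integralAdeles K, y.1 - x.1 = x.2 * c
  iseqv :=
    { refl := fun x => ⟨⟨1, by simp⟩, 0, zero_mem _, by simp⟩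
      symm := by
        rintro x y ⟨⟨w, hw⟩, c, hc, h⟩
        have hww : ((w : integralAdeles K) : FinAdele K) * ((w⁻¹ : (integralAdeles K)ˣ) :
            integralAdeles K) = 1 := by
          rw [← Subring.coe_mul, Units.mul_inv, Subring.coe_one]
        refine ⟨⟨w⁻¹, by rw [hw, mul_assoc, hww, mul_one]⟩,
          -(((w⁻¹ : (integralAdeles K)ˣ) : integralAdeles K) * c),
          neg_mem (mul_mem (SetLike.coe_mem _) hc), ?_⟩
        rw [hw, ← neg_sub, h]
        linear_combination x.2 * c * hww
      trans := by
        rintro x y z ⟨⟨w, hw⟩, c, hc, h⟩ ⟨⟨w', hw'⟩, c', hc', h'⟩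
        refine ⟨⟨w * w', by rw [hw', hw, Units.val_mul, Subring.coe_mul, mul_assoc]⟩,
          c + (w : integralAdeles K) * c', add_mem hc (mul_mem (SetLike.coe_mem _) hc'), ?_⟩
        rw [hw] at h'
        linear_combination h + h' }

/-- The space of equivalence classes of pairs of finite adeles, with the quotient topology. -/
def OmegaA : Type _ := Quotient (omegaSetoid K)

instance : TopologicalSpace (OmegaA K) :=
  inferInstanceAs (TopologicalSpace (Quotient (omegaSetoid K)))

variable {K}

/-- The class of the pair `(r, a)`. -/
def omega (r a : FinAdele K) : OmegaA K := Quotient.mk (omegaSetoid K) (r, a)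

theorem continuous_omega : Continuous fun x : FinAdele K × FinAdele K => omega x.1 x.2 :=
  continuous_quot_mk

theorem isClopen_omega_iff {s : Set (OmegaA K)} :
    IsClopen s ↔ IsClopen ((fun x : FinAdele K × FinAdele K => omega x.1 x.2) ⁻¹' s) :=
  (isQuotientMap_quot_mk (r := (omegaSetoid K).r)).isClopen_preimage.symm

theorem omega_eq {r a s b : FinAdele K} : omega r a = omega s b ↔
    (∃ w : (integralAdeles K)ˣ, b = a * (w : integralAdeles K)) ∧
      ∃ c ∈ integralAdeles K, s - r = a * c :=
  Quotient.eq (r := omegaSetoid K)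

/-- The action `(m, k) ω_{r,a} = ω_{m + kr, ka}` of `K ⋊ K*`. -/
instance : MulAction (AxB K) (OmegaA K) where
  smul g := Quotient.map
    (fun x => (algebraMap K (FinAdele K) g.add + algebraMap K (FinAdele K) g.mul * x.1,
      algebraMap K (FinAdele K) g.mul * x.2)) (by
    rintro x y ⟨⟨w, hw⟩, c, hc, h⟩
    refine ⟨⟨w, by simp only [hw, mul_assoc]⟩, c, hc, ?_⟩
    linear_combination algebraMap K (FinAdele K) g.mul * h)
  one_smul x := by
    induction x using Quotient.inductionOn with
    | h x =>
      change omega (algebraMap K (FinAdele K) 0 + algebraMap K (FinAdele K) 1 * x.1)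
        (algebraMap K (FinAdele K) 1 * x.2) = omega x.1 x.2
      simp
  mul_smul g h x := by
    induction x using Quotient.inductionOn with
    | h x =>
      change omega (algebraMap K (FinAdele K) (g.add + g.mul * h.add) +
          algebraMap K (FinAdele K) (g.mul * h.mul : K) * x.1)
          (algebraMap K (FinAdele K) (g.mul * h.mul : K) * x.2) =
        omega (algebraMap K (FinAdele K) g.add + algebraMap K (FinAdele K) g.mul *
          (algebraMap K (FinAdele K) h.add + algebraMap K (FinAdele K) h.mul * x.1))
          (algebraMap K (FinAdele K) g.mul * (algebraMap K (FinAdele K) h.mul * x.2))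
      simp only [map_add, map_mul]
      congr 1 <;> ring

theorem smul_omega (g : AxB K) (r a : FinAdele K) :
    g • omega r a = omega
      (algebraMap K (FinAdele K) g.add + algebraMap K (FinAdele K) g.mul * r)
      (algebraMap K (FinAdele K) g.mul * a) := rfl

instance : ContinuousConstSMul (AxB K) (OmegaA K) where
  continuous_const_smul g := by
    refine (isQuotientMap_quot_mk (r := (omegaSetoid K).r)).continuous_iff.2 ?_
    exact continuous_omega.comp ((continuous_const.add (continuous_const.mul continuous_fst)).prodMk
      (continuous_const.mul continuous_snd))

variable (K) in
/-- The compact open subset of classes of pairs of integral adeles. -/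
def OmegaR : Set (OmegaA K) :=
  {x | ∃ r ∈ integralAdeles K, ∃ a ∈ integralAdeles K, x = omega r a}

theorem omega_mem_OmegaR {r a : FinAdele K} :
    omega r a ∈ OmegaR K ↔ r ∈ integralAdeles K ∧ a ∈ integralAdeles K := by
  refine ⟨?_, fun h => ⟨r, h.1, a, h.2, rfl⟩⟩
  rintro ⟨s, hs, b, hb, h⟩
  obtain ⟨⟨w, rfl⟩, c, hc, h⟩ := omega_eq.1 h.symm
  rw [sub_eq_iff_eq_add] at h
  rw [h]
  exact ⟨add_mem (mul_mem hb hc) hs, mul_mem hb (SetLike.coe_mem _)⟩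

theorem isClopen_OmegaR : IsClopen (OmegaR K) := by
  rw [isClopen_omega_iff]
  convert (isClopen_integralAdeles K).prod (isClopen_integralAdeles K) using 1
  ext x
  exact omega_mem_OmegaR

theorem isCompact_OmegaR : IsCompact (OmegaR K) := by
  convert ((isCompact_integralAdeles K).prod (isCompact_integralAdeles K)).image
    continuous_omega using 1
  ext x
  constructor
  · rintro ⟨r, hr, a, ha, rfl⟩
    exact ⟨(r, a), ⟨hr, ha⟩, rfl⟩
  · rintro ⟨⟨r, a⟩, ⟨hr, ha⟩, rfl⟩
    exact ⟨r, hr, a, ha, rfl⟩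

instance : CompactSpace (OmegaR K) := isCompact_iff_compactSpace.1 isCompact_OmegaR

theorem smul_mem_OmegaR (g : AxB (𝓞 K)) {x : OmegaA K} (hx : x ∈ OmegaR K) :
    AxB.map (𝓞 K) K g • x ∈ OmegaR K := by
  have h : ∀ y : 𝓞 K, algebraMap K (FinAdele K) (algebraMap (𝓞 K) K y) ∈ integralAdeles K :=
    fun y v => HeightOneSpectrum.coe_algebraMap_mem (𝓞 K) K v y
  obtain ⟨r, hr, a, ha, rfl⟩ := hx
  exact omega_mem_OmegaR.2 ⟨add_mem (h _) (mul_mem (h _) hr), mul_mem (h _) ha⟩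

open Classical in
/-- Extension by zero of a continuous function on `Ω_R`. -/
def extendZero (f : C(OmegaR K, ℂ)) : C₀(OmegaA K, ℂ) where
  toFun x := if h : x ∈ OmegaR K then f ⟨x, h⟩ else 0
  continuous_toFun := by
    rw [continuous_iff_continuousAt]
    intro x
    by_cases hx : x ∈ OmegaR K
    · rw [← (isClopen_OmegaR.isOpen.isOpenEmbedding_subtypeVal).continuousAt_iff (x := ⟨x, hx⟩)]
      have : ((fun x => if h : x ∈ OmegaR K then f ⟨x, h⟩ else 0) ∘
          (Subtype.val : OmegaR K → OmegaA K)) = f := by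
        ext y
        simp
      rw [this]
      exact f.continuous.continuousAt
    · refine (continuousAt_const (y := (0 : ℂ))).congr ?_
      filter_upwards [isClopen_OmegaR.compl.isOpen.mem_nhds hx] with y hy
      rw [dif_neg hy]
  zero_at_infty' := by
    refine tendsto_const_nhds.congr' ?_
    filter_upwards [isCompact_OmegaR.compl_mem_cocompact] with y hy
    have hy' : y ∉ OmegaR K := hy
    simp [hy']

theorem extendZero_apply (f : C(OmegaR K, ℂ)) (x : OmegaR K) : extendZero f x = f x :=
  dif_pos x.2

theorem extendZero_of_notMem (f : C(OmegaR K, ℂ)) {x : OmegaA K} (hx : x ∉ OmegaR K) :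
    extendZero f x = 0 :=
  dif_neg hx

variable (K)

/-- The action of `K ⋊ K*` on `C₀(Ω)` by `(g f)(x) = f (g⁻¹ x)`. -/
def omegaAction : AxB K →* (C₀(OmegaA K, ℂ) →⋆ₙₐ[ℂ] C₀(OmegaA K, ℂ)) where
  toFun g :=
    { toFun := fun f => f.comp (Homeomorph.smul g⁻¹).toCocompactMap
      map_smul' := fun _ _ => rfl
      map_zero' := rfl
      map_add' := fun _ _ => rfl
      map_mul' := fun _ _ => rfl
      map_star' := fun _ => rfl }
  map_one' := by
    ext f x
    change f ((1 : AxB K)⁻¹ • x) = f x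
    simp
  map_mul' g h := by
    ext f x
    change f ((g * h)⁻¹ • x) = f (h⁻¹ • g⁻¹ • x)
    rw [mul_inv_rev, mul_smul]

variable {K}

theorem omegaAction_apply (g : AxB K) (f : C₀(OmegaA K, ℂ)) (x : OmegaA K) :
    omegaAction K g f x = f (g⁻¹ • x) := rfl

/-- The function on `Ω_R` whose value at `x` is `f (g⁻¹ x)` if `x ∈ g Ω_R`, and is `0` if not. -/
def pushOmegaR (g : AxB (𝓞 K)) (f : C(OmegaR K, ℂ)) : C(OmegaR K, ℂ) :=
  (omegaAction K (AxB.map (𝓞 K) K g) (extendZero f) : C(OmegaA K, ℂ)).restrict (OmegaR K)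

theorem pushOmegaR_apply (g : AxB (𝓞 K)) (f : C(OmegaR K, ℂ)) (x : OmegaR K) :
    pushOmegaR g f x = extendZero f ((AxB.map (𝓞 K) K g)⁻¹ • (x : OmegaA K)) := rfl

theorem extendZero_pushOmegaR (g : AxB (𝓞 K)) (f : C(OmegaR K, ℂ)) (x : OmegaA K) :
    extendZero (pushOmegaR g f) x = extendZero f ((AxB.map (𝓞 K) K g)⁻¹ • x) := by
  by_cases hx : x ∈ OmegaR K
  · exact extendZero_apply _ ⟨x, hx⟩
  · rw [extendZero_of_notMem _ hx, extendZero_of_notMem]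
    intro h
    apply hx
    simpa using smul_mem_OmegaR g h

variable (K)

/-- The action of the semigroup `R ⋊ R^×` on `C(Ω_R)` by endomorphisms. -/
def omegaSemigroupAction : AxB (𝓞 K) →* (C(OmegaR K, ℂ) →⋆ₙₐ[ℂ] C(OmegaR K, ℂ)) where
  toFun g :=
    { toFun := pushOmegaR g
      map_smul' := fun z f => by
        ext x
        by_cases hx : (AxB.map (𝓞 K) K g)⁻¹ • (x : OmegaA K) ∈ OmegaR K <;>
          simp [pushOmegaR_apply, extendZero, hx]
      map_zero' := by
        ext x
        simp [pushOmegaR_apply, extendZero]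
      map_add' := fun f f' => by
        ext x
        by_cases hx : (AxB.map (𝓞 K) K g)⁻¹ • (x : OmegaA K) ∈ OmegaR K <;>
          simp [pushOmegaR_apply, extendZero, hx]
      map_mul' := fun f f' => by
        ext x
        by_cases hx : (AxB.map (𝓞 K) K g)⁻¹ • (x : OmegaA K) ∈ OmegaR K <;>
          simp [pushOmegaR_apply, extendZero, hx]
      map_star' := fun f => by
        ext x
        by_cases hx : (AxB.map (𝓞 K) K g)⁻¹ • (x : OmegaA K) ∈ OmegaR K <;>
          simp [pushOmegaR_apply, extendZero, hx] }
  map_one' := by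
    ext f x
    change pushOmegaR 1 f x = f x
    rw [pushOmegaR_apply, map_one, inv_one, one_smul, extendZero_apply]
  map_mul' g h := by
    ext f x
    change pushOmegaR (g * h) f x = pushOmegaR g (pushOmegaR h f) x
    rw [pushOmegaR_apply, pushOmegaR_apply, extendZero_pushOmegaR, map_mul, mul_inv_rev, mul_smul]

variable {K}

/-- The set of all `ω_{s,b}` in `Ω_R` such that `b ≥ I` (that is, the exponents of `b` are at least
those of `I`) and the class of `s` modulo `I` is zero. -/
def idealSet (I : NonzeroIdeal (𝓞 K)) : Set (OmegaR K) :=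
  {x | ∃ s b : FinAdele K, (x : OmegaA K) = omega s b ∧ b ∈ idealAdeles I ∧ s ∈ idealAdeles I}

theorem isClopen_idealSet (I : NonzeroIdeal (𝓞 K)) : IsClopen (idealSet I) := by
  suffices h : IsClopen {x : OmegaA K | ∃ s b : FinAdele K, x = omega s b ∧
      b ∈ idealAdeles I ∧ s ∈ idealAdeles I} from h.preimage continuous_subtype_val
  rw [isClopen_omega_iff]
  convert (isClopen_idealAdeles I).prod (isClopen_idealAdeles I) using 1
  ext ⟨r, a⟩
  constructor
  · rintro ⟨s, b, h, hb, hs⟩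
    obtain ⟨⟨w, hw⟩, c, hc, h⟩ := omega_eq.1 h.symm
    rw [sub_eq_iff_eq_add] at h
    change r ∈ idealAdeles I ∧ a ∈ idealAdeles I
    rw [show a = _ from hw, show r = _ from h]
    exact ⟨add_mem (idealAdeles_mul_mem hb hc) hs, idealAdeles_mul_mem hb (SetLike.coe_mem _)⟩
  · rintro ⟨hr, ha⟩
    exact ⟨r, a, rfl, ha, hr⟩

open Classical in
/-- The characteristic function `E_I`. -/
def idealFunction (I : NonzeroIdeal (𝓞 K)) : C(OmegaR K, ℂ) where
  toFun x := if x ∈ idealSet I then 1 else 0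
  continuous_toFun := by
    refine continuous_if (fun x hx => ?_) continuousOn_const continuousOn_const
    rw [Set.ofPred_mem_eq, (isClopen_idealSet I).frontier_eq] at hx
    exact hx.elim

end Adeles

/-! ## Corners -/

section Corners

variable {M : Type*} [CStarAlgebra M]

/-- The corner `p B p` of a C*-subalgebra `B` at an element `p`. -/
def corner (B : NonUnitalStarSubalgebra ℂ M) (p : M) : Set M := {x | ∃ b ∈ B, x = p * b * p}

/-- The element `p` is a projection of the C*-algebra `B` which is full, that is, the closed
linear span of `B p B` is all of `B`. -/
structure IsFullProjection (B : NonUnitalStarSubalgebra ℂ M) (p : M) : Prop where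
  mem : p ∈ B
  isStarProjection : IsStarProjection p
  full : closure (Submodule.span ℂ {x : M | ∃ b ∈ B, ∃ c ∈ B, x = b * p * c} : Set M) = B

end Corners

/-- The characteristic function of `Ω_R`, as an element of the crossed product
`C₀(Ω) ⋊ (K ⋊ K*)`. -/
def omegaProjection (K : Type*) [Field K] [NumberField K] :
    CrossedProduct.Ambient (omegaAction K) :=
  CrossedProduct.ofAlg (omegaAction K) (extendZero 1)

end

open scoped NumberField nonZeroDivisors

/-! Both algebras in (1) are universal, so it suffices to find mutually inverse homomorphisms, and
these need only be checked on generators. One direction,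
`exists_toeplitz_to_semigroupCrossedProduct`, is a verification of the Toeplitz relations in the
crossed product. The other needs a homomorphism from C(Ω_R) to the Toeplitz algebra which sends the
translate of E_I by x to u^x e_I u^{-x}, and its existence is the core of (1).

The projections u^x e_I u^{-x} multiply like indicator functions of the cosets x + I: a product is
the projection of the intersection, or zero if the cosets are disjoint. A character of the
commutative algebra which they generate takes the value 1 on a family of cosets closed under finite
intersections and enlargement. On finitely many cosets such a character agrees with evaluation at a
point ω_{x,a}, where a has exactly the exponents of an ideal I. As Ω_R is compact, the whole
character is evaluation at a point of Ω_R (`exists_point_of_character`). By Gelfand theory a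
polynomial in the projections has norm at most the sup norm of the same polynomial in the coset
functions. These functions separate the points of Ω_R, so Stone–Weierstrass makes their polynomials
dense, and `exists_hom_of_omegaR` follows by extension.

For (2), extension by zero and v_t ↦ U_t p define a homomorphism of the semigroup crossed product T
into the corner; the issue is injectivity. With S = R ⋊ R^× and G = K ⋊ K*, common denominators give
G = S⁻¹S, so the isometries of S can be dilated to unitaries of G. The dilation lives on a T-valued
inner product space of functions G → T that contains a copy of T. The operators there satisfy the
covariance relations and hence are dominated by the universal norm, while the images of the
generators of T act on the copy of T by left multiplication. This gives ‖x‖ ≤ ‖Ψ x‖ in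
`exists_semigroupCrossedProduct_to_crossedProduct`. The range is the whole corner because U_g = U_t*
U_b whenever g = t⁻¹b. Finally p is full because every compact subset of Ω lies in d⁻¹Ω_R for some
nonzero integer d. -/

noncomputable section

open scoped CStarAlgebra

/-! ### Homomorphisms out of free `*`-algebras and universal C*-algebras. -/

namespace FreeStarAlg

variable {X M : Type*}

section Lift

variable [Ring M] [StarRing M] [Algebra ℂ M] [StarModule ℂ M]

/-- The unital `*`-homomorphism on the free `*`-algebra with given values at the generators. -/
def lift (f : X → M) : FreeStarAlg X →⋆ₐ[ℂ] M :=
  { MonoidAlgebra.lift ℂ M (FreeMonoid (X × Bool))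
      (FreeMonoid.lift fun l => if l.2 then star (f l.1) else f l.1) with
    map_star' := fun a => by
      change MonoidAlgebra.lift ℂ M (FreeMonoid (X × Bool)) _ _ =
        star (MonoidAlgebra.lift ℂ M (FreeMonoid (X × Bool)) _ _)
      induction a using induction with
      | hz z => rw [star_algebraMap, AlgHom.commutes, AlgHom.commutes, algebraMap_star_comm]
      | hl l =>
        rw [star_letter]
        obtain ⟨x, _ | _⟩ := l <;> simp [letter]
      | ha a b iha ihb => simp only [star_add, map_add, iha, ihb]
      | hm a b iha ihb => simp only [star_mul, map_mul, iha, ihb] }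

theorem lift_letter (f : X → M) (l : X × Bool) :
    lift f (letter l) = if l.2 then star (f l.1) else f l.1 := by
  change MonoidAlgebra.lift ℂ M (FreeMonoid (X × Bool)) _ (letter l) = _
  simp [letter]

@[simp] theorem lift_gen (f : X → M) (x : X) : lift f (gen x) = f x := by
  simp [gen, lift_letter]

/-- The `*`-homomorphism on the free `*`-algebra with given values in the corner of a projection
`p` at the generators, and value `p` at `1`. -/
def liftCorner (f : X → M) (p : M) (hp : IsStarProjection p) (hf : ∀ x, p * f x = f x)
    (hf' : ∀ x, f x * p = f x) : FreeStarAlg X →⋆ₙₐ[ℂ] M :=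
  -- Since `p` commutes with all values of the unital lift, cutting down by `p` is multiplicative.
  -- The scalars, which the lift does not send into the corner, are the reason for the cut.
  have hc : ∀ a, p * lift f a = lift f a * p := fun a => by
    induction a using induction with
    | hz z => rw [AlgHomClass.commutes, Algebra.commutes]
    | hl l =>
      obtain ⟨x, _ | _⟩ := l
      · simp [lift_letter, hf, hf']
      · have h1 := congrArg star (hf x)
        have h2 := congrArg star (hf' x)
        rw [star_mul, hp.isSelfAdjoint.star_eq] at h1 h2
        simp [lift_letter, h1, h2]
    | ha a b iha ihb => rw [map_add, mul_add, add_mul, iha, ihb]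
    | hm a b iha ihb => rw [map_mul, ← mul_assoc, iha, mul_assoc, ihb, mul_assoc]
  { toFun := fun a => p * lift f a
    map_smul' := fun z a => by simp
    map_zero' := by simp
    map_add' := fun a b => by simp [mul_add]
    map_mul' := fun a b => by
      rw [map_mul, hc a, mul_assoc (lift f a), ← mul_assoc p p, hp.isIdempotentElem.eq,
        ← mul_assoc, ← mul_assoc, hc a]
    map_star' := fun a => by
      rw [map_star, star_mul, hp.isSelfAdjoint.star_eq, ← map_star, hc] }

variable (f : X → M) (p : M) (hp : IsStarProjection p) (hf : ∀ x, p * f x = f x)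
    (hf' : ∀ x, f x * p = f x)

@[simp] theorem liftCorner_gen (x : X) : liftCorner f p hp hf hf' (gen x) = f x := by
  change p * lift f (gen x) = _
  rw [lift_gen, hf]

@[simp] theorem liftCorner_one : liftCorner f p hp hf hf' 1 = p := by
  change p * lift f 1 = _
  rw [map_one, mul_one]

end Lift

theorem induction_gen {P : FreeStarAlg X → Prop} (h1 : P 1) (hg : ∀ x, P (gen x))
    (hs : ∀ a, P a → P (star a)) (hz : ∀ (z : ℂ) a, P a → P (z • a))
    (ha : ∀ a b, P a → P b → P (a + b))
    (hm : ∀ a b, P a → P b → P (a * b)) (a : FreeStarAlg X) : P a := by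
  induction a using induction with
  | hz z => rw [Algebra.algebraMap_eq_smul_one]; exact hz _ _ h1
  | hl l =>
    obtain ⟨x, _ | _⟩ := l
    · exact hg x
    · have := hs _ (hg x)
      rwa [gen, star_letter] at this
  | ha a b iha ihb => exact ha _ _ iha ihb
  | hm a b iha ihb => exact hm _ _ iha ihb

end FreeStarAlg

/-- A `*`-homomorphism defined on a dense `*`-subalgebra of a C*-algebra extends if it does not
increase norms. -/
theorem exists_starHom_of_norm_le {F A B : Type*} [Ring F] [StarRing F] [Algebra ℂ F]
    [CStarAlgebra A] [CStarAlgebra B] (E : F →⋆ₙₐ[ℂ] A) (e : F →⋆ₙₐ[ℂ] B) (hE : DenseRange E)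
    (h : ∀ a, ‖e a‖ ≤ ‖E a‖) : ∃ Φ : A →⋆ₙₐ[ℂ] B, ∀ a, Φ (E a) = e a := by
  let E' : F →ₗ[ℂ] A := { toFun := E, map_add' := map_add E, map_smul' := map_smul E }
  let e' : F →ₗ[ℂ] B := { toFun := e, map_add' := map_add e, map_smul' := map_smul e }
  -- `E` need not be injective: the norm inequality forces the kernel of `E` into that of `e`, so
  -- `e` descends to the range of `E` before it is extended by continuity.
  let L : A →L[ℂ] B := e'.extendOfNorm E'
  have hL : ∀ a, L (E a) = e a := fun a =>
    LinearMap.extendOfNorm_eq (f := e') (e := E') hE ⟨1, fun x => by rw [one_mul]; exact h x⟩ a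
  refine ⟨{ toFun := L
            map_smul' := map_smul L
            map_zero' := map_zero L
            map_add' := map_add L
            map_mul' := fun a b => ?_
            map_star' := fun a => ?_ }, hL⟩
  · refine hE.induction_on₂ (p := fun a b => L (a * b) = L a * L b) ?_ ?_ a b
    · exact isClosed_eq (L.continuous.comp continuous_mul)
        ((L.continuous.comp continuous_fst).mul (L.continuous.comp continuous_snd))
    · intro a b
      rw [← map_mul, hL, hL, hL, map_mul]
  · refine hE.induction_on (p := fun a => L (star a) = star (L a)) a ?_ ?_
    · exact isClosed_eq (L.continuous.comp continuous_star) (continuous_star.comp L.continuous)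
    · intro a
      rw [← map_star, hL, hL, map_star]

/-- A unital `*`-homomorphism, from one which is not assumed to be unital. -/
def NonUnitalStarAlgHom.toStarAlgHomOfMapOne {A B : Type*} [Ring A] [StarRing A] [Algebra ℂ A]
    [Ring B] [StarRing B] [Algebra ℂ B] (Φ : A →⋆ₙₐ[ℂ] B) (h : Φ 1 = 1) : A →⋆ₐ[ℂ] B :=
  { Φ with
    map_one' := h
    commutes' := fun z => by
      change Φ (algebraMap ℂ A z) = _
      rw [Algebra.algebraMap_eq_smul_one, map_smul, h, ← Algebra.algebraMap_eq_smul_one] }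

namespace CStarPresentation

variable {X : Type*} (P : CStarPresentation X)

/-- The canonical map of the free `*`-algebra to the universal C*-algebra. -/
def toUniversal : FreeStarAlg X →⋆ₐ[ℂ] P.Universal where
  toFun := CStarSeminorm.Completion.of P.universalSeminorm
  map_one' := CStarSeminorm.Completion.of_one _
  map_mul' := CStarSeminorm.Completion.of_mul _
  map_zero' := CStarSeminorm.Completion.of_zero _
  map_add' := CStarSeminorm.Completion.of_add _
  commutes' z := by
    rw [Algebra.algebraMap_eq_smul_one, Algebra.algebraMap_eq_smul_one,
      CStarSeminorm.Completion.of_smul, CStarSeminorm.Completion.of_one]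
  map_star' a := (CStarSeminorm.Completion.star_of _ a).symm

theorem toUniversal_eq_of_rel {a b : FreeStarAlg X} (h : P.rel a b) :
    P.toUniversal a = P.toUniversal b := by
  refine CStarSeminorm.Completion.of_eq_of _ ?_
  change (⨆ i : P.Admissible, i.1 (a - b)) = 0
  simp [fun i : P.Admissible => i.2 a b h]

theorem norm_toUniversal_ge (q : CStarSeminorm (FreeStarAlg X))
    (hq : ∀ a b, P.rel a b → q (a - b) = 0)
    (a : FreeStarAlg X) : q a ≤ ‖P.toUniversal a‖ := by
  change _ ≤ ‖CStarSeminorm.Completion.of _ a‖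
  rw [CStarSeminorm.Completion.norm_of]
  exact le_ciSup (P.bddAbove a) ⟨q, hq⟩

theorem denseRange_toUniversal : DenseRange P.toUniversal := by
  intro a
  induction a using CStarSeminorm.Completion.induction with
  | hc => exact isClosed_closure
  | h a => exact subset_closure ⟨a, rfl⟩

theorem induction {p : P.Universal → Prop} (hc : IsClosed {a | p a}) (h1 : p 1)
    (hg : ∀ x, p (P.universalGen x)) (hs : ∀ a, p a → p (star a))
    (hz : ∀ (z : ℂ) a, p a → p (z • a))
    (ha : ∀ a b, p a → p b → p (a + b)) (hm : ∀ a b, p a → p b → p (a * b))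
    (a : P.Universal) : p a := by
  refine P.denseRange_toUniversal.induction_on a hc fun b => ?_
  induction b using FreeStarAlg.induction_gen with
  | h1 => rwa [map_one]
  | hg x => exact hg x
  | hs a iha => rw [map_star]; exact hs _ iha
  | hz z a iha => rw [map_smul]; exact hz _ _ iha
  | ha a b iha ihb => rw [map_add]; exact ha _ _ iha ihb
  | hm a b iha ihb => rw [map_mul]; exact hm _ _ iha ihb

variable {M : Type*} [CStarAlgebra M]

/-- The C*-seminorm defined by a `*`-homomorphism to a C*-algebra. -/
def _root_.CStarSeminorm.ofHom {A : Type*} [Ring A] [StarRing A] [Algebra ℂ A]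
    (φ : A →⋆ₙₐ[ℂ] M) : CStarSeminorm A where
  toFun a := ‖φ a‖
  map_zero' := by simp
  add_le' a b := by rw [map_add]; exact norm_add_le _ _
  neg' a := by rw [← neg_one_smul ℂ a, map_smul]; simp
  smul' z a := by rw [map_smul, norm_smul]
  mul_le' a b := by
    rw [map_mul]; exact norm_mul_le _ _
  star_mul_self' a := by
    rw [map_mul, map_star, CStarRing.norm_star_mul_self]

section Lift

variable (φ : FreeStarAlg X →⋆ₙₐ[ℂ] M) (hφ : ∀ a b, P.rel a b → φ a = φ b)

-- Only the C*-seminorm ‖φ ·‖ enters, so `φ` need not be unital. This is what later permits maps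
-- into a corner, where 1 goes to the projection.
include hφ in
theorem norm_le_norm_toUniversal (a : FreeStarAlg X) : ‖φ a‖ ≤ ‖P.toUniversal a‖ :=
  P.norm_toUniversal_ge (CStarSeminorm.ofHom φ) (fun a b h => by
    change ‖φ (a - b)‖ = 0
    rw [map_sub, hφ a b h, sub_self, norm_zero]) a

include hφ in
theorem exists_lift : ∃ Φ : P.Universal →⋆ₙₐ[ℂ] M, ∀ a, Φ (P.toUniversal a) = φ a :=
  exists_starHom_of_norm_le (P.toUniversal : FreeStarAlg X →⋆ₙₐ[ℂ] P.Universal) φ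
    P.denseRange_toUniversal (P.norm_le_norm_toUniversal φ hφ)

end Lift

theorem exists_starAlgHom (f : X → M)
    (hf : ∀ a b, P.rel a b → FreeStarAlg.lift f a = FreeStarAlg.lift f b) :
    ∃ Φ : P.Universal →⋆ₐ[ℂ] M, ∀ x, Φ (P.universalGen x) = f x := by
  obtain ⟨Φ, hΦ⟩ := P.exists_lift (FreeStarAlg.lift f : FreeStarAlg X →⋆ₙₐ[ℂ] M) hf
  refine ⟨Φ.toStarAlgHomOfMapOne ?_, fun x => ?_⟩
  · rw [← map_one P.toUniversal, hΦ]
    exact map_one (FreeStarAlg.lift f)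
  · exact (hΦ (.gen x)).trans (FreeStarAlg.lift_gen f x)

theorem starHom_ext {Φ Ψ : P.Universal →⋆ₙₐ[ℂ] M} (h1 : Φ 1 = Ψ 1)
    (h : ∀ x, Φ (P.universalGen x) = Ψ (P.universalGen x)) : Φ = Ψ := by
  ext a
  induction a using P.induction with
  | hc => exact isClosed_eq (map_continuous Φ) (map_continuous Ψ)
  | h1 => exact h1
  | hg x => exact h x
  | hs a ih => rw [map_star, map_star, ih]
  | hz z a ih => rw [map_smul, map_smul, ih]
  | ha a b iha ihb => rw [map_add, map_add, iha, ihb]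
  | hm a b iha ihb => rw [map_mul, map_mul, iha, ihb]

end CStarPresentation

end

noncomputable section

/-! ### Ideals and finite adeles. -/

section AdelesAndIdeals

open IsDedekindDomain NumberField
open scoped NumberField nonZeroDivisors WithZero Topology ZeroAtInfty

variable {K : Type*} [Field K] [NumberField K]

theorem mem_integralAdeles {x : FinAdele K} : x ∈ integralAdeles K ↔ ∀ v, Valued.v (x v) ≤ 1 :=
  Iff.rfl

theorem mem_idealAdeles {I : NonzeroIdeal (𝓞 K)} {x : FinAdele K} : x ∈ idealAdeles I ↔
    ∀ v : HeightOneSpectrum (𝓞 K),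
      Valued.v (x v) ≤ WithZero.exp (-(multiplicity v.asIdeal I.1 : ℤ)) := Iff.rfl

theorem finiteMultiplicity_ideal (v : HeightOneSpectrum (𝓞 K)) (I : NonzeroIdeal (𝓞 K)) :
    FiniteMultiplicity v.asIdeal I.1 :=
  FiniteMultiplicity.of_prime_left v.prime I.2

theorem multiplicity_anti {I J : NonzeroIdeal (𝓞 K)} (h : I.1 ≤ J.1)
    (v : HeightOneSpectrum (𝓞 K)) : multiplicity v.asIdeal J.1 ≤ multiplicity v.asIdeal I.1 :=
  (finiteMultiplicity_ideal v I).le_multiplicity_of_pow_dvd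
    ((pow_multiplicity_dvd _ _).trans (Ideal.dvd_iff_le.2 h))

theorem idealAdeles_mono {I J : NonzeroIdeal (𝓞 K)} (h : I.1 ≤ J.1) :
    idealAdeles I ≤ idealAdeles J := fun x hx v => (hx v).trans
  (WithZero.exp_le_exp.2 (neg_le_neg (by exact_mod_cast multiplicity_anti h v)))

theorem idealAdeles_whole {x : FinAdele K} :
    x ∈ idealAdeles NonzeroIdeal.whole ↔ x ∈ integralAdeles K := by
  have h : ∀ v : HeightOneSpectrum (𝓞 K),
      multiplicity v.asIdeal (⊤ : Ideal (𝓞 K)) = 0 := fun v => by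
    refine multiplicity_eq_zero.2 fun h => v.isPrime.ne_top ?_
    exact top_le_iff.1 (Ideal.dvd_iff_le.1 h)
  rw [mem_idealAdeles, mem_integralAdeles]
  simp [NonzeroIdeal.whole, h]

theorem idealAdeles_le_integralAdeles {I : NonzeroIdeal (𝓞 K)} {x : FinAdele K}
    (hx : x ∈ idealAdeles I) : x ∈ integralAdeles K :=
  idealAdeles_whole.1 (idealAdeles_mono (J := NonzeroIdeal.whole) le_top hx)

/-- The exponent of I ∩ J is at most the larger of the two exponents. This comes from (I + J)(I ∩ J)
= IJ in a Dedekind domain, because the exponent of I + J is at least the smaller one. -/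
theorem mem_idealAdeles_inter {I J : NonzeroIdeal (𝓞 K)} {x : FinAdele K} :
    x ∈ idealAdeles (I.inter J) ↔ x ∈ idealAdeles I ∧ x ∈ idealAdeles J := by
  refine ⟨fun h => ⟨idealAdeles_mono inf_le_left h, idealAdeles_mono inf_le_right h⟩,
    fun ⟨hI, hJ⟩ v => ?_⟩
  have hS : I.1 ⊔ J.1 ≠ ⊥ := fun h => I.2 (le_bot_iff.1 (le_sup_left.trans h.le))
  have h1 : multiplicity v.asIdeal (I.1 ⊔ J.1) + multiplicity v.asIdeal (I.inter J).1 =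
      multiplicity v.asIdeal I.1 + multiplicity v.asIdeal J.1 := by
    rw [← multiplicity_mul v.prime, ← multiplicity_mul v.prime]
    · exact congrArg _ (Ideal.sup_mul_inf I.1 J.1)
    · exact FiniteMultiplicity.of_prime_left v.prime (mul_ne_zero I.2 J.2)
    · exact FiniteMultiplicity.of_prime_left v.prime (mul_ne_zero hS (I.inter J).2)
  have h2 : min (multiplicity v.asIdeal I.1) (multiplicity v.asIdeal J.1) ≤
      multiplicity v.asIdeal (I.1 ⊔ J.1) := by
    refine (FiniteMultiplicity.of_prime_left v.prime hS).le_multiplicity_of_pow_dvd ?_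
    refine Ideal.dvd_iff_le.2 (sup_le ?_ ?_)
    · exact Ideal.dvd_iff_le.1 ((pow_dvd_pow _ (min_le_left _ _)).trans (pow_multiplicity_dvd _ _))
    · exact Ideal.dvd_iff_le.1 ((pow_dvd_pow _ (min_le_right _ _)).trans (pow_multiplicity_dvd _ _))
  rcases le_total (multiplicity v.asIdeal I.1) (multiplicity v.asIdeal J.1) with h | h
  · refine (hJ v).trans (WithZero.exp_le_exp.2 ?_)
    rw [min_eq_left h] at h2
    omega
  · refine (hI v).trans (WithZero.exp_le_exp.2 ?_)
    rw [min_eq_right h] at h2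
    omega

theorem valued_algebraMap (k : 𝓞 K) (v : HeightOneSpectrum (𝓞 K)) :
    Valued.v (algebraMap K (FinAdele K) (algebraMap (𝓞 K) K k) v) = v.intValuation k := by
  rw [FiniteAdeleRing.algebraMap_apply, HeightOneSpectrum.valuedAdicCompletion_eq_valuation']
  exact HeightOneSpectrum.valuation_of_algebraMap v k

theorem mem_idealAdeles_dilate {k : (𝓞 K)⁰} {I : NonzeroIdeal (𝓞 K)} {x : FinAdele K} :
    algebraMap K (FinAdele K) (algebraMap (𝓞 K) K k) * x ∈ idealAdeles (I.dilate k) ↔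
      x ∈ idealAdeles I := by
  have hk : (k : 𝓞 K) ≠ 0 := nonZeroDivisors.ne_zero k.2
  refine forall_congr' fun v => ?_
  change Valued.v (algebraMap K (FinAdele K) (algebraMap (𝓞 K) K k) v * x v) ≤
    WithZero.exp (-(multiplicity v.asIdeal (Ideal.span {(k : 𝓞 K)} * I.1) : ℤ)) ↔ _
  rw [map_mul, valued_algebraMap, v.intValuation_eq_exp_neg_multiplicity hk,
    multiplicity_mul v.prime (FiniteMultiplicity.of_prime_left v.prime (I.dilate k).2)]
  push_cast
  rw [neg_add, WithZero.exp_add, mul_le_mul_iff_right₀ (by simp)]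

/-- Ideals become principal over the integral adeles: an element of the right valuation can be
chosen at each prime separately, and all these local choices are integral. -/
theorem exists_generator (I : NonzeroIdeal (𝓞 K)) : ∃ a : FinAdele K,
    ∀ v : HeightOneSpectrum (𝓞 K),
      Valued.v (a v) = WithZero.exp (-(multiplicity v.asIdeal I.1 : ℤ)) := by
  choose π hπ using fun v : HeightOneSpectrum (𝓞 K) => v.valuation_surjective K
    (WithZero.exp (-(multiplicity v.asIdeal I.1 : ℤ)))
  have h : ∀ v : HeightOneSpectrum (𝓞 K), Valued.v ((π v : K) : v.adicCompletion K) =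
      WithZero.exp (-(multiplicity v.asIdeal I.1 : ℤ)) := fun v => by
    rw [HeightOneSpectrum.valuedAdicCompletion_eq_valuation', hπ]
  refine ⟨⟨fun v => ((π v : K) : v.adicCompletion K), Filter.Eventually.of_forall fun v => ?_⟩, h⟩
  change Valued.v ((π v : K) : v.adicCompletion K) ≤ 1
  rw [h, ← WithZero.exp_zero]
  exact WithZero.exp_le_exp.2 (by simp)

theorem le_of_generator_mem {I J : NonzeroIdeal (𝓞 K)} {a : FinAdele K}
    (ha : ∀ v : HeightOneSpectrum (𝓞 K),
      Valued.v (a v) = WithZero.exp (-(multiplicity v.asIdeal I.1 : ℤ)))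
    (h : a ∈ idealAdeles J) : I.1 ≤ J.1 := by
  rw [← Ideal.dvd_iff_le, UniqueFactorizationMonoid.dvd_iff_emultiplicity_le J.2]
  intro p hp
  let v : HeightOneSpectrum (𝓞 K) := ⟨p, Ideal.isPrime_of_prime hp, hp.ne_zero⟩
  have := h v
  rw [ha, WithZero.exp_le_exp] at this
  rw [(finiteMultiplicity_ideal v J).emultiplicity_eq_multiplicity,
    (finiteMultiplicity_ideal v I).emultiplicity_eq_multiplicity]
  have h3 : multiplicity v.asIdeal J.1 ≤ multiplicity v.asIdeal I.1 := by omega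
  exact_mod_cast h3

/-- The ideal `P ^ n`. -/
def primePowIdeal (v : HeightOneSpectrum (𝓞 K)) (n : ℕ) : NonzeroIdeal (𝓞 K) :=
  ⟨v.asIdeal ^ n, pow_ne_zero n v.ne_bot⟩

theorem mem_idealAdeles_primePowIdeal {v : HeightOneSpectrum (𝓞 K)} {n : ℕ} {x : FinAdele K} :
    x ∈ idealAdeles (primePowIdeal v n) ↔
      x ∈ integralAdeles K ∧ Valued.v (x v) ≤ WithZero.exp (-(n : ℤ)) := by
  have h1 : multiplicity v.asIdeal (v.asIdeal ^ n) = n :=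
    multiplicity_pow_self v.ne_bot v.prime.not_isUnit n
  constructor
  · intro h
    refine ⟨idealAdeles_le_integralAdeles h, ?_⟩
    have := h v
    rwa [primePowIdeal, h1] at this
  · rintro ⟨h, hv⟩ w
    by_cases hw : w = v
    · subst hw
      rwa [primePowIdeal, h1]
    · have h2 : multiplicity w.asIdeal (v.asIdeal ^ n) = 0 := by
        refine multiplicity_eq_zero.2 fun hd => hw ?_
        have := w.prime.dvd_of_dvd_pow hd
        refine HeightOneSpectrum.ext ?_
        exact associated_iff_eq.1 ((w.prime.dvd_prime_iff_associated v.prime).1 this)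
      rw [primePowIdeal, h2, Nat.cast_zero, neg_zero, WithZero.exp_zero]
      exact h w

/-- Weak approximation at one prime: r_v is approximated first by an element y of K, which is then
v-integral, and y by an algebraic integer. At the other primes the difference only has to be
integral. -/
theorem exists_sub_mem_primePowIdeal (v : HeightOneSpectrum (𝓞 K)) (n : ℕ) {r : FinAdele K}
    (hr : r ∈ integralAdeles K) : ∃ x : 𝓞 K,
      r - algebraMap K (FinAdele K) (algebraMap (𝓞 K) K x) ∈ idealAdeles (primePowIdeal v n) := by
  have hd : DenseRange (algebraMap K (v.adicCompletion K)) := v.denseRange_algebraMap K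
  let u : (ℤᵐ⁰)ˣ := Units.mk0 (WithZero.exp (-(n : ℤ))) (by simp)
  have hu : (u : ℤᵐ⁰) = WithZero.exp (-(n : ℤ)) := rfl
  have hu1 : (u : ℤᵐ⁰) ≤ 1 := by
    rw [hu, ← WithZero.exp_zero]
    exact WithZero.exp_le_exp.2 (by simp)
  obtain ⟨y, hy⟩ : ∃ y : K, Valued.v (r v - (y : v.adicCompletion K)) ≤ u := by
    obtain ⟨π, hπ⟩ := v.valuation_surjective K (u : ℤᵐ⁰)
    have hπv : Valued.v (π : v.adicCompletion K) = u := by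
      rw [HeightOneSpectrum.valuedAdicCompletion_eq_valuation', hπ]
    have hπ0 : (π : v.adicCompletion K) ≠ 0 := by
      rw [← (Valued.v : Valuation (v.adicCompletion K) ℤᵐ⁰).ne_zero_iff, hπv]
      exact u.ne_zero
    -- The ball of radius `u` about r_v, written as the preimage of the open valuation ring after
    -- division by an element of valuation `u`.
    have ho : IsOpen {z : v.adicCompletion K |
        (r v - z) * (π : v.adicCompletion K)⁻¹ ∈ v.adicCompletionIntegers K} :=
      (Valued.isOpen_valuationSubring (v.adicCompletion K)).preimage
        ((continuous_const.sub continuous_id).mul continuous_const)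
    obtain ⟨y, hy⟩ := hd.exists_mem_open ho ⟨r v, by simp⟩
    refine ⟨y, ?_⟩
    have hy' : Valued.v ((r v - (y : v.adicCompletion K)) * (π : v.adicCompletion K)⁻¹) ≤ 1 := hy
    rw [map_mul, map_inv₀, hπv] at hy'
    rwa [mul_inv_le_iff₀ (zero_lt_iff.2 u.ne_zero), one_mul] at hy'
  have hy1 : v.valuation K y ≤ 1 := by
    rw [← HeightOneSpectrum.valuedAdicCompletion_eq_valuation',
      show (y : v.adicCompletion K) = r v - (r v - y) by ring]
    exact (Valuation.map_sub _ _ _).trans (max_le (hr v) (hy.trans hu1))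
  obtain ⟨x, hx⟩ := v.exists_valuation_sub_lt_of_integer hy1 u
  refine ⟨x, mem_idealAdeles_primePowIdeal.2 ⟨sub_mem hr fun w => ?_, ?_⟩⟩
  · exact HeightOneSpectrum.coe_algebraMap_mem (𝓞 K) K w x
  · change Valued.v (r v - ((algebraMap (𝓞 K) K x : K) : v.adicCompletion K)) ≤ _
    have h4 : ((algebraMap (𝓞 K) K x - y : K) : v.adicCompletion K) =
        ((algebraMap (𝓞 K) K x : K) : v.adicCompletion K) - (y : v.adicCompletion K) :=
      map_sub (algebraMap K (v.adicCompletion K)) (algebraMap (𝓞 K) K x) y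
    rw [show r v - ((algebraMap (𝓞 K) K x : K) : v.adicCompletion K) = (r v - y) -
      ((algebraMap (𝓞 K) K x - y : K) : v.adicCompletion K) by rw [h4]; ring]
    refine (Valuation.map_sub _ _ _).trans (max_le hy ?_)
    rw [HeightOneSpectrum.valuedAdicCompletion_eq_valuation']
    exact hx.le

/-- An adele is integral at all but finitely many primes, so the product of local denominators at
the remaining ones clears it everywhere. -/
theorem exists_mul_mem_integralAdeles (r : FinAdele K) : ∃ d : (𝓞 K)⁰,
    algebraMap K (FinAdele K) (algebraMap (𝓞 K) K d) * r ∈ integralAdeles K := by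
  classical
  have hfin : {v | ¬ r v ∈ v.adicCompletionIntegers K}.Finite := r.2
  choose d hd hd' using fun v : HeightOneSpectrum (𝓞 K) =>
    HeightOneSpectrum.adicCompletion.mul_nonZeroDivisor_mem_adicCompletionIntegers v (r v)
  refine ⟨⟨∏ v ∈ hfin.toFinset, d v, prod_mem fun v _ => hd v⟩, fun v => ?_⟩
  change Valued.v (algebraMap K (FinAdele K) (algebraMap (𝓞 K) K (∏ v ∈ hfin.toFinset, d v)) v
    * r v) ≤ 1
  rw [map_mul, valued_algebraMap]
  by_cases hv : r v ∈ v.adicCompletionIntegers K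
  · exact mul_le_one' (v.intValuation_le_one _) hv
  · rw [← Finset.mul_prod_erase _ d (hfin.mem_toFinset.2 hv), map_mul, mul_right_comm]
    refine mul_le_one' ?_ (v.intValuation_le_one _)
    have := hd' v
    rw [HeightOneSpectrum.mem_adicCompletionIntegers, map_mul, mul_comm] at this
    refine le_trans (le_of_eq ?_) this
    rw [← valued_algebraMap (K := K)]
    rfl

end AdelesAndIdeals
end

noncomputable section

/-! ### The coset functions on Ω_R: relations, separation of points, density. -/

section Omega

open IsDedekindDomain NumberField
open scoped NumberField nonZeroDivisors WithZero Topology ZeroAtInfty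

variable {K : Type*} [Field K] [NumberField K]

theorem exists_eq_omega (x : OmegaA K) : ∃ r a : FinAdele K, x = omega r a := by
  induction x using Quotient.inductionOn with
  | h x => exact ⟨x.1, x.2, rfl⟩

theorem mem_idealSet {I : NonzeroIdeal (𝓞 K)} {x : OmegaR K} {s b : FinAdele K}
    (hx : (x : OmegaA K) = omega s b) :
    x ∈ idealSet I ↔ s ∈ idealAdeles I ∧ b ∈ idealAdeles I := by
  constructor
  · rintro ⟨r, a, h, ha, hr⟩
    obtain ⟨⟨w, hw⟩, c, hc, h⟩ := omega_eq.1 (h.symm.trans hx)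
    rw [sub_eq_iff_eq_add] at h
    rw [hw, h]
    exact ⟨add_mem (idealAdeles_mul_mem ha hc) hr, idealAdeles_mul_mem ha (SetLike.coe_mem _)⟩
  · rintro ⟨hs, hb⟩
    exact ⟨s, b, hx, hb, hs⟩

open Classical in
theorem extendZero_idealFunction (I : NonzeroIdeal (𝓞 K)) (s b : FinAdele K) :
    extendZero (idealFunction I) (omega s b) =
      if s ∈ idealAdeles I ∧ b ∈ idealAdeles I then 1 else 0 := by
  by_cases h : omega s b ∈ OmegaR K
  · rw [extendZero_apply _ ⟨_, h⟩]
    change (if (⟨_, h⟩ : OmegaR K) ∈ idealSet I then (1 : ℂ) else 0) = _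
    simp only [mem_idealSet (x := ⟨_, h⟩) rfl]
  · rw [extendZero_of_notMem _ h, if_neg]
    rintro ⟨hs, hb⟩
    exact h (omega_mem_OmegaR.2
      ⟨idealAdeles_le_integralAdeles hs, idealAdeles_le_integralAdeles hb⟩)

/-- The characteristic function of the set of all `ω_{s,b}` in `Ω_R` with `b ≥ I` and `s`
congruent to `x` modulo `I`. -/
def cosetFunction (x : 𝓞 K) (I : NonzeroIdeal (𝓞 K)) : C(OmegaR K, ℂ) :=
  omegaSemigroupAction K ⟨x, 1⟩ (idealFunction I)

open Classical in
theorem omegaSemigroupAction_idealFunction_apply (x : 𝓞 K) (k : (𝓞 K)⁰) (I : NonzeroIdeal (𝓞 K))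
    {y : OmegaR K} {s b : FinAdele K} (hy : (y : OmegaA K) = omega s b) :
    omegaSemigroupAction K ⟨x, k⟩ (idealFunction I) y =
      if s - algebraMap K (FinAdele K) (algebraMap (𝓞 K) K x) ∈ idealAdeles (I.dilate k) ∧
        b ∈ idealAdeles (I.dilate k) then 1 else 0 := by
  have hk : algebraMap (𝓞 K) K k ≠ 0 := by
    simp
  set κ : FinAdele K := algebraMap K (FinAdele K) (algebraMap (𝓞 K) K k) with hκ
  set κ' : FinAdele K := algebraMap K (FinAdele K) (algebraMap (𝓞 K) K k)⁻¹ with hκ'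
  have h1 : κ * κ' = 1 := by rw [hκ, hκ', ← map_mul, mul_inv_cancel₀ hk, map_one]
  set ξ : FinAdele K := algebraMap K (FinAdele K) (algebraMap (𝓞 K) K x) with hξ
  have h2 : (AxB.map (𝓞 K) K ⟨x, k⟩)⁻¹ • omega s b = omega (κ' * (s - ξ)) (κ' * b) := by
    rw [inv_smul_eq_iff, smul_omega]
    change omega s b = omega (ξ + κ * (κ' * (s - ξ))) (κ * (κ' * b))
    rw [← mul_assoc, ← mul_assoc, h1, one_mul, one_mul, add_sub_cancel]
  have h3 : ∀ z, κ' * z ∈ idealAdeles I ↔ z ∈ idealAdeles (I.dilate k) := fun z => by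
    rw [← mem_idealAdeles_dilate (k := k), ← hκ, ← mul_assoc, h1, one_mul]
  change pushOmegaR _ _ y = _
  rw [pushOmegaR_apply, hy, h2, extendZero_idealFunction, h3, h3]

omit [NumberField K] in
theorem NonzeroIdeal.dilate_one (I : NonzeroIdeal (𝓞 K)) : I.dilate 1 = I := by
  apply Subtype.ext
  simp [NonzeroIdeal.dilate]

open Classical in
theorem cosetFunction_apply (x : 𝓞 K) (I : NonzeroIdeal (𝓞 K))
    {y : OmegaR K} {s b : FinAdele K} (hy : (y : OmegaA K) = omega s b) :
    cosetFunction x I y =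
      if s - algebraMap K (FinAdele K) (algebraMap (𝓞 K) K x) ∈ idealAdeles I ∧
        b ∈ idealAdeles I then 1 else 0 := by
  rw [cosetFunction, omegaSemigroupAction_idealFunction_apply x 1 I hy, I.dilate_one]

open Classical in
theorem idealFunction_apply (I : NonzeroIdeal (𝓞 K)) {y : OmegaR K} {s b : FinAdele K}
    (hy : (y : OmegaA K) = omega s b) :
    idealFunction I y = if s ∈ idealAdeles I ∧ b ∈ idealAdeles I then 1 else 0 := by
  rw [← extendZero_apply, hy, extendZero_idealFunction]

theorem omegaSemigroupAction_idealFunction (x : 𝓞 K) (k : (𝓞 K)⁰) (I : NonzeroIdeal (𝓞 K)) :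
    omegaSemigroupAction K ⟨x, k⟩ (idealFunction I) = cosetFunction x (I.dilate k) := by
  classical
  ext y
  obtain ⟨s, b, hy⟩ := exists_eq_omega (y : OmegaA K)
  rw [omegaSemigroupAction_idealFunction_apply x k I hy, cosetFunction_apply _ _ hy]

theorem cosetFunction_zero (I : NonzeroIdeal (𝓞 K)) : cosetFunction 0 I = idealFunction I := by
  have : (⟨0, 1⟩ : AxB (𝓞 K)) = 1 := rfl
  rw [cosetFunction, this, map_one]
  rfl

theorem omegaSemigroupAction_mul_apply (g h : AxB (𝓞 K)) (f : C(OmegaR K, ℂ)) :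
    omegaSemigroupAction K (g * h) f = omegaSemigroupAction K g (omegaSemigroupAction K h f) := by
  rw [map_mul]
  rfl

/-- The semigroup permutes the coset functions as (m, k) moves the coset y + I to m + ky + kI. The
Toeplitz counterparts are `u_mul_eCoset` and `s_mul_eCoset`. -/
theorem omegaSemigroupAction_cosetFunction (g : AxB (𝓞 K)) (y : 𝓞 K) (I : NonzeroIdeal (𝓞 K)) :
    omegaSemigroupAction K g (cosetFunction y I) =
      cosetFunction (g.add + (g.mul : 𝓞 K) * y) (I.dilate g.mul) := by
  have h : g * ⟨y, 1⟩ = ⟨g.add + g.mul * y, g.mul⟩ := by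
    ext
    · rfl
    · simp
  rw [cosetFunction, ← omegaSemigroupAction_mul_apply, h, omegaSemigroupAction_idealFunction]

theorem idealFunction_whole : idealFunction (K := K) NonzeroIdeal.whole = 1 := by
  classical
  ext y
  obtain ⟨s, hs, b, hb, hy⟩ := y.2
  rw [idealFunction_apply _ hy, idealAdeles_whole, idealAdeles_whole, if_pos ⟨hs, hb⟩]
  rfl

theorem idealFunction_inter (I J : NonzeroIdeal (𝓞 K)) :
    idealFunction (I.inter J) = idealFunction I * idealFunction J := by
  classical
  ext y
  obtain ⟨s, b, hy⟩ := exists_eq_omega (y : OmegaA K)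
  rw [ContinuousMap.mul_apply, idealFunction_apply _ hy, idealFunction_apply _ hy,
    idealFunction_apply _ hy, mem_idealAdeles_inter, mem_idealAdeles_inter, ite_zero_mul_ite_zero,
    mul_one]
  congr 1
  exact propext (by tauto)

theorem idealFunction_mul_self (I : NonzeroIdeal (𝓞 K)) :
    idealFunction I * idealFunction I = idealFunction I := by
  classical
  ext y
  obtain ⟨s, b, hy⟩ := exists_eq_omega (y : OmegaA K)
  rw [ContinuousMap.mul_apply, idealFunction_apply _ hy]
  split_ifs <;> simp

theorem star_idealFunction (I : NonzeroIdeal (𝓞 K)) :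
    star (idealFunction I) = idealFunction I := by
  classical
  ext y
  obtain ⟨s, b, hy⟩ := exists_eq_omega (y : OmegaA K)
  rw [ContinuousMap.star_apply, idealFunction_apply _ hy]
  split_ifs <;> simp

theorem cosetFunction_eq_idealFunction {x : 𝓞 K} {I : NonzeroIdeal (𝓞 K)} (hx : x ∈ I.1) :
    cosetFunction x I = idealFunction I := by
  classical
  ext y
  obtain ⟨s, b, hy⟩ := exists_eq_omega (y : OmegaA K)
  have h := algebraMap_mem_idealAdeles (K := K) hx
  rw [cosetFunction_apply _ _ hy, idealFunction_apply _ hy]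
  congr 2
  exact propext ⟨fun h' => by simpa using add_mem h' h, fun h' => sub_mem h' h⟩

theorem idealFunction_mul_cosetFunction {x : 𝓞 K} {I : NonzeroIdeal (𝓞 K)} (hx : x ∉ I.1) :
    idealFunction I * cosetFunction x I = 0 := by
  classical
  ext y
  obtain ⟨s, b, hy⟩ := exists_eq_omega (y : OmegaA K)
  rw [ContinuousMap.mul_apply, cosetFunction_apply _ _ hy, idealFunction_apply _ hy,
    ite_zero_mul_ite_zero, if_neg]
  · rfl
  · rintro ⟨⟨h1, -⟩, h2, -⟩
    refine hx (algebraMap_mem_idealAdeles_iff.1 ?_)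
    simpa using sub_mem h1 h2

-- The point ω_{x,a}, with a having exactly the exponents of I, represents the coset x + I. A coset
-- function is 1 there precisely if its coset contains x + I.
open Classical in
theorem exists_point (x : 𝓞 K) (I : NonzeroIdeal (𝓞 K)) : ∃ ω : OmegaR K, ∀ y J,
    cosetFunction y J ω = if x - y ∈ J.1 ∧ I.1 ≤ J.1 then 1 else 0 := by
  obtain ⟨a, ha⟩ := exists_generator I
  have hI : a ∈ idealAdeles I := fun v => (ha v).le
  refine ⟨⟨omega (algebraMap K (FinAdele K) (algebraMap (𝓞 K) K x)) a, omega_mem_OmegaR.2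
    ⟨fun v => HeightOneSpectrum.coe_algebraMap_mem (𝓞 K) K v x,
      idealAdeles_le_integralAdeles hI⟩⟩, fun y J => ?_⟩
  rw [cosetFunction_apply _ _ rfl]
  congr 1
  rw [← map_sub, ← map_sub]
  exact propext (and_congr algebraMap_mem_idealAdeles_iff
    ⟨le_of_generator_mem ha, fun h => idealAdeles_mono h hI⟩)

/-- The values at (r, a) are tested with one coset: an integer x congruent to r modulo P^n. It
transfers divisibility by P^n from a to b and shows that both r and s are congruent to x. -/
theorem mem_idealAdeles_of_cosetFunction {r a s b : FinAdele K} (hr : r ∈ integralAdeles K)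
    (h : ∀ x : 𝓞 K, ∀ I : NonzeroIdeal (𝓞 K),
      r - algebraMap K (FinAdele K) (algebraMap (𝓞 K) K x) ∈ idealAdeles I ∧ a ∈ idealAdeles I →
      s - algebraMap K (FinAdele K) (algebraMap (𝓞 K) K x) ∈ idealAdeles I ∧ b ∈ idealAdeles I)
    {v : HeightOneSpectrum (𝓞 K)} {n : ℕ} (ha : a ∈ idealAdeles (primePowIdeal v n)) :
    b ∈ idealAdeles (primePowIdeal v n) ∧ r - s ∈ idealAdeles (primePowIdeal v n) := by
  obtain ⟨x, hx⟩ := exists_sub_mem_primePowIdeal v n hr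
  obtain ⟨h1, h2⟩ := h x _ ⟨hx, ha⟩
  refine ⟨h2, ?_⟩
  simpa using sub_mem hx h1

/-- Thresholds with natural exponents suffice because z ≤ 1. The case z = 0 is an infinite exponent,
where every threshold is available and w must vanish too. -/
theorem withZero_le_of_forall_exp {z w : ℤᵐ⁰} (hz : z ≤ 1)
    (h : ∀ n : ℕ, z ≤ WithZero.exp (-(n : ℤ)) → w ≤ WithZero.exp (-(n : ℤ))) : w ≤ z := by
  rcases eq_or_ne z 0 with rfl | hz0
  · by_contra hw
    obtain ⟨m, rfl⟩ : ∃ m : ℤ, w = WithZero.exp m :=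
      ⟨WithZero.log w, (WithZero.exp_log (by rintro rfl; exact hw le_rfl)).symm⟩
    have := h (m.natAbs + 1) zero_le
    rw [WithZero.exp_le_exp] at this
    omega
  · obtain ⟨m, rfl⟩ : ∃ m : ℤ, z = WithZero.exp m := ⟨WithZero.log z, (WithZero.exp_log hz0).symm⟩
    rw [← WithZero.exp_zero, WithZero.exp_le_exp] at hz
    have h1 : -((m.natAbs : ℕ) : ℤ) = m := by omega
    have := h m.natAbs
    rw [h1] at this
    exact this le_rfl

theorem exists_mul_of_valued_le {a b : FinAdele K} (h : ∀ v, Valued.v (b v) ≤ Valued.v (a v)) :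
    ∃ c ∈ integralAdeles K, b = a * c := by
  -- Where a_v = 0 the quotient is 0 by convention, which is still integral; b_v vanishes there as
  -- well.
  have hc : ∀ v : HeightOneSpectrum (𝓞 K), b v / a v ∈ v.adicCompletionIntegers K := fun v => by
    change Valued.v (b v / a v) ≤ 1
    rw [map_div₀]
    exact div_le_one_of_le₀ (h v) zero_le
  refine ⟨⟨fun v => b v / a v, Filter.Eventually.of_forall hc⟩, hc, ?_⟩
  refine FiniteAdeleRing.ext _ fun v => ?_
  change b v = a v * (b v / a v)
  by_cases ha : a v = 0
  · have := h v
    rw [ha, map_zero, le_zero_iff, map_eq_zero] at this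
    rw [this, ha, zero_mul]
  · rw [mul_div_cancel₀ _ ha]

theorem exists_unit_of_valued_eq {a b : FinAdele K} (h : ∀ v, Valued.v (b v) = Valued.v (a v)) :
    ∃ w : (integralAdeles K)ˣ, b = a * (w : integralAdeles K) := by
  classical
  -- At the zeros of a any local unit will do, so 1 is used. The convention b / 0 = 0 would not give
  -- a unit.
  let f : ∀ v : HeightOneSpectrum (𝓞 K), v.adicCompletion K :=
    fun v => if a v = 0 then 1 else b v / a v
  have hf : ∀ v, Valued.v (f v) = 1 := fun v => by
    by_cases ha : a v = 0
    · simp [f, ha]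
    · simp only [f, ha, if_false]
      rw [map_div₀, h, div_self]
      rwa [(Valued.v : Valuation (v.adicCompletion K) ℤᵐ⁰).ne_zero_iff]
  have hf1 : ∀ v, f v ∈ v.adicCompletionIntegers K := fun v => (hf v).le
  have hf2 : ∀ v, (f v)⁻¹ ∈ v.adicCompletionIntegers K := fun v => by
    change Valued.v (f v)⁻¹ ≤ 1
    rw [map_inv₀, hf, inv_one]
  have hf0 : ∀ v, f v ≠ 0 := fun v h0 => by
    have := hf v
    rw [h0, map_zero] at this
    exact zero_ne_one this
  let w : FinAdele K := ⟨f, Filter.Eventually.of_forall hf1⟩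
  let w' : FinAdele K := ⟨fun v => (f v)⁻¹, Filter.Eventually.of_forall hf2⟩
  have hw : w * w' = 1 := by
    refine FiniteAdeleRing.ext _ fun v => ?_
    exact mul_inv_cancel₀ (hf0 v)
  refine ⟨⟨⟨w, hf1⟩, ⟨w', hf2⟩, Subtype.ext hw, Subtype.ext ((mul_comm _ _).trans hw)⟩, ?_⟩
  refine FiniteAdeleRing.ext _ fun v => ?_
  change b v = a v * f v
  by_cases ha : a v = 0
  · have := h v
    rw [ha, map_zero, map_eq_zero] at this
    rw [this, ha, zero_mul]
  · simp only [f, ha, if_false]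
    rw [mul_div_cancel₀ _ ha]

/-- Separation of points. The prime powers dividing a and b agree, so a and b have the same
exponents and differ by a unit; and r - s is divisible by every prime power dividing a, hence by a.
-/
theorem omega_eq_of_forall_cosetFunction {x y : OmegaR K}
    (h : ∀ z I, cosetFunction z I x = cosetFunction z I y) : x = y := by
  classical
  obtain ⟨r, hr, a, ha, hx⟩ := x.2
  obtain ⟨s, hs, b, hb, hy⟩ := y.2
  have h' : ∀ z : 𝓞 K, ∀ I : NonzeroIdeal (𝓞 K),
      (r - algebraMap K (FinAdele K) (algebraMap (𝓞 K) K z) ∈ idealAdeles I ∧ a ∈ idealAdeles I) ↔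
      (s - algebraMap K (FinAdele K) (algebraMap (𝓞 K) K z) ∈ idealAdeles I ∧
        b ∈ idealAdeles I) := fun z I => by
    have := h z I
    rw [cosetFunction_apply _ _ hx, cosetFunction_apply _ _ hy] at this
    split_ifs at this with h1 h2 h2
    · exact iff_of_true h1 h2
    · exact absurd this one_ne_zero
    · exact absurd this zero_ne_one
    · exact iff_of_false h1 h2
  have h1 : ∀ v n, a ∈ idealAdeles (primePowIdeal v n) →
      b ∈ idealAdeles (primePowIdeal v n) ∧ r - s ∈ idealAdeles (primePowIdeal v n) :=
    fun v n => mem_idealAdeles_of_cosetFunction hr fun z I => (h' z I).1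
  have h2 : ∀ v n, b ∈ idealAdeles (primePowIdeal v n) →
      a ∈ idealAdeles (primePowIdeal v n) ∧ s - r ∈ idealAdeles (primePowIdeal v n) :=
    fun v n => mem_idealAdeles_of_cosetFunction hs fun z I => (h' z I).2
  apply Subtype.ext
  rw [hx, hy, omega_eq]
  constructor
  · refine exists_unit_of_valued_eq fun v => le_antisymm ?_ ?_
    · refine withZero_le_of_forall_exp (ha v) fun n hn => ?_
      exact (mem_idealAdeles_primePowIdeal.1
        (h1 v n (mem_idealAdeles_primePowIdeal.2 ⟨ha, hn⟩)).1).2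
    · refine withZero_le_of_forall_exp (hb v) fun n hn => ?_
      exact (mem_idealAdeles_primePowIdeal.1
        (h2 v n (mem_idealAdeles_primePowIdeal.2 ⟨hb, hn⟩)).1).2
  · refine exists_mul_of_valued_le fun v => withZero_le_of_forall_exp (ha v) fun n hn => ?_
    rw [← Valuation.map_neg]
    have := (mem_idealAdeles_primePowIdeal.1
      (h1 v n (mem_idealAdeles_primePowIdeal.2 ⟨ha, hn⟩)).2).2
    rw [← neg_sub s r] at this
    exact this

/-- The translates of the functions `E_I` generate `C(Ω_R)`. -/
theorem denseRange_lift_cosetFunction : DenseRange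
    (FreeStarAlg.lift fun i : 𝓞 K × NonzeroIdeal (𝓞 K) => cosetFunction i.1 i.2) := by
  set φ := FreeStarAlg.lift fun i : 𝓞 K × NonzeroIdeal (𝓞 K) => cosetFunction i.1 i.2 with hφ
  -- Stone–Weierstrass. The range of the unital lift contains the constants, so only separation of
  -- points is left.
  have h := ContinuousMap.starSubalgebra_topologicalClosure_eq_top_of_separatesPoints φ.range ?_
  · rw [DenseRange, dense_iff_closure_eq]
    have h2 := congrArg (SetLike.coe : StarSubalgebra ℂ C(OmegaR K, ℂ) → Set _) h
    rwa [StarSubalgebra.topologicalClosure_coe] at h2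
  · intro x y hxy
    by_contra hne
    refine hxy (omega_eq_of_forall_cosetFunction fun z I => ?_)
    by_contra hz
    refine hne ⟨_, ⟨cosetFunction z I, ⟨.gen (z, I), ?_⟩, rfl⟩, hz⟩
    simp [hφ]

end Omega
end

noncomputable section

/-! ### Norm estimates through characters. -/

open scoped CStarAlgebra

/-- For commuting selfadjoint elements of a C*-algebra, the norm of a polynomial in these elements
is bounded by its values at the characters of the free `*`-algebra which factor through the
algebra generated by the elements. -/
theorem FreeStarAlg.norm_lift_le {ι A : Type*} [CStarAlgebra A] (e : ι → A)
    (hs : ∀ i, star (e i) = e i) (hc : ∀ i j, e i * e j = e j * e i) (p : FreeStarAlg ι) {C : ℝ}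
    (hC : 0 ≤ C) (h : ∀ ψ : FreeStarAlg ι →⋆ₐ[ℂ] ℂ, (∀ a, lift e a = 0 → ψ a = 0) → ‖ψ p‖ ≤ C) :
    ‖lift e p‖ ≤ C := by
  have hl : ∀ l, lift e (letter l) = e l.1 := fun l => by
    obtain ⟨x, _ | _⟩ := l <;> simp [lift_letter, hs]
  have hc1 : ∀ (a : FreeStarAlg ι) j, lift e a * e j = e j * lift e a := fun a j => by
    induction a using induction with
    | hz z => rw [AlgHomClass.commutes, Algebra.commutes]
    | hl l => rw [hl, hc]
    | ha a b iha ihb => rw [map_add, add_mul, iha, ihb, mul_add]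
    | hm a b iha ihb => rw [map_mul, mul_assoc, ihb, ← mul_assoc, iha, mul_assoc]
  have hc2 : ∀ a b : FreeStarAlg ι, lift e a * lift e b = lift e b * lift e a := fun a b => by
    induction b using induction with
    | hz z => rw [AlgHomClass.commutes, Algebra.commutes]
    | hl l => rw [hl, hc1]
    | ha b d iha ihb => rw [map_add, add_mul, ← iha, ← ihb, mul_add]
    | hm b d iha ihb => rw [map_mul, mul_assoc, ← ihb, ← mul_assoc, iha, mul_assoc]
  let D : StarSubalgebra ℂ A := (lift e).range.topologicalClosure
  have hcl : IsClosed (D : Set A) := StarSubalgebra.isClosed_topologicalClosure _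
  have hmem : ∀ a, lift e a ∈ D := fun a => StarSubalgebra.le_topologicalClosure _ ⟨a, rfl⟩
  -- The closed algebra generated by the elements is commutative, so its Gelfand transform is
  -- isometric and the norm is a supremum over characters. Each one pulls back to the free algebra
  -- and kills the kernel of `lift e`.
  let _ : CommCStarAlgebra D :=
    { StarSubalgebra.cstarAlgebra D with
      mul_comm := ((lift e).range.commRingTopologicalClosure (by
        rintro ⟨_, a, rfl⟩ ⟨_, b, rfl⟩
        exact Subtype.ext (hc2 a b))).mul_comm }
  let φ : FreeStarAlg ι →⋆ₐ[ℂ] D := (lift e).codRestrict D hmem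
  have h1 : ‖lift e p‖ = ‖WeakDual.gelfandTransform ℂ D (φ p)‖ :=
    ((gelfandTransform_isometry D).norm_map_of_map_zero (map_zero _) (φ p)).symm
  rw [h1, ContinuousMap.norm_le _ hC]
  intro χ
  let χ' : D →⋆ₐ[ℂ] ℂ :=
    { toFun := χ
      map_one' := map_one χ
      map_mul' := map_mul χ
      map_zero' := map_zero χ
      map_add' := map_add χ
      commutes' := AlgHomClass.commutes χ
      map_star' := map_star χ }
  refine h (χ'.comp φ) fun a ha => ?_
  have h2 : φ a = 0 := Subtype.ext ha
  rw [StarAlgHom.comp_apply, h2, map_zero]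

end

noncomputable section

open scoped nonZeroDivisors CStarAlgebra

/-! ### Coset projections in the Toeplitz algebra and their characters. -/

namespace ToeplitzAlgebra

variable {R : Type*} [CommRing R] [IsDomain R]

theorem of_rel {a b : FreeStarAlg (ToeplitzGen R)} (h : ToeplitzRel a b) :
    (toeplitzPresentation R).toUniversal a = (toeplitzPresentation R).toUniversal b :=
  (toeplitzPresentation R).toUniversal_eq_of_rel h

theorem toUniversal_gen_u (x : R) : (toeplitzPresentation R).toUniversal (.gen (.u x)) = u x := rfl
theorem toUniversal_gen_s (a : R⁰) : (toeplitzPresentation R).toUniversal (.gen (.s a)) = s a := rfl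
theorem toUniversal_gen_e (I : NonzeroIdeal R) :
    (toeplitzPresentation R).toUniversal (.gen (.e I)) = e I := rfl

theorem star_u_mul (x : R) : star (u x) * u x = 1 := by
  simpa only [map_mul, map_star, map_one, toUniversal_gen_u, toUniversal_gen_s, toUniversal_gen_e] using
    of_rel (.u_star_mul x)

theorem u_mul_star (x : R) : u x * star (u x) = 1 := by
  simpa only [map_mul, map_star, map_one, toUniversal_gen_u, toUniversal_gen_s, toUniversal_gen_e] using
    of_rel (.u_mul_star x)

theorem u_add (x y : R) : u (x + y) = u x * u y := by
  simpa only [map_mul, toUniversal_gen_u, toUniversal_gen_s, toUniversal_gen_e] using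
    (of_rel (.u_add x y)).symm

theorem star_s_mul (a : R⁰) : star (s a) * s a = 1 := by
  simpa only [map_mul, map_star, map_one, toUniversal_gen_u, toUniversal_gen_s, toUniversal_gen_e] using
    of_rel (.s_isometry a)

theorem s_mul (a b : R⁰) : s (a * b) = s a * s b := by
  simpa only [map_mul, toUniversal_gen_u, toUniversal_gen_s, toUniversal_gen_e] using
    (of_rel (.s_mul a b)).symm

theorem s_mul_u (a : R⁰) (x : R) : s a * u x = u (a * x) * s a := by
  simpa only [map_mul, toUniversal_gen_u, toUniversal_gen_s, toUniversal_gen_e] using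
    of_rel (.s_u a x)

theorem star_e (I : NonzeroIdeal R) : star (e I) = e I := by
  simpa only [map_star, toUniversal_gen_u, toUniversal_gen_s, toUniversal_gen_e] using
    of_rel (.e_star I)

theorem e_inter (I J : NonzeroIdeal R) : e (I.inter J) = e I * e J := by
  simpa only [map_mul, toUniversal_gen_u, toUniversal_gen_s, toUniversal_gen_e] using
    of_rel (.e_inter I J)

theorem e_whole : e (NonzeroIdeal.whole (R := R)) = 1 := by
  simpa only [map_one, toUniversal_gen_u, toUniversal_gen_s, toUniversal_gen_e] using
    of_rel (R := R) .e_whole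

theorem s_mul_e_mul_star (a : R⁰) (I : NonzeroIdeal R) :
    s a * e I * star (s a) = e (I.dilate a) := by
  simpa only [map_mul, map_star, toUniversal_gen_u, toUniversal_gen_s, toUniversal_gen_e] using
    of_rel (.s_e a I)

theorem u_mul_e {x : R} {I : NonzeroIdeal R} (h : x ∈ I.1) : u x * e I = e I * u x := by
  simpa only [map_mul, toUniversal_gen_u, toUniversal_gen_s, toUniversal_gen_e] using
    of_rel (.u_e_mem x I h)

theorem e_mul_u_mul_e {x : R} {I : NonzeroIdeal R} (h : x ∉ I.1) : e I * u x * e I = 0 := by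
  simpa only [map_mul, map_zero, toUniversal_gen_u, toUniversal_gen_s, toUniversal_gen_e] using
    of_rel (.u_e_notMem x I h)

/-- An idempotent isometry is 1: cancel one factor with the adjoint. -/
theorem u_zero : u (0 : R) = 1 := by
  have h := u_add (0 : R) 0
  rw [add_zero] at h
  have h2 := congrArg (star (u (0 : R)) * ·) h
  simp only [← mul_assoc, star_u_mul, one_mul] at h2
  exact h2.symm

theorem star_u (x : R) : star (u x) = u (-x) := by
  have h : u x * u (-x) = 1 := by rw [← u_add, add_neg_cancel, u_zero]
  have h2 := congrArg (star (u x) * ·) h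
  simp only [← mul_assoc, star_u_mul, one_mul, mul_one] at h2
  exact h2.symm

theorem e_mul_e_of_le {I J : NonzeroIdeal R} (h : I.1 ≤ J.1) : e I * e J = e I := by
  rw [← e_inter]
  exact congrArg e (Subtype.ext (inf_eq_left.2 h))

theorem e_mul_comm (I J : NonzeroIdeal R) : e I * e J = e J * e I := by
  rw [← e_inter, ← e_inter]
  exact congrArg e (Subtype.ext (inf_comm _ _))

/-- The projection `u^x e_I u^{-x}`. -/
def eCoset (x : R) (I : NonzeroIdeal R) : ToeplitzAlgebra R := u x * e I * star (u x)

theorem star_eCoset (x : R) (I : NonzeroIdeal R) : star (eCoset x I) = eCoset x I := by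
  rw [eCoset, star_mul, star_mul, star_star, star_e, mul_assoc]

theorem eCoset_zero (I : NonzeroIdeal R) : eCoset 0 I = e I := by
  rw [eCoset, u_zero, star_one, one_mul, mul_one]

theorem eCoset_whole (x : R) : eCoset x NonzeroIdeal.whole = 1 := by
  rw [eCoset, e_whole, mul_one, u_mul_star]

theorem u_mul_eCoset (x y : R) (I : NonzeroIdeal R) :
    u x * eCoset y I * star (u x) = eCoset (x + y) I := by
  rw [eCoset, eCoset, u_add, star_mul]
  simp only [mul_assoc]

/-- The relation s_a u^y = u^{ay} s_a and its adjoint carry s_a through to e_I, where s_a e_I s_a* =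
e_{aI} applies. -/
theorem s_mul_eCoset (a : R⁰) (y : R) (I : NonzeroIdeal R) :
    s a * eCoset y I * star (s a) = eCoset (a * y) (I.dilate a) := by
  rw [eCoset, eCoset, ← s_mul_e_mul_star]
  have h := congrArg star (s_mul_u a y)
  rw [star_mul, star_mul] at h
  simp only [mul_assoc, h]
  simp only [← mul_assoc, s_mul_u]

/-- The projection depends only on the coset, because u^{x-y} commutes with e_I. -/
theorem eCoset_eq_of_mem {x y : R} {I : NonzeroIdeal R} (h : x - y ∈ I.1) :
    eCoset x I = eCoset y I := by
  have h1 : eCoset (x - y) I = e I := by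
    rw [eCoset, u_mul_e h, mul_assoc, u_mul_star, mul_one]
  rw [← add_sub_cancel y x, ← u_mul_eCoset, h1]
  rfl

theorem eCoset_mul_eCoset_same (z : R) (I J : NonzeroIdeal R) :
    eCoset z I * eCoset z J = eCoset z (I.inter J) := by
  rw [eCoset, eCoset, eCoset, e_inter]
  calc u z * e I * star (u z) * (u z * e J * star (u z))
      = u z * e I * (star (u z) * u z) * e J * star (u z) := by simp only [mul_assoc]
    _ = _ := by rw [star_u_mul, mul_one]; simp only [mul_assoc]

/-- Cosets whose difference lies in I + J meet. With a common representative z the product reduces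
to e_I e_J = e_{I ∩ J}. -/
theorem exists_eCoset_mul_eCoset {x y : R} {I J : NonzeroIdeal R} (h : x - y ∈ I.1 ⊔ J.1) :
    ∃ z, x - z ∈ I.1 ∧ y - z ∈ J.1 ∧ eCoset x I * eCoset y J = eCoset z (I.inter J) := by
  obtain ⟨i, hi, j, hj, hij⟩ := Submodule.mem_sup.1 h
  have h1 : x - (x - i) ∈ I.1 := by rwa [sub_sub_cancel]
  have h2 : y - (x - i) ∈ J.1 := by
    rw [show y - (x - i) = -j by linear_combination hij]
    exact neg_mem hj
  exact ⟨x - i, h1, h2, by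
    rw [eCoset_eq_of_mem h1, eCoset_eq_of_mem h2, eCoset_mul_eCoset_same]⟩

/-- Disjoint cosets of different ideals reduce to one ideal: e_I and e_J both absorb e_{I+J}, and
the orthogonality relation for I + J kills the middle factor. -/
theorem eCoset_mul_eCoset_eq_zero {x y : R} {I J : NonzeroIdeal R} (h : x - y ∉ I.1 ⊔ J.1) :
    eCoset x I * eCoset y J = 0 := by
  let S : NonzeroIdeal R := ⟨I.1 ⊔ J.1, fun h => I.2 (le_bot_iff.1 (le_sup_left.trans h.le))⟩
  have h1 : -x + y ∉ S.1 := fun h' => h (by simpa [sub_eq_add_neg, add_comm] using neg_mem h')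
  have h2 : e I * u (-x + y) * e J = 0 := by
    rw [← e_mul_e_of_le (I := I) (J := S) le_sup_left,
      ← e_mul_e_of_le (I := J) (J := S) le_sup_right, e_mul_comm J S]
    calc e I * e S * u (-x + y) * (e S * e J)
        = e I * (e S * u (-x + y) * e S) * e J := by simp only [mul_assoc]
      _ = 0 := by rw [e_mul_u_mul_e h1, mul_zero, zero_mul]
  rw [eCoset, eCoset, star_u x]
  calc u x * e I * u (-x) * (u y * e J * star (u y))
      = u x * (e I * (u (-x) * u y) * e J) * star (u y) := by simp only [mul_assoc]
    _ = 0 := by rw [← u_add, h2, mul_zero, zero_mul]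

theorem eCoset_mul_comm (x y : R) (I J : NonzeroIdeal R) :
    eCoset x I * eCoset y J = eCoset y J * eCoset x I := by
  have h1 := star_eCoset x I
  have h2 := star_eCoset y J
  by_cases h : x - y ∈ I.1 ⊔ J.1
  · obtain ⟨z, hx, hy, -⟩ := exists_eCoset_mul_eCoset h
    rw [eCoset_eq_of_mem hx, eCoset_eq_of_mem hy, eCoset_mul_eCoset_same, eCoset_mul_eCoset_same]
    exact congrArg (eCoset z) (Subtype.ext (inf_comm _ _))
  · rw [eCoset_mul_eCoset_eq_zero h, ← h1, ← h2, ← star_mul,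
      eCoset_mul_eCoset_eq_zero h, star_zero]

theorem eCoset_mul_self (x : R) (I : NonzeroIdeal R) : eCoset x I * eCoset x I = eCoset x I := by
  rw [eCoset_mul_eCoset_same]
  exact congrArg (eCoset x) (Subtype.ext (inf_idem _))

section Characters

variable (ψ : FreeStarAlg (R × NonzeroIdeal R) →⋆ₐ[ℂ] ℂ)
  (hψ : ∀ a, FreeStarAlg.lift (fun i : R × NonzeroIdeal R => eCoset i.1 i.2) a = 0 → ψ a = 0)

include hψ

theorem character_eq {a b : FreeStarAlg (R × NonzeroIdeal R)}
    (h : FreeStarAlg.lift (fun i : R × NonzeroIdeal R => eCoset i.1 i.2) a =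
      FreeStarAlg.lift (fun i : R × NonzeroIdeal R => eCoset i.1 i.2) b) : ψ a = ψ b := by
  rw [← sub_eq_zero, ← map_sub]
  exact hψ _ (by rw [map_sub, h, sub_self])

theorem character_gen_eq (x : R) (I : NonzeroIdeal R) :
    ψ (.gen (x, I)) = 0 ∨ ψ (.gen (x, I)) = 1 := by
  have h : ψ (.gen (x, I) * .gen (x, I)) = ψ (.gen (x, I)) :=
    character_eq ψ hψ (by simp [eCoset_mul_self])
  rw [map_mul] at h
  exact IsIdempotentElem.iff_eq_zero_or_one.1 h

theorem character_gen_of_le {x y : R} {I J : NonzeroIdeal R} (h : x - y ∈ J.1) (hIJ : I.1 ≤ J.1)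
    (h1 : ψ (.gen (x, I)) = 1) : ψ (.gen (y, J)) = 1 := by
  have h2 : ψ (.gen (x, I) * .gen (y, J)) = ψ (.gen (x, I)) := character_eq ψ hψ (by
    simp only [map_mul, FreeStarAlg.lift_gen]
    rw [← eCoset_eq_of_mem h, eCoset_mul_eCoset_same]
    exact congrArg (eCoset x) (Subtype.ext (inf_eq_left.2 hIJ)))
  rwa [map_mul, h1, one_mul] at h2

/-- The cosets of value 1 form a filter base. Two of them must meet, since otherwise their product
would be zero, and the intersection again has value 1. -/
theorem exists_forall_le_of_character (F : Finset (R × NonzeroIdeal R))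
    (hF : ∀ i ∈ F, ψ (.gen i) = 1) : ∃ x : R, ∃ I : NonzeroIdeal R, ψ (.gen (x, I)) = 1 ∧
      ∀ i ∈ F, x - i.1 ∈ i.2.1 ∧ I.1 ≤ i.2.1 := by
  classical
  induction F using Finset.induction_on with
  | empty =>
    refine ⟨0, NonzeroIdeal.whole, ?_, by simp⟩
    rw [← map_one ψ]
    exact character_eq ψ hψ (by simp [eCoset_whole])
  | insert j F hj ih =>
    obtain ⟨x, I, h1, h2⟩ := ih fun i hi => hF i (Finset.mem_insert_of_mem hi)
    have h3 : ψ (.gen (x, I) * .gen j) = 1 := by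
      rw [map_mul, h1, hF j (Finset.mem_insert_self _ _), one_mul]
    by_cases hx : x - j.1 ∈ I.1 ⊔ j.2.1
    · obtain ⟨z, hz1, hz2, hz⟩ := exists_eCoset_mul_eCoset hx
      refine ⟨z, I.inter j.2, ?_, fun i hi => ?_⟩
      · rw [← h3]
        exact character_eq ψ hψ (by simp [hz])
      · rcases Finset.mem_insert.1 hi with rfl | hi
        · exact ⟨by simpa using neg_mem hz2, inf_le_right⟩
        · obtain ⟨h4, h5⟩ := h2 i hi
          refine ⟨?_, inf_le_left.trans h5⟩
          rw [show z - i.1 = (x - i.1) - (x - z) by ring]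
          exact sub_mem h4 (h5 hz1)
    · have : ψ (.gen (x, I) * .gen j) = ψ 0 :=
        character_eq ψ hψ (by simp [eCoset_mul_eCoset_eq_zero hx])
      rw [h3, map_zero] at this
      exact absurd this one_ne_zero

end Characters

open NumberField

variable {K : Type*} [Field K] [NumberField K]

theorem exists_point_of_character (ψ : FreeStarAlg (𝓞 K × NonzeroIdeal (𝓞 K)) →⋆ₐ[ℂ] ℂ)
    (hψ : ∀ a, FreeStarAlg.lift (fun i : 𝓞 K × NonzeroIdeal (𝓞 K) => eCoset i.1 i.2) a = 0 →
      ψ a = 0) : ∃ ω : OmegaR K, ∀ i, cosetFunction i.1 i.2 ω = ψ (.gen i) := by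
  classical
  -- For finitely many indices, the point attached to a small coset of value 1 has the required
  -- values. It lies in every listed coset of value 1 and in no other, by monotonicity of the
  -- character; compactness then handles all indices at once.
  have h := CompactSpace.iInter_nonempty
    (t := fun i => {ω : OmegaR K | cosetFunction i.1 i.2 ω = ψ (.gen i)})
    (fun i => isClosed_eq (map_continuous _) continuous_const) fun F => by
      obtain ⟨x, I, h1, h2⟩ := exists_forall_le_of_character ψ hψ (F.filter fun i => ψ (.gen i) = 1)
        (by simp)
      obtain ⟨ω, hω⟩ := exists_point x I
      refine ⟨ω, Set.mem_iInter₂.2 fun i hi => ?_⟩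
      rw [Set.mem_ofPred_eq, hω]
      split_ifs with h3
      · exact (character_gen_of_le ψ hψ h3.1 h3.2 h1).symm
      · rcases character_gen_eq ψ hψ i.1 i.2 with h4 | h4
        · exact h4.symm
        · exact absurd (h2 i (Finset.mem_filter.2 ⟨hi, h4⟩)) h3
  obtain ⟨ω, hω⟩ := h
  exact ⟨ω, fun i => Set.mem_iInter.1 hω i⟩

theorem exists_hom_of_omegaR : ∃ θ : C(OmegaR K, ℂ) →⋆ₐ[ℂ] ToeplitzAlgebra (𝓞 K),
    ∀ x I, θ (cosetFunction x I) = eCoset x I := by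
  set E := FreeStarAlg.lift fun i : 𝓞 K × NonzeroIdeal (𝓞 K) => cosetFunction i.1 i.2 with hE
  set φ := FreeStarAlg.lift fun i : 𝓞 K × NonzeroIdeal (𝓞 K) => eCoset i.1 i.2 with hφ
  obtain ⟨θ, hθ⟩ := exists_starHom_of_norm_le
    (E : FreeStarAlg (𝓞 K × NonzeroIdeal (𝓞 K)) →⋆ₙₐ[ℂ] C(OmegaR K, ℂ))
    (φ : FreeStarAlg (𝓞 K × NonzeroIdeal (𝓞 K)) →⋆ₙₐ[ℂ] ToeplitzAlgebra (𝓞 K))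
    denseRange_lift_cosetFunction fun p => by
      -- Each character is evaluation at a point, so its value on `p` is bounded by the sup norm of
      -- the corresponding polynomial in the coset functions.
      refine FreeStarAlg.norm_lift_le _ (fun i => star_eCoset _ _)
        (fun i j => eCoset_mul_comm _ _ _ _) p (norm_nonneg _) fun ψ hψ => ?_
      obtain ⟨ω, hω⟩ := exists_point_of_character ψ hψ
      have h : ∀ p, ψ p = E p ω := fun p => by
        induction p using FreeStarAlg.induction_gen with
        | h1 => simp
        | hg i => simp [hE, hω]
        | hs a ih => simp [map_star, ih]
        | hz z a ih => simp [ih]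
        | ha a b iha ihb => simp [iha, ihb]
        | hm a b iha ihb => simp [iha, ihb]
      rw [h]
      exact ContinuousMap.norm_coe_le_norm (E p) ω
  refine ⟨θ.toStarAlgHomOfMapOne ?_, fun x I => ?_⟩
  · rw [← map_one E]
    exact (hθ 1).trans (map_one φ)
  · have := hθ (.gen (x, I))
    change θ (E _) = φ _ at this
    rwa [hE, hφ, FreeStarAlg.lift_gen, FreeStarAlg.lift_gen] at this

end ToeplitzAlgebra
end

noncomputable section

open scoped nonZeroDivisors CStarAlgebra

/-! ### The semigroup crossed product and its universal property. -/

namespace SemigroupCrossedProduct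

variable {A S : Type*} [CStarAlgebra A] [Monoid S] (α : S →* (A →⋆ₙₐ[ℂ] A))

theorem of_rel {a b : FreeStarAlg (A ⊕ S)} (h : UnitalCovariantRel α a b) :
    (semigroupCrossedPresentation α).toUniversal a =
      (semigroupCrossedPresentation α).toUniversal b :=
  (semigroupCrossedPresentation α).toUniversal_eq_of_rel h

theorem toUniversal_gen_inl (a : A) :
    (semigroupCrossedPresentation α).toUniversal (.gen (.inl a)) = ofAlg α a := rfl
theorem toUniversal_gen_inr (s : S) :
    (semigroupCrossedPresentation α).toUniversal (.gen (.inr s)) = isom α s := rfl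

theorem ofAlg_one : ofAlg α 1 = 1 := by
  simpa only [map_one, toUniversal_gen_inl] using of_rel α .one

/-- The canonical `*`-homomorphism of `A` into `A ⋊ S`. -/
def ofAlgHom : A →⋆ₐ[ℂ] SemigroupCrossedProduct α :=
  NonUnitalStarAlgHom.toStarAlgHomOfMapOne
    { toFun := ofAlg α
      map_smul' := fun z a => by
        simpa only [map_smul, toUniversal_gen_inl, MonoidHom.id_apply] using
          of_rel α (.covariantRel (.smul z a))
      map_zero' := by
        simpa only [map_zero, toUniversal_gen_inl, zero_smul] using
          of_rel α (.covariantRel (.smul 0 0))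
      map_add' := fun a b => by
        simpa only [map_add, toUniversal_gen_inl] using of_rel α (.covariantRel (.add a b))
      map_mul' := fun a b => by
        simpa only [map_mul, toUniversal_gen_inl] using of_rel α (.covariantRel (.mul a b))
      map_star' := fun a => by
        simpa only [map_star, toUniversal_gen_inl] using of_rel α (.covariantRel (.star a)) }
    (ofAlg_one α)

theorem ofAlgHom_apply (a : A) : ofAlgHom α a = ofAlg α a := rfl

theorem star_isom_mul (s : S) : star (isom α s) * isom α s = 1 := by
  simpa only [map_mul, map_star, map_one, toUniversal_gen_inr] using
    of_rel α (.covariantRel (.isometry s))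

theorem isom_mul (s t : S) : isom α (s * t) = isom α s * isom α t := by
  simpa only [map_mul, toUniversal_gen_inr] using of_rel α (.covariantRel (.semigroup s t))

theorem isom_mul_ofAlg_mul_star (s : S) (a : A) :
    isom α s * ofAlg α a * star (isom α s) = ofAlg α (α s a) := by
  simpa only [map_mul, map_star, toUniversal_gen_inr, toUniversal_gen_inl] using
    (of_rel α (.covariantRel (.covariant s a))).symm

theorem isom_mul_ofAlg (s : S) (a : A) :
    isom α s * ofAlg α a = ofAlg α (α s a) * isom α s := by
  rw [← isom_mul_ofAlg_mul_star, mul_assoc, star_isom_mul, mul_one]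

theorem isom_mul_star (s : S) : isom α s * star (isom α s) = ofAlg α (α s 1) := by
  rw [← isom_mul_ofAlg_mul_star, ofAlg_one, mul_one]

theorem exists_starAlgHom {M : Type*} [CStarAlgebra M] (π : A →⋆ₐ[ℂ] M) (v : S → M)
    (hv : ∀ s, star (v s) * v s = 1) (hmul : ∀ s t, v (s * t) = v s * v t)
    (hc : ∀ s a, π (α s a) = v s * π a * star (v s)) :
    ∃ Φ : SemigroupCrossedProduct α →⋆ₐ[ℂ] M, (∀ a, Φ (ofAlg α a) = π a) ∧
      ∀ s, Φ (isom α s) = v s := by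
  obtain ⟨Φ, hΦ⟩ := (semigroupCrossedPresentation α).exists_starAlgHom (Sum.elim π v) (by
    rintro a b (⟨h⟩ | _)
    · cases h <;> simp [hv, hmul, hc, map_star]
    · simp)
  exact ⟨Φ, fun a => hΦ (.inl a), fun s => hΦ (.inr s)⟩

end SemigroupCrossedProduct

/-! ### The isomorphism between the Toeplitz algebra and the semigroup crossed product. -/

section Isomorphism

open NumberField SemigroupCrossedProduct ToeplitzAlgebra

variable (K : Type*) [Field K] [NumberField K]

theorem omegaR_hom_ext {M : Type*} [CStarAlgebra M] {Φ Ψ : C(OmegaR K, ℂ) →⋆ₐ[ℂ] M}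
    (h : ∀ x I, Φ (cosetFunction x I) = Ψ (cosetFunction x I)) : Φ = Ψ := by
  ext f
  refine denseRange_lift_cosetFunction.induction_on f
    (isClosed_eq (map_continuous Φ) (map_continuous Ψ)) fun p => ?_
  induction p using FreeStarAlg.induction_gen with
  | h1 => simp
  | hg i => simp [h]
  | hs a ih => simp only [map_star, ih]
  | hz z a ih => simp only [map_smul, ih]
  | ha a b iha ihb => simp only [map_add, iha, ihb]
  | hm a b iha ihb => simp only [map_mul, iha, ihb]

theorem cosetFunction_whole (x : 𝓞 K) : cosetFunction (K := K) x NonzeroIdeal.whole = 1 := by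
  rw [cosetFunction_eq_idealFunction (Submodule.mem_top), idealFunction_whole]

theorem exists_toeplitz_to_semigroupCrossedProduct :
    ∃ Φ : ToeplitzAlgebra (𝓞 K) →⋆ₐ[ℂ] SemigroupCrossedProduct (omegaSemigroupAction K),
      (∀ x : 𝓞 K, Φ (u x) = isom (omegaSemigroupAction K) ⟨x, 1⟩) ∧
      (∀ k : (𝓞 K)⁰, Φ (s k) = isom (omegaSemigroupAction K) ⟨0, k⟩) ∧
      (∀ I : NonzeroIdeal (𝓞 K), Φ (e I) =
        ofAlg (omegaSemigroupAction K) (idealFunction I)) := by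
  set α := omegaSemigroupAction K with hα
  have hmul : ∀ a b : C(OmegaR K, ℂ), ofAlg α a * ofAlg α b = ofAlg α (a * b) := fun a b =>
    (map_mul (ofAlgHom α) a b).symm
  -- Translation by an integer maps Ω_R onto itself, so the range projection of this isometry is 1.
  have hu : ∀ x : 𝓞 K, isom α ⟨x, 1⟩ * star (isom α ⟨x, 1⟩) = 1 := fun x => by
    rw [isom_mul_star, ← idealFunction_whole, hα]
    change ofAlg _ (cosetFunction x NonzeroIdeal.whole) = 1
    rw [cosetFunction_whole, ofAlg_one]
  obtain ⟨Φ, hΦ⟩ := (toeplitzPresentation (𝓞 K)).exists_starAlgHom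
    (fun g => match g with
      | .u x => isom α ⟨x, 1⟩
      | .s k => isom α ⟨0, k⟩
      | .e I => ofAlg α (idealFunction I)) (by
    intro a b h
    cases h with
    | u_star_mul x => simp [star_isom_mul, map_star]
    | u_mul_star x => simp [hu, map_star]
    | u_add x y =>
      simp only [map_mul, FreeStarAlg.lift_gen, ← isom_mul]
      congr 1
      ext <;> simp
    | s_isometry a => simp [star_isom_mul, map_star]
    | s_mul a b =>
      simp only [map_mul, FreeStarAlg.lift_gen, ← isom_mul]
      congr 1
      ext <;> simp
    | s_u a x =>
      simp only [map_mul, FreeStarAlg.lift_gen, ← isom_mul]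
      congr 1
      ext <;> simp
    | e_star I =>
      simp only [map_star, FreeStarAlg.lift_gen]
      rw [← ofAlgHom_apply, ← map_star, star_idealFunction]
    | e_idem I =>
      simp only [map_mul, FreeStarAlg.lift_gen, hmul, idealFunction_mul_self]
    | e_inter I J =>
      simp only [map_mul, FreeStarAlg.lift_gen, hmul, idealFunction_inter]
    | e_whole =>
      simp only [map_one, FreeStarAlg.lift_gen, idealFunction_whole, ofAlg_one]
    | s_e a I =>
      simp only [map_mul, map_star, FreeStarAlg.lift_gen, isom_mul_ofAlg_mul_star]
      rw [hα, omegaSemigroupAction_idealFunction, cosetFunction_zero]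
    | u_e_mem x I h =>
      simp only [map_mul, FreeStarAlg.lift_gen, isom_mul_ofAlg]
      rw [show α ⟨x, 1⟩ (idealFunction I) = idealFunction I from cosetFunction_eq_idealFunction h]
    | u_e_notMem x I h =>
      simp only [map_mul, map_zero, FreeStarAlg.lift_gen]
      -- Moving v_x to the right leaves the product of the indicator functions of the disjoint
      -- cosets I and x + I.
      rw [mul_assoc, isom_mul_ofAlg, ← mul_assoc, hmul,
        show α ⟨x, 1⟩ (idealFunction I) = cosetFunction x I from rfl,
        idealFunction_mul_cosetFunction h, ← ofAlgHom_apply, map_zero, zero_mul])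
  exact ⟨Φ, fun x => hΦ (.u x), fun k => hΦ (.s k), fun I => hΦ (.e I)⟩

theorem exists_semigroupCrossedProduct_to_toeplitz :
    ∃ Ψ : SemigroupCrossedProduct (omegaSemigroupAction K) →⋆ₐ[ℂ] ToeplitzAlgebra (𝓞 K),
      (∀ x I, Ψ (ofAlg (omegaSemigroupAction K) (cosetFunction x I)) = eCoset x I) ∧
      (∀ g : AxB (𝓞 K), Ψ (isom (omegaSemigroupAction K) g) = u g.add * s g.mul) := by
  obtain ⟨θ, hθ⟩ := exists_hom_of_omegaR (K := K)
  have hv : ∀ g : AxB (𝓞 K), star (u g.add * s g.mul) * (u g.add * s g.mul) = 1 := fun g => by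
    rw [star_mul, mul_assoc, ← mul_assoc (star (u g.add)), star_u_mul, one_mul, star_s_mul]
  have hcoset : ∀ (g : AxB (𝓞 K)) x I,
      θ (omegaSemigroupAction K g (cosetFunction x I)) =
        u g.add * s g.mul * θ (cosetFunction x I) * star (u g.add * s g.mul) := fun g x I => by
    rw [omegaSemigroupAction_cosetFunction, hθ, hθ, star_mul]
    rw [← u_mul_eCoset, ← s_mul_eCoset]
    simp only [mul_assoc]
  obtain ⟨Ψ, h1, h2⟩ := exists_starAlgHom (omegaSemigroupAction K) θ
    (fun g => u g.add * s g.mul) hv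
    (fun g h => by
      rw [AxB.mul_add', AxB.mul_mul', u_add, s_mul]
      calc u g.add * u (g.mul * h.add) * (s g.mul * s h.mul)
          = u g.add * (u (g.mul * h.add) * s g.mul) * s h.mul := by simp only [mul_assoc]
        _ = _ := by rw [← s_mul_u]; simp only [mul_assoc])
    (fun g f => by
      -- Covariance is known on coset functions. It passes to products because v*v = 1 cancels
      -- between the factors, and to all of C(Ω_R) by continuity.
      refine denseRange_lift_cosetFunction.induction_on f (isClosed_eq
        ((map_continuous θ).comp (map_continuous (omegaSemigroupAction K g)))
        ((continuous_const.mul (map_continuous θ)).mul continuous_const)) fun p => ?_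
      induction p using FreeStarAlg.induction_gen with
      | h1 => rw [map_one, ← cosetFunction_whole K 0]; exact hcoset g _ _
      | hg i => rw [FreeStarAlg.lift_gen]; exact hcoset g _ _
      | hs a ih =>
        simp only [map_star] at ih ⊢
        rw [ih]
        simp only [star_mul, star_star, mul_assoc]
      | hz z a ih =>
        simp only [map_smul] at ih ⊢
        rw [ih, mul_smul_comm, smul_mul_assoc]
      | ha a b iha ihb =>
        simp only [map_add] at iha ihb ⊢
        rw [iha, ihb, mul_add, add_mul]
      | hm a b iha ihb =>
        simp only [map_mul] at iha ihb ⊢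
        set v := u g.add * s g.mul
        rw [iha, ihb]
        simp only [mul_assoc]
        rw [← mul_assoc (star v) v, hv, one_mul])
  exact ⟨Ψ, fun x I => (h1 _).trans (hθ x I), h2⟩

theorem exists_toeplitz_equiv_semigroupCrossedProduct :
    ∃ Φ : ToeplitzAlgebra (𝓞 K) ≃⋆ₐ[ℂ] SemigroupCrossedProduct (omegaSemigroupAction K),
      (∀ x : 𝓞 K, Φ (u x) = isom (omegaSemigroupAction K) ⟨x, 1⟩) ∧
      (∀ k : (𝓞 K)⁰, Φ (s k) = isom (omegaSemigroupAction K) ⟨0, k⟩) ∧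
      (∀ I : NonzeroIdeal (𝓞 K), Φ (e I) =
        ofAlg (omegaSemigroupAction K) (idealFunction I)) := by
  obtain ⟨Φ, hu, hs, he⟩ := exists_toeplitz_to_semigroupCrossedProduct K
  obtain ⟨Ψ, hf, hg⟩ := exists_semigroupCrossedProduct_to_toeplitz K
  have hs1 : s (1 : (𝓞 K)⁰) = 1 := by
    have h := s_mul (1 : (𝓞 K)⁰) 1
    rw [one_mul] at h
    have h2 := congrArg (star (s (1 : (𝓞 K)⁰)) * ·) h
    simp only [← mul_assoc, star_s_mul, one_mul] at h2
    exact h2.symm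
  have h1 : ∀ a, Ψ (Φ a) = a := fun a => by
    have : ((Ψ.comp Φ : ToeplitzAlgebra (𝓞 K) →⋆ₐ[ℂ] _) : ToeplitzAlgebra (𝓞 K) →⋆ₙₐ[ℂ] _) =
        NonUnitalStarAlgHom.id ℂ _ := by
      refine (toeplitzPresentation (𝓞 K)).starHom_ext (by simp) fun g => ?_
      cases g with
      | u x =>
        change Ψ (Φ (u x)) = u x
        rw [hu, hg, hs1, mul_one]
      | s k =>
        change Ψ (Φ (s k)) = s k
        rw [hs, hg, u_zero, one_mul]
      | e I =>
        change Ψ (Φ (e I)) = e I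
        rw [he, ← cosetFunction_zero, hf, eCoset_zero]
    exact DFunLike.congr_fun this a
  have hfix : ∀ f, Φ (Ψ (ofAlg (omegaSemigroupAction K) f)) =
      ofAlg (omegaSemigroupAction K) f := fun f => by
    have : (Φ.comp Ψ).comp (ofAlgHom (omegaSemigroupAction K)) =
        ofAlgHom (omegaSemigroupAction K) := omegaR_hom_ext K fun x I => by
      change Φ (Ψ (ofAlg _ _)) = ofAlg _ _
      rw [hf, eCoset, map_mul, map_mul, map_star, hu, he, isom_mul_ofAlg_mul_star]
      rfl
    exact DFunLike.congr_fun this f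
  have h2 : ∀ b, Φ (Ψ b) = b := fun b => by
    have : ((Φ.comp Ψ : SemigroupCrossedProduct (omegaSemigroupAction K) →⋆ₐ[ℂ] _) :
        SemigroupCrossedProduct (omegaSemigroupAction K) →⋆ₙₐ[ℂ] _) =
        NonUnitalStarAlgHom.id ℂ _ := by
      refine (semigroupCrossedPresentation _).starHom_ext (by simp) fun g => ?_
      cases g with
      | inl f => exact hfix f
      | inr g =>
        change Φ (Ψ (isom _ g)) = isom _ g
        -- This uses the factorization (m, k) = (m, 1)(0, k).
        rw [hg, map_mul, hu, hs, ← isom_mul]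
        congr 1
        ext <;> simp
    exact DFunLike.congr_fun this b
  exact ⟨StarAlgEquiv.ofBijective Φ ⟨Function.LeftInverse.injective h1,
    Function.RightInverse.surjective h2⟩, hu, hs, he⟩

end Isomorphism
end

noncomputable section

open scoped nonZeroDivisors CStarAlgebra

/-! ### The crossed product by a discrete group. -/

namespace CrossedProduct

variable {A G : Type*} [NonUnitalCStarAlgebra A] [Group G] (α : G →* (A →⋆ₙₐ[ℂ] A))

theorem of_rel {a b : FreeStarAlg (A ⊕ G)} (h : CovariantRel α a b) :
    (covariantPresentation α).toUniversal a = (covariantPresentation α).toUniversal b :=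
  (covariantPresentation α).toUniversal_eq_of_rel h

theorem toUniversal_gen_inl (a : A) :
    (covariantPresentation α).toUniversal (.gen (.inl a)) = ofAlg α a := rfl
theorem toUniversal_gen_inr (g : G) :
    (covariantPresentation α).toUniversal (.gen (.inr g)) = unit α g := rfl

/-- The canonical `*`-homomorphism on `A`. -/
def ofAlgHom : A →⋆ₙₐ[ℂ] Ambient α where
  toFun := ofAlg α
  map_smul' z a := by
    simpa only [map_smul, toUniversal_gen_inl, MonoidHom.id_apply] using of_rel α (.smul z a)
  map_zero' := by
    simpa only [map_zero, toUniversal_gen_inl, zero_smul] using of_rel α (.smul 0 0)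
  map_add' a b := by
    simpa only [map_add, toUniversal_gen_inl] using of_rel α (.add a b)
  map_mul' a b := by
    simpa only [map_mul, toUniversal_gen_inl] using of_rel α (.mul a b)
  map_star' a := by
    simpa only [map_star, toUniversal_gen_inl] using of_rel α (.star a)

theorem ofAlgHom_apply (a : A) : ofAlgHom α a = ofAlg α a := rfl

theorem ofAlg_mul (a b : A) : ofAlg α (a * b) = ofAlg α a * ofAlg α b := map_mul (ofAlgHom α) a b

theorem star_ofAlg (a : A) : star (ofAlg α a) = ofAlg α (star a) := (map_star (ofAlgHom α) a).symm

theorem star_unit_mul (g : G) : star (unit α g) * unit α g = 1 := by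
  simpa only [map_mul, map_star, map_one, toUniversal_gen_inr] using of_rel α (.isometry g)

theorem unit_mul (g h : G) : unit α (g * h) = unit α g * unit α h := by
  simpa only [map_mul, toUniversal_gen_inr] using of_rel α (.semigroup g h)

theorem unit_one : unit α 1 = 1 := by
  have h := unit_mul α 1 1
  rw [one_mul] at h
  have h2 := congrArg (star (unit α 1) * ·) h
  simp only [← mul_assoc, star_unit_mul, one_mul] at h2
  exact h2.symm

theorem star_unit (g : G) : star (unit α g) = unit α g⁻¹ := by
  have h : unit α g * unit α g⁻¹ = 1 := by rw [← unit_mul, mul_inv_cancel, unit_one]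
  have h2 := congrArg (star (unit α g) * ·) h
  simp only [← mul_assoc, star_unit_mul, one_mul, mul_one] at h2
  exact h2.symm

theorem unit_mul_ofAlg (g : G) (a : A) : unit α g * ofAlg α a = ofAlg α (α g a) * unit α g := by
  have h : ofAlg α (α g a) = unit α g * ofAlg α a * star (unit α g) := by
    simpa only [map_mul, map_star, toUniversal_gen_inr, toUniversal_gen_inl] using
      of_rel α (.covariant g a)
  rw [h, mul_assoc, star_unit_mul, mul_one]

theorem unit_mul_ofAlg_mul_star (g : G) (a : A) :
    unit α g * ofAlg α a * star (unit α g) = ofAlg α (α g a) := by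
  rw [unit_mul_ofAlg, mul_assoc, star_unit, ← unit_mul, mul_inv_cancel, unit_one, mul_one]

theorem isClosed_coe : IsClosed (CrossedProduct α : Set (Ambient α)) :=
  NonUnitalStarSubalgebra.isClosed_topologicalClosure _

theorem ofAlg_mul_unit_mem (a : A) (g : G) : ofAlg α a * unit α g ∈ CrossedProduct α :=
  NonUnitalStarSubalgebra.le_topologicalClosure _
    (NonUnitalStarAlgebra.subset_adjoin ℂ _ ⟨a, g, rfl⟩)

theorem ofAlg_mem (a : A) : ofAlg α a ∈ CrossedProduct α := by
  simpa [unit_one] using ofAlg_mul_unit_mem α a 1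

theorem unit_mul_ofAlg_mem (a : A) (g : G) : unit α g * ofAlg α a ∈ CrossedProduct α := by
  rw [unit_mul_ofAlg]
  exact ofAlg_mul_unit_mem α _ _

/-- The crossed product is the closed linear span of the products `a * U g`. -/
theorem mem_of_closed_span {V : Submodule ℂ (Ambient α)} (hV : IsClosed (V : Set (Ambient α)))
    (h : ∀ a g, ofAlg α a * unit α g ∈ V) {b : Ambient α} (hb : b ∈ CrossedProduct α) : b ∈ V := by
  let W : Submodule ℂ (Ambient α) :=
    Submodule.span ℂ {b | ∃ a g, b = ofAlg α a * unit α g}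
  have hgen : ∀ a g, ofAlg α a * unit α g ∈ W := fun a g => Submodule.subset_span ⟨a, g, rfl⟩
  -- Covariance gives (a U_g)(c U_h) = a α_g(c) U_{gh}, so the span is already an algebra.
  have hmul : ∀ x ∈ W, ∀ y ∈ W, x * y ∈ W := fun x hx y hy => by
    induction hx using Submodule.span_induction with
    | mem x hx =>
      obtain ⟨a, g, rfl⟩ := hx
      induction hy using Submodule.span_induction with
      | mem y hy =>
        obtain ⟨c, h, rfl⟩ := hy
        rw [mul_assoc, ← mul_assoc (unit α g), unit_mul_ofAlg, mul_assoc, ← unit_mul, ← mul_assoc,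
          ← ofAlg_mul]
        exact hgen _ _
      | zero => rw [mul_zero]; exact zero_mem _
      | add y z _ _ hy hz => rw [mul_add]; exact add_mem hy hz
      | smul z y _ hy => rw [mul_smul_comm]; exact W.smul_mem _ hy
    | zero => rw [zero_mul]; exact zero_mem _
    | add y z _ _ hy hz => rw [add_mul]; exact add_mem hy hz
    | smul z y _ hy => rw [smul_mul_assoc]; exact W.smul_mem _ hy
  have hstar : ∀ x ∈ W, star x ∈ W := fun x hx => by
    induction hx using Submodule.span_induction with
    | mem x hx =>
      obtain ⟨a, g, rfl⟩ := hx
      rw [star_mul, star_ofAlg, star_unit, unit_mul_ofAlg]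
      exact hgen _ _
    | zero => rw [star_zero]; exact zero_mem _
    | add y z _ _ hy hz => rw [star_add]; exact add_mem hy hz
    | smul z y _ hy => rw [star_smul]; exact W.smul_mem _ hy
  let W' : NonUnitalStarSubalgebra ℂ (Ambient α) :=
    { W with
      mul_mem' := fun {x y} hx hy => hmul x hx y hy
      star_mem' := fun {x} hx => hstar x hx }
  have h1 : NonUnitalStarAlgebra.adjoin ℂ {b | ∃ a g, b = ofAlg α a * unit α g} ≤ W' :=
    NonUnitalStarAlgebra.adjoin_le fun b hb => Submodule.subset_span hb
  have h2 : W ≤ V := Submodule.span_le.2 (by rintro _ ⟨a, g, rfl⟩; exact h a g)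
  have h3 : (CrossedProduct α : Set (Ambient α)) ⊆ V :=
    closure_minimal (fun x hx => h2 (h1 hx)) hV
  exact h3 hb

end CrossedProduct

/-! ### Fractions in K ⋊ K*, extension by zero and restriction to Ω_R. -/

section Dilation

open NumberField SemigroupCrossedProduct
open scoped ZeroAtInfty

variable {K : Type*} [Field K] [NumberField K]

omit [NumberField K] in
theorem AxB.map_injective : Function.Injective (AxB.map (𝓞 K) K) := by
  intro g h hgh
  have h1 : algebraMap (𝓞 K) K g.add = algebraMap (𝓞 K) K h.add := congrArg AxB.add hgh
  have h2 : algebraMap (𝓞 K) K g.mul = algebraMap (𝓞 K) K h.mul :=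
    congrArg (fun z : AxB K => (z.mul : K)) hgh
  ext
  · exact congrArg _ (FaithfulSMul.algebraMap_injective (𝓞 K) K h1)
  · exact congrArg _ (FaithfulSMul.algebraMap_injective (𝓞 K) K h2)

/-- This is G = S⁻¹S: a common denominator d of both components of g yields t = (0, d). -/
theorem AxB.exists_map_mul_eq (g : AxB K) : ∃ t b : AxB (𝓞 K),
    AxB.map (𝓞 K) K t * g = AxB.map (𝓞 K) K b := by
  classical
  obtain ⟨d, hd⟩ := IsLocalization.exist_integer_multiples_of_finset (𝓞 K)⁰
    ({g.add, (g.mul : K)} : Finset K)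
  obtain ⟨m, hm⟩ := hd g.add (by simp)
  obtain ⟨k, hk⟩ := hd g.mul (by simp)
  rw [Algebra.smul_def] at hm hk
  have hk0 : k ≠ 0 := by
    rintro rfl
    rw [map_zero, eq_comm, mul_eq_zero] at hk
    rcases hk with h | h
    · simp at h
    · exact nonZeroDivisors.ne_zero g.mul.2 h
  refine ⟨⟨0, d⟩, ⟨m, ⟨k, mem_nonZeroDivisors_of_ne_zero hk0⟩⟩, ?_⟩
  ext
  · change algebraMap (𝓞 K) K 0 + algebraMap (𝓞 K) K d * g.add = algebraMap (𝓞 K) K m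
    rw [map_zero, zero_add, hm]
  · change algebraMap (𝓞 K) K d * (g.mul : K) = algebraMap (𝓞 K) K k
    rw [hk]

variable (K) in
/-- Extension by zero, as a `*`-homomorphism. -/
def extendZeroHom : C(OmegaR K, ℂ) →⋆ₙₐ[ℂ] C₀(OmegaA K, ℂ) where
  toFun := extendZero
  map_smul' z f := by
    ext x
    by_cases hx : x ∈ OmegaR K <;> simp [extendZero, hx]
  map_zero' := by
    ext x
    simp [extendZero]
  map_add' f g := by
    ext x
    by_cases hx : x ∈ OmegaR K <;> simp [extendZero, hx]
  map_mul' f g := by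
    ext x
    by_cases hx : x ∈ OmegaR K <;> simp [extendZero, hx]
  map_star' f := by
    ext x
    by_cases hx : x ∈ OmegaR K <;> simp [extendZero, hx]

theorem extendZeroHom_apply (f : C(OmegaR K, ℂ)) : extendZeroHom K f = extendZero f := rfl

variable (K) in
/-- Restriction to `Ω_R`, as a `*`-homomorphism. -/
def restrictHom : C₀(OmegaA K, ℂ) →⋆ₙₐ[ℂ] C(OmegaR K, ℂ) where
  toFun f := (f : C(OmegaA K, ℂ)).restrict (OmegaR K)
  map_smul' _ _ := rfl
  map_zero' := rfl
  map_add' _ _ := rfl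
  map_mul' _ _ := rfl
  map_star' _ := rfl

theorem restrictHom_apply (f : C₀(OmegaA K, ℂ)) (x : OmegaR K) : restrictHom K f x = f x := rfl

theorem restrictHom_extendZero (f : C(OmegaR K, ℂ)) : restrictHom K (extendZero f) = f := by
  ext x
  rw [restrictHom_apply, extendZero_apply]

theorem extendZero_restrictHom (f : C₀(OmegaA K, ℂ)) :
    extendZero (restrictHom K f) = extendZero 1 * f := by
  ext x
  by_cases hx : x ∈ OmegaR K <;> simp [extendZero, hx, restrictHom_apply]

theorem extendZero_omegaSemigroupAction (t : AxB (𝓞 K)) (f : C(OmegaR K, ℂ)) :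
    extendZero (omegaSemigroupAction K t f) =
      omegaAction K (AxB.map (𝓞 K) K t) (extendZero f) := by
  ext x
  exact extendZero_pushOmegaR t f x

/-- Restricting before translating loses the values outside tΩ_R; the factor α_t(1) is the indicator
function of tΩ_R. -/
theorem omegaSemigroupAction_restrictHom (t : AxB (𝓞 K)) (f : C₀(OmegaA K, ℂ)) :
    omegaSemigroupAction K t (restrictHom K f) =
      restrictHom K (omegaAction K (AxB.map (𝓞 K) K t) f) * omegaSemigroupAction K t 1 := by
  rw [← restrictHom_extendZero (omegaSemigroupAction K t (restrictHom K f)),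
    ← restrictHom_extendZero (omegaSemigroupAction K t 1), extendZero_omegaSemigroupAction,
    extendZero_omegaSemigroupAction, extendZero_restrictHom, map_mul, map_mul, mul_comm]

/-- The extra factor α_t(1) = v_t v_t* is absorbed by v_t, so restriction is covariant in the
one-sided form that the dilation requires. -/
theorem isom_mul_ofAlg_restrictHom (t : AxB (𝓞 K)) (f : C₀(OmegaA K, ℂ)) :
    isom (omegaSemigroupAction K) t * ofAlg (omegaSemigroupAction K) (restrictHom K f) =
      ofAlg (omegaSemigroupAction K) (restrictHom K (omegaAction K (AxB.map (𝓞 K) K t) f)) *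
        isom (omegaSemigroupAction K) t := by
  rw [isom_mul_ofAlg, omegaSemigroupAction_restrictHom, ← ofAlgHom_apply, map_mul, ofAlgHom_apply,
    ofAlgHom_apply, ← isom_mul_star, mul_assoc, mul_assoc, star_isom_mul, mul_one]

end Dilation
end

noncomputable section

open scoped nonZeroDivisors CStarAlgebra ZeroAtInfty
open NumberField SemigroupCrossedProduct

/-! ### Dilation of isometries of S to unitaries of G = S⁻¹S. -/

section Dilation

/-- An action of a group `G` on a C*-algebra `A`, with a `*`-homomorphism of `A` to a C*-algebra `T`
which is covariant with respect to a representation by isometries of a submonoid `S` of `G` such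
that `G = S⁻¹ S`. -/
structure DilationData (A S G T : Type*) [NonUnitalCStarAlgebra A] [Monoid S] [Group G]
    [CStarAlgebra T] where
  /-- the inclusion of the submonoid -/
  incl : S →* G
  incl_injective : Function.Injective incl
  exists_incl_mul_eq : ∀ g, ∃ t b, incl t * g = incl b
  /-- the action -/
  act : G →* (A →⋆ₙₐ[ℂ] A)
  /-- the isometries -/
  isom : S → T
  star_isom_mul : ∀ t, star (isom t) * isom t = 1
  isom_mul : ∀ s t, isom (s * t) = isom s * isom t
  /-- the `*`-homomorphism -/
  hom : A →⋆ₙₐ[ℂ] T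
  isom_mul_hom : ∀ t a, isom t * hom a = hom (act (incl t) a) * isom t

variable {A S G T : Type*} [NonUnitalCStarAlgebra A] [Monoid S] [Group G] [CStarAlgebra T]
  (D : DilationData A S G T)

namespace DilationData

theorem exists_incl_mul_eq_mul (s s' : G) : ∃ t t', D.incl t * s = D.incl t' * s' := by
  obtain ⟨t, b, h⟩ := D.exists_incl_mul_eq (s * s'⁻¹)
  exact ⟨t, b, by rw [← h, mul_assoc, inv_mul_cancel_right]⟩

theorem star_isom_mul_hom (t : S) (a : A) :
    star (D.isom t) * D.hom (D.act (D.incl t) a) = D.hom a * star (D.isom t) := by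
  have h := congrArg star (D.isom_mul_hom t (star a))
  rw [star_mul, star_mul, ← map_star, ← map_star, ← map_star, star_star] at h
  exact h.symm

theorem act_mul_apply (g h : G) (a : A) : D.act (g * h) a = D.act g (D.act h a) := by
  rw [map_mul]
  rfl

theorem isom_one : D.isom 1 = 1 := by
  have h := D.isom_mul 1 1
  rw [one_mul] at h
  have h2 := congrArg (star (D.isom 1) * ·) h
  simp only [← mul_assoc, D.star_isom_mul, one_mul] at h2
  exact h2.symm

/-- Only an inequality, because `T` may be the zero algebra, where ‖1‖ = 0. -/
theorem norm_isom_le (t : S) : ‖D.isom t‖ ≤ 1 := by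
  have h : ‖D.isom t‖ * ‖D.isom t‖ = ‖(1 : T)‖ := by
    rw [← CStarRing.norm_star_mul_self, D.star_isom_mul]
  have h1 : ‖(1 : T)‖ * ‖(1 : T)‖ = ‖(1 : T)‖ := by
    rw [← CStarRing.norm_star_mul_self, star_one, one_mul]
  have h2 : ‖(1 : T)‖ ≤ 1 := by nlinarith [norm_nonneg (1 : T)]
  nlinarith [norm_nonneg (D.isom t)]

/-- The relation `y (t s) = v_t y (s)` for all `t ∈ S`. -/
def IsTranslate (y : G → T) (s : G) : Prop :=
  ∀ t : S, y (D.incl t * s) = D.isom t * y s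

variable {D} in
theorem IsTranslate.incl_mul {y : G → T} {s : G} (h : D.IsTranslate y s)
    (t : S) : D.IsTranslate y (D.incl t * s) := fun t' => by
  rw [← mul_assoc, ← map_mul, h, h, D.isom_mul, mul_assoc]

variable {D} in
-- Any two elements of G have a common left multiple by S, and the property passes to left
-- multiples. Finitely many vectors can therefore be studied at a single base point.
theorem IsTranslate.exists_common {y z : G → T} {s s' : G}
    (h : D.IsTranslate y s) (h' : D.IsTranslate z s') :
    ∃ r, D.IsTranslate y r ∧ D.IsTranslate z r := by
  obtain ⟨t, t', ht⟩ := D.exists_incl_mul_eq_mul s s'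
  exact ⟨_, h.incl_mul t, ht ▸ h'.incl_mul t'⟩

/-- The space on which the isometries of `S` are dilated to unitaries of `G`: functions
on `G` which are determined by their value at some `s` as `y (t⁻¹ t' s) = v_t^* v_t' y (s)`. -/
def dilationSubmodule : Submodule ℂ (G → T) where
  carrier := {y | (∀ g (t : S), y g = star (D.isom t) * y (D.incl t * g)) ∧
    ∃ s, D.IsTranslate y s}
  zero_mem' := ⟨fun g t => by simp, 1, fun t => by simp⟩
  add_mem' := by
    rintro y z ⟨hy, s, hs⟩ ⟨hz, s', hs'⟩
    obtain ⟨r, hr, hr'⟩ := hs.exists_common hs'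
    refine ⟨fun g t => ?_, r, fun t => ?_⟩
    · rw [Pi.add_apply, Pi.add_apply, mul_add, ← hy, ← hz]
    · rw [Pi.add_apply, Pi.add_apply, mul_add, ← hr, ← hr']
  smul_mem' := by
    rintro c y ⟨hy, s, hs⟩
    refine ⟨fun g t => ?_, s, fun t => ?_⟩
    · rw [Pi.smul_apply, Pi.smul_apply, mul_smul_comm, ← hy]
    · rw [Pi.smul_apply, Pi.smul_apply, mul_smul_comm, ← hs]

/-- The dilation space, with the norm defined below. -/
def Space : Type _ := D.dilationSubmodule

namespace Space

variable {D}

instance : AddCommGroup (D.Space) := inferInstanceAs (AddCommGroup (D.dilationSubmodule))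
instance : Module ℂ (D.Space) := inferInstanceAs (Module ℂ (D.dilationSubmodule))

/-- The underlying function. -/
def toFun (y : D.Space) : G → T := Subtype.val y

instance : CoeFun (D.Space) fun _ => G → T := ⟨toFun⟩

/-- An element of the dilation space from a function. -/
def mk (y : G → T) (h : ∀ g t, y g = star (D.isom t) * y (D.incl t * g))
    (h' : ∃ s, D.IsTranslate y s) : D.Space := Subtype.mk y ⟨h, h'⟩

theorem add_apply (y z : D.Space) (g : G) : (y + z) g = y g + z g := rfl
theorem smul_apply (c : ℂ) (y : D.Space) (g : G) : (c • y) g = c • y g := rfl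
theorem zero_apply (g : G) : (0 : D.Space) g = 0 := rfl

theorem apply_eq (y : D.Space) (g : G) (t : S) :
    y g = star (D.isom t) * y (D.incl t * g) :=
  (Subtype.property y).1 g t

theorem exists_isTranslate (y : D.Space) : ∃ s, D.IsTranslate y s :=
  (Subtype.property y).2

theorem exists_isTranslate₂ (y z : D.Space) : ∃ s, D.IsTranslate y s ∧ D.IsTranslate z s := by
  obtain ⟨s, hs⟩ := y.exists_isTranslate
  obtain ⟨s', hs'⟩ := z.exists_isTranslate
  exact hs.exists_common hs'

/-- A common left multiple t g = t' s computes the value at g from that at s. The witnesses do not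
depend on `y`, so vectors which agree at a common base point agree everywhere. -/
theorem exists_apply_eq {s : G} (g : G) : ∃ t t' : S, ∀ y : D.Space,
    D.IsTranslate y s → y g = star (D.isom t) * (D.isom t' * y s) := by
  obtain ⟨t, t', ht⟩ := D.exists_incl_mul_eq_mul g s
  exact ⟨t, t', fun y hs => by rw [y.apply_eq g t, ht, hs]⟩

theorem ext_of_isTranslate {y z : D.Space} {s : G} (hy : D.IsTranslate y s)
    (hz : D.IsTranslate z s) (h : y s = z s) : y = z := by
  refine Subtype.ext (funext fun g => ?_)
  obtain ⟨t, t', ht⟩ := exists_apply_eq (D := D) (s := s) g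
  change y g = z g
  rw [ht y hy, ht z hz, h]

theorem norm_apply_le {y : D.Space} {s : G} (hs : D.IsTranslate y s) (g : G) :
    ‖y g‖ ≤ ‖y s‖ := by
  obtain ⟨t, t', h⟩ := exists_apply_eq (D := D) (s := s) g
  rw [h y hs]
  refine (norm_mul_le _ _).trans ?_
  rw [norm_star]
  refine (mul_le_of_le_one_left (norm_nonneg _) (D.norm_isom_le t)).trans ?_
  refine (norm_mul_le _ _).trans ?_
  exact mul_le_of_le_one_left (norm_nonneg _) (D.norm_isom_le t')

instance : Norm (D.Space) := ⟨fun y => ⨆ g, ‖y g‖⟩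

/-- The supremum is attained at any base point, since the other values arise from that one by
contractions. -/
theorem norm_eq {y : D.Space} {s : G} (hs : D.IsTranslate y s) : ‖y‖ = ‖y s‖ := by
  change (⨆ g, ‖y g‖) = _
  refine le_antisymm (ciSup_le (norm_apply_le hs)) ?_
  exact le_ciSup (f := fun g => ‖y g‖) ⟨_, by rintro _ ⟨g, rfl⟩; exact norm_apply_le hs g⟩ s

theorem isTranslate_add {y z : D.Space} {s : G} (hy : D.IsTranslate y s)
    (hz : D.IsTranslate z s) : D.IsTranslate (toFun (y + z)) s := fun t => by
  rw [add_apply, add_apply, mul_add, ← hy, ← hz]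

theorem isTranslate_smul {y : D.Space} {s : G} (hy : D.IsTranslate y s) (c : ℂ) :
    D.IsTranslate (toFun (c • y)) s := fun t => by
  rw [smul_apply, smul_apply, mul_smul_comm, ← hy]

theorem core : NormedSpace.Core ℂ (D.Space) where
  norm_nonneg y := Real.iSup_nonneg fun g => norm_nonneg _
  norm_smul c y := by
    obtain ⟨s, hs⟩ := y.exists_isTranslate
    rw [norm_eq hs, norm_eq (isTranslate_smul hs c), smul_apply, norm_smul]
  norm_triangle y z := by
    obtain ⟨s, hy, hz⟩ := y.exists_isTranslate₂ z
    rw [norm_eq hy, norm_eq hz, norm_eq (isTranslate_add hy hz), add_apply]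
    exact norm_add_le _ _
  norm_eq_zero_iff y := by
    obtain ⟨s, hs⟩ := y.exists_isTranslate
    rw [norm_eq hs, norm_eq_zero]
    constructor
    · intro h
      refine ext_of_isTranslate hs (s := s) (fun t => ?_) h
      rw [zero_apply, zero_apply, mul_zero]
    · rintro rfl
      rfl

instance : NormedAddCommGroup (D.Space) := NormedAddCommGroup.ofCore core
instance : NormedSpace ℂ (D.Space) := NormedSpace.ofCore core

/-- The inner product of the dilation space, with values in `T`. -/
def ip (y z : D.Space) : T :=
  star (y (y.exists_isTranslate₂ z).choose) * z (y.exists_isTranslate₂ z).choose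

theorem ip_eq {y z : D.Space} {s : G} (hy : D.IsTranslate y s) (hz : D.IsTranslate z s) :
    ip y z = star (y s) * z s := by
  obtain ⟨hy', hz'⟩ := (y.exists_isTranslate₂ z).choose_spec
  rw [ip]
  set r := (y.exists_isTranslate₂ z).choose
  obtain ⟨t, t', ht⟩ := D.exists_incl_mul_eq_mul s r
  -- Moving the base point up by t inserts v_t* v_t = 1, so all base points give the same product.
  have h : ∀ (t : S) s, D.IsTranslate y s → D.IsTranslate z s →
      star (y (D.incl t * s)) * z (D.incl t * s) = star (y s) * z s :=
    fun t s hy hz => by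
      rw [hy, hz, star_mul, mul_assoc, ← mul_assoc (star (D.isom t)), D.star_isom_mul, one_mul]
  rw [← h t s hy hz, ht, h t' r hy' hz']

theorem norm_ip_self (y : D.Space) : ‖ip y y‖ = ‖y‖ * ‖y‖ := by
  obtain ⟨s, hs⟩ := y.exists_isTranslate
  rw [ip_eq hs hs, norm_eq hs, CStarRing.norm_star_mul_self]

theorem norm_ip_le (y z : D.Space) : ‖ip y z‖ ≤ ‖y‖ * ‖z‖ := by
  obtain ⟨s, hy, hz⟩ := y.exists_isTranslate₂ z
  rw [ip_eq hy hz, norm_eq hy, norm_eq hz]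
  exact (norm_mul_le _ _).trans (by rw [norm_star])

theorem ip_add_left (y z w : D.Space) : ip (y + z) w = ip y w + ip z w := by
  obtain ⟨s, hy, hz⟩ := y.exists_isTranslate₂ z
  obtain ⟨s', hw⟩ := w.exists_isTranslate
  obtain ⟨t, t', ht⟩ := D.exists_incl_mul_eq_mul s s'
  have hy := hy.incl_mul t
  have hz := hz.incl_mul t
  have hw := hw.incl_mul t'
  rw [← ht] at hw
  rw [ip_eq (isTranslate_add hy hz) hw, ip_eq hy hw, ip_eq hz hw, add_apply, star_add, add_mul]

theorem star_ip (y z : D.Space) : star (ip y z) = ip z y := by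
  obtain ⟨s, hy, hz⟩ := y.exists_isTranslate₂ z
  rw [ip_eq hy hz, ip_eq hz hy, star_mul, star_star]

theorem ip_add_right (y z w : D.Space) : ip y (z + w) = ip y z + ip y w := by
  rw [← star_ip, ip_add_left, star_add, star_ip, star_ip]

theorem ip_smul_left (c : ℂ) (y z : D.Space) : ip (c • y) z = star c • ip y z := by
  obtain ⟨s, hy, hz⟩ := y.exists_isTranslate₂ z
  rw [ip_eq (isTranslate_smul hy c) hz, ip_eq hy hz, smul_apply, star_smul, smul_mul_assoc]

theorem ip_smul_right (c : ℂ) (y z : D.Space) : ip y (c • z) = c • ip y z := by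
  rw [← star_ip, ip_smul_left, star_smul, star_ip, star_star]

/-- The translation `y ↦ y (· h)`. -/
def translate (h : G) : D.Space →L[ℂ] D.Space :=
  LinearMap.mkContinuous
    { toFun := fun y => mk (fun g => y (g * h)) (fun g t => by
        rw [y.apply_eq (g * h) t, mul_assoc]) (by
        obtain ⟨s, hs⟩ := y.exists_isTranslate
        refine ⟨s * h⁻¹, fun t => ?_⟩
        change y (D.incl t * (s * h⁻¹) * h) = D.isom t * y (s * h⁻¹ * h)
        rw [mul_assoc, inv_mul_cancel_right, hs])
      map_add' := fun _ _ => rfl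
      map_smul' := fun _ _ => rfl } 1 fun y => by
    refine (ciSup_le fun g => ?_).trans (one_mul _).ge
    obtain ⟨s, hs⟩ := y.exists_isTranslate
    rw [norm_eq hs]
    exact norm_apply_le hs (g * h)

theorem translate_apply (h : G) (y : D.Space) (g : G) :
    translate h y g = y (g * h) := rfl

theorem isTranslate_translate {y : D.Space} {s h : G} (hs : D.IsTranslate y (s * h)) :
    D.IsTranslate (translate h y) s := fun t => by
  rw [translate_apply, translate_apply, mul_assoc, hs]

theorem norm_hom_act_le (g : G) (f : A) :
    ‖D.hom (D.act g f)‖ ≤ ‖f‖ :=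
  NonUnitalStarAlgHom.norm_apply_le (D.hom.comp (D.act g)) f

/-- The action of the elements of `A`. -/
def multiply (f : A) : D.Space →L[ℂ] D.Space :=
  LinearMap.mkContinuous
    { toFun := fun y => mk (fun g => D.hom (D.act g f) * y g) (fun g t => by
          rw [D.act_mul_apply, ← mul_assoc, D.star_isom_mul_hom, mul_assoc,
            ← y.apply_eq g t]) (by
          obtain ⟨s, hs⟩ := y.exists_isTranslate
          refine ⟨s, fun t => ?_⟩
          change D.hom (D.act (D.incl t * s) f) * y (D.incl t * s) =
            D.isom t * (D.hom (D.act s f) * y s)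
          rw [hs, D.act_mul_apply, ← mul_assoc, ← D.isom_mul_hom, mul_assoc])
      map_add' := fun y z => Subtype.ext (funext fun g => mul_add _ _ _)
      map_smul' := fun c y => Subtype.ext (funext fun g => mul_smul_comm _ _ _) } ‖f‖ fun y => by
    refine ciSup_le fun g => ?_
    obtain ⟨s, hs⟩ := y.exists_isTranslate
    rw [norm_eq hs]
    exact (norm_mul_le _ _).trans (mul_le_mul (norm_hom_act_le g f)
      (norm_apply_le hs g) (norm_nonneg _) (norm_nonneg _))

theorem multiply_apply (f : A) (y : D.Space) (g : G) :
    multiply f y g = D.hom (D.act g f) * y g := rfl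

theorem isTranslate_multiply {y : D.Space} {s : G} (hs : D.IsTranslate y s)
    (f : A) : D.IsTranslate (multiply f y) s := fun t => by
  rw [multiply_apply, multiply_apply, hs, D.act_mul_apply, ← mul_assoc,
    ← D.isom_mul_hom, mul_assoc]

theorem ext {y z : D.Space} (h : ∀ g, y g = z g) : y = z := Subtype.ext (funext h)

theorem ip_translate (h : G) (y z : D.Space) :
    ip (translate h y) z = ip y (translate h⁻¹ z) := by
  obtain ⟨s, hy, hz⟩ := (translate h y).exists_isTranslate₂ z
  have hy' : D.IsTranslate y (s * h) := fun t => by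
    rw [← mul_assoc]; exact hy t
  have hz' : D.IsTranslate (translate h⁻¹ z) (s * h) :=
    isTranslate_translate (by rwa [mul_inv_cancel_right])
  rw [ip_eq hy hz, ip_eq hy' hz', translate_apply, translate_apply, mul_inv_cancel_right]

theorem ip_multiply (f : A) (y z : D.Space) :
    ip (multiply f y) z = ip y (multiply (star f) z) := by
  obtain ⟨s, hy, hz⟩ := y.exists_isTranslate₂ z
  rw [ip_eq (isTranslate_multiply hy f) hz, ip_eq hy (isTranslate_multiply hz _), multiply_apply,
    multiply_apply, star_mul, map_star, map_star, mul_assoc]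

/-- The representation of the free `*`-algebra on the dilation space. -/
def rep : FreeStarAlg (A ⊕ G) →ₐ[ℂ] (D.Space →L[ℂ] D.Space) :=
  MonoidAlgebra.lift ℂ _ _ (FreeMonoid.lift fun l => match l with
    | (.inl f, false) => multiply f
    | (.inl f, true) => multiply (star f)
    | (.inr g, false) => translate g
    | (.inr g, true) => translate g⁻¹)

theorem rep_gen_inl (f : A) : rep (D := D) (.gen (.inl f)) = multiply f := by
  simp [rep, FreeStarAlg.gen, FreeStarAlg.letter]

theorem rep_star_gen_inl (f : A) :
    rep (D := D) (star (.gen (.inl f))) = multiply (star f) := by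
  rw [FreeStarAlg.gen, FreeStarAlg.star_letter]
  simp [rep, FreeStarAlg.letter]

theorem rep_gen_inr (g : G) : rep (D := D) (.gen (.inr g)) = translate g := by
  simp [rep, FreeStarAlg.gen, FreeStarAlg.letter]

theorem rep_star_gen_inr (g : G) : rep (D := D) (star (.gen (.inr g))) = translate g⁻¹ := by
  rw [FreeStarAlg.gen, FreeStarAlg.star_letter]
  simp [rep, FreeStarAlg.letter]

theorem ip_rep (a : FreeStarAlg (A ⊕ G)) (y z : D.Space) :
    ip (rep (D := D) a y) z = ip y (rep (D := D) (star a) z) := by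
  induction a using FreeStarAlg.induction_gen generalizing y z with
  | h1 => simp
  | hg x =>
    cases x with
    | inl f => rw [rep_gen_inl, rep_star_gen_inl, ip_multiply]
    | inr g => rw [rep_gen_inr, rep_star_gen_inr, ip_translate]
  | hs a ih => rw [star_star, ← star_ip, ← ih, star_ip]
  | hz c a ih =>
    rw [star_smul, map_smul, map_smul, _root_.smul_apply,
      _root_.smul_apply, ip_smul_left, ip_smul_right, ih]
  | ha a b iha ihb =>
    rw [star_add, map_add, map_add, _root_.add_apply, _root_.add_apply,
      ip_add_left, ip_add_right, iha, ihb]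
  | hm a b iha ihb =>
    rw [star_mul, map_mul, map_mul, mul_apply_eq_comp, mul_apply_eq_comp,
      iha, ihb]

/-- As for Hilbert space operators: ‖ay‖² = ‖⟨y, a*a y⟩‖ ≤ ‖a*a‖ ‖y‖². Completeness of the space
plays no role, as only the operator norm on the image of the free algebra is used. -/
theorem norm_rep_mul_self_le (a : FreeStarAlg (A ⊕ G)) :
    ‖rep (D := D) a‖ * ‖rep (D := D) a‖ ≤ ‖rep (D := D) (star a * a)‖ := by
  have h : ‖rep (D := D) a‖ ≤ √‖rep (D := D) (star a * a)‖ := by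
    refine ContinuousLinearMap.opNorm_le_bound _ (Real.sqrt_nonneg _) fun y => ?_
    refine le_of_sq_le_sq ?_ (mul_nonneg (Real.sqrt_nonneg _) (norm_nonneg _))
    rw [mul_pow, Real.sq_sqrt (norm_nonneg _), sq, ← norm_ip_self, ip_rep, ← mul_apply_eq_comp,
      ← map_mul]
    refine (norm_ip_le _ _).trans ?_
    have := (rep (D := D) (star a * a)).le_opNorm y
    nlinarith [norm_nonneg y]
  have := mul_self_le_mul_self (norm_nonneg _) h
  rwa [Real.mul_self_sqrt (norm_nonneg _)] at this

theorem norm_rep_le_star (a : FreeStarAlg (A ⊕ G)) :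
    ‖rep (D := D) a‖ ≤ ‖rep (D := D) (star a)‖ := by
  rcases (norm_nonneg (rep (D := D) a)).eq_or_lt with h | h
  · rw [← h]
    exact norm_nonneg _
  · refine le_of_mul_le_mul_right ((norm_rep_mul_self_le a).trans ?_) h
    rw [map_mul]
    exact norm_mul_le _ _

variable (D) in
/-- The C*-seminorm on the free `*`-algebra defined by the representation on the dilation space. -/
def repSeminorm : CStarSeminorm (FreeStarAlg (A ⊕ G)) where
  toFun a := ‖rep (D := D) a‖
  map_zero' := by rw [map_zero, norm_zero]
  add_le' a b := by rw [map_add]; exact norm_add_le _ _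
  neg' a := by rw [map_neg, norm_neg]
  smul' z a := by rw [map_smul, norm_smul]
  mul_le' a b := by rw [map_mul]; exact norm_mul_le _ _
  star_mul_self' a := by
    refine le_antisymm ?_ (norm_rep_mul_self_le a)
    rw [map_mul]
    refine (norm_mul_le _ _).trans (mul_le_mul_of_nonneg_right ?_ (norm_nonneg _))
    simpa using norm_rep_le_star (D := D) (star a)

theorem rep_eq_of_rel {a b : FreeStarAlg (A ⊕ G)} (h : CovariantRel D.act a b) :
    rep (D := D) a = rep (D := D) b := by
  refine ContinuousLinearMap.ext fun y => ext fun g => ?_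
  cases h with
  | add a b =>
    rw [map_add, rep_gen_inl, rep_gen_inl, rep_gen_inl, _root_.add_apply, add_apply,
      multiply_apply, multiply_apply, multiply_apply, map_add, map_add, add_mul]
  | smul z a =>
    rw [map_smul, rep_gen_inl, rep_gen_inl, _root_.smul_apply, smul_apply,
      multiply_apply, multiply_apply, map_smul, map_smul, smul_mul_assoc]
  | mul a b =>
    rw [map_mul, rep_gen_inl, rep_gen_inl, rep_gen_inl, mul_apply_eq_comp,
      multiply_apply, multiply_apply, multiply_apply, map_mul, map_mul, mul_assoc]
  | star a => rw [rep_gen_inl, rep_star_gen_inl]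
  | isometry s =>
    rw [map_mul, rep_gen_inr, rep_star_gen_inr, mul_apply_eq_comp, translate_apply,
      translate_apply, inv_mul_cancel_right, map_one]
    rfl
  | semigroup s t =>
    rw [map_mul, rep_gen_inr, rep_gen_inr, rep_gen_inr, mul_apply_eq_comp, translate_apply,
      translate_apply, translate_apply, mul_assoc]
  | covariant s a =>
    rw [map_mul, map_mul, rep_gen_inr, rep_star_gen_inr, rep_gen_inl, rep_gen_inl,
      mul_apply_eq_comp, mul_apply_eq_comp, translate_apply, multiply_apply,
      multiply_apply, translate_apply, mul_inv_cancel_right, D.act_mul_apply]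

/-- The operators form a covariant pair, so their C*-seminorm is one of those whose supremum is the
universal norm. -/
theorem norm_rep_le (a : FreeStarAlg (A ⊕ G)) :
    ‖rep (D := D) a‖ ≤ ‖(covariantPresentation D.act).toUniversal a‖ :=
  (covariantPresentation D.act).norm_toUniversal_ge (repSeminorm D) (fun a b h => by
    change ‖rep (D := D) (a - b)‖ = 0
    rw [map_sub, rep_eq_of_rel h, sub_self, norm_zero]) a

end Space

/-- The value `v_t^* v_b` at `t⁻¹ b`. -/
def cocycle (g : G) : T :=
  star (D.isom (D.exists_incl_mul_eq g).choose) *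
    D.isom (D.exists_incl_mul_eq g).choose_spec.choose

/-- Two fractions t⁻¹b = t'⁻¹b' become equal after expansion by some c and c' in S, and expansion
does not change v_t* v_b. Injectivity of the inclusion brings the equalities back to S. -/
theorem cocycle_eq {g : G} {t b : S} (h : D.incl t * g = D.incl b) :
    D.cocycle g = star (D.isom t) * D.isom b := by
  have h' := (D.exists_incl_mul_eq g).choose_spec.choose_spec
  rw [cocycle]
  set t' := (D.exists_incl_mul_eq g).choose
  set b' := (D.exists_incl_mul_eq g).choose_spec.choose
  obtain ⟨c, c', hc⟩ := D.exists_incl_mul_eq_mul (D.incl t) (D.incl t')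
  have h1 : c * t = c' * t' := D.incl_injective (by rw [map_mul, map_mul, hc])
  have h2 : c * b = c' * b' :=
    D.incl_injective (by rw [map_mul, map_mul, ← h, ← h', ← mul_assoc, ← mul_assoc, hc])
  have h3 : ∀ c t b, star (D.isom t) * D.isom b = star (D.isom (c * t)) * D.isom (c * b) :=
    fun c t b => by
      rw [D.isom_mul, D.isom_mul, star_mul, mul_assoc, ← mul_assoc (star (D.isom c)),
        D.star_isom_mul, one_mul]
  rw [h3 c t b, h3 c' t' b', h1, h2]

theorem cocycle_incl (s : S) : D.cocycle (D.incl s) = D.isom s := by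
  rw [D.cocycle_eq (t := 1) (b := s) (by rw [map_one, one_mul]), D.isom_one, star_one, one_mul]

theorem cocycle_inv_incl (s : S) : D.cocycle (D.incl s)⁻¹ = star (D.isom s) := by
  rw [D.cocycle_eq (t := s) (b := 1) (by rw [map_one, mul_inv_cancel]), D.isom_one, mul_one]

/-- The embedding into the dilation space. -/
def embed (x : T) : D.Space :=
  Space.mk (fun g => D.cocycle g * x) (fun g t => by
    obtain ⟨c, b, h⟩ := D.exists_incl_mul_eq (D.incl t * g)
    rw [D.cocycle_eq h, D.cocycle_eq (t := c * t) (b := b) (by rw [map_mul, mul_assoc, h]),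
      D.isom_mul, star_mul]
    simp only [mul_assoc])
    ⟨1, fun t => by
      change D.cocycle (D.incl t * 1) * x = D.isom t * (D.cocycle 1 * x)
      rw [mul_one, D.cocycle_incl, ← map_one D.incl, D.cocycle_incl, D.isom_one, one_mul]⟩

theorem embed_apply (x : T) (g : G) : D.embed x g = D.cocycle g * x := rfl

theorem embed_apply_incl (x : T) (s : S) : D.embed x (D.incl s) = D.isom s * x := by
  rw [embed_apply, cocycle_incl]

theorem embed_apply_one (x : T) : D.embed x 1 = x := by
  rw [← map_one D.incl, embed_apply_incl, isom_one, one_mul]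

theorem isTranslate_embed (x : T) (s : S) : D.IsTranslate (D.embed x) (D.incl s) := fun t => by
  rw [← map_mul, embed_apply_incl, embed_apply_incl, D.isom_mul, mul_assoc]

theorem isTranslate_embed_one (x : T) : D.IsTranslate (D.embed x) 1 := by
  rw [← map_one D.incl]
  exact D.isTranslate_embed x 1

theorem norm_embed (x : T) : ‖D.embed x‖ = ‖x‖ := by
  rw [Space.norm_eq (D.isTranslate_embed_one x), embed_apply_one]

theorem embed_add (x y : T) : D.embed (x + y) = D.embed x + D.embed y :=
  Space.ext fun _ => mul_add _ _ _

theorem embed_smul (c : ℂ) (x : T) : D.embed (c • x) = c • D.embed x :=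
  Space.ext fun _ => mul_smul_comm _ _ _

/-- The embedded copy of `T` consists of the vectors with base point 1, so identities on it are
checked by evaluation at 1. -/
theorem eq_embed {y : D.Space} (h : D.IsTranslate y 1) : y = D.embed (y 1) :=
  Space.ext_of_isTranslate h (D.isTranslate_embed_one _) (D.embed_apply_one _).symm

theorem multiply_embed (f : A) (x : T) :
    Space.multiply f (D.embed x) = D.embed (D.hom f * x) := by
  rw [D.eq_embed (Space.isTranslate_multiply (D.isTranslate_embed_one x) f),
    Space.multiply_apply, embed_apply_one, map_one]
  rfl

theorem translate_incl_embed (s : S) (x : T) :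
    Space.translate (D.incl s) (D.embed x) = D.embed (D.isom s * x) := by
  rw [D.eq_embed (y := Space.translate (D.incl s) (D.embed x))
    (Space.isTranslate_translate (by rw [one_mul]; exact D.isTranslate_embed x s)),
    Space.translate_apply, one_mul, embed_apply_incl]

/-- Translation by s⁻¹ may lead out of the embedded copy. Multiplication by `e`, which acts at t as
v_t v_t*, compresses back into it and turns the inverse translation into v_s*. -/
theorem multiply_translate_inv_embed {e : A} (he : D.hom e = 1)
    (he' : ∀ t, D.hom (D.act (D.incl t) e) = D.isom t * star (D.isom t)) (s : S) (x : T) :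
    Space.multiply e (Space.translate (D.incl s)⁻¹ (D.embed x)) =
      D.embed (star (D.isom s) * x) := by
  set y := Space.translate (D.incl s)⁻¹ (D.embed x)
  have h1 : Space.multiply e y 1 = y 1 := by
    rw [Space.multiply_apply, map_one]
    exact (congrArg (· * y 1) he).trans (one_mul _)
  have h : D.IsTranslate (Space.multiply e y) 1 := fun t => by
    rw [h1, mul_one, Space.multiply_apply, he', mul_assoc]
    congr 1
    have := y.apply_eq 1 t
    rw [mul_one] at this
    exact this.symm
  rw [D.eq_embed h, h1, Space.translate_apply, one_mul, embed_apply, cocycle_inv_incl]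

section Implement

variable {X : Type*} {τ : FreeStarAlg X →⋆ₐ[ℂ] T} {σ : FreeStarAlg X →⋆ₐ[ℂ] FreeStarAlg (A ⊕ G)}
  (h : ∀ x z, Space.rep (σ (.gen x)) (D.embed z) = D.embed (τ (.gen x) * z))
  (h' : ∀ x z, Space.rep (star (σ (.gen x))) (D.embed z) = D.embed (star (τ (.gen x)) * z))

include h h'

theorem rep_embed (a : FreeStarAlg X) (z : T) :
    Space.rep (σ a) (D.embed z) = D.embed (τ a * z) := by
  induction a using FreeStarAlg.induction generalizing z with
  | hz c =>
    rw [AlgHomClass.commutes, AlgHomClass.commutes, AlgHomClass.commutes, ← Algebra.smul_def,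
      embed_smul, Algebra.algebraMap_eq_smul_one]
    rfl
  | hl l =>
    obtain ⟨x, _ | _⟩ := l
    · exact h x z
    · have := h' x z
      rwa [← map_star, ← map_star, FreeStarAlg.gen, FreeStarAlg.star_letter] at this
  | ha a b iha ihb => rw [map_add, map_add, map_add, _root_.add_apply, iha, ihb, add_mul, embed_add]
  | hm a b iha ihb => rw [map_mul, map_mul, map_mul, mul_apply_eq_comp, ihb, iha, mul_assoc]

/-- A `*`-homomorphism to `T` which is implemented on the embedded copy of `T` by elements of the
crossed product does not increase norms. -/
theorem norm_le_norm_toUniversal {e : A} (he : D.hom e = 1) (a : FreeStarAlg X) :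
    ‖τ a‖ ≤ ‖(covariantPresentation D.act).toUniversal (FreeStarAlg.gen (Sum.inl e) * σ a)‖ := by
  have h1 : ‖(1 : T)‖ ≤ 1 := by
    have := D.norm_isom_le 1
    rwa [isom_one] at this
  -- The embedded unit is the test vector: σ a acts on it as left multiplication by τ a, and `e`
  -- acts trivially on the result.
  have h2 : Space.rep (FreeStarAlg.gen (Sum.inl e) * σ a) (D.embed 1) = D.embed (τ a) := by
    rw [map_mul, mul_apply_eq_comp, D.rep_embed h h', mul_one, Space.rep_gen_inl, multiply_embed,
      he, one_mul]
  rw [← D.norm_embed, ← h2]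
  refine le_trans ?_ (Space.norm_rep_le (D := D) (FreeStarAlg.gen (Sum.inl e) * σ a))
  refine (ContinuousLinearMap.le_opNorm _ _).trans ?_
  rw [norm_embed]
  exact mul_le_of_le_one_right (norm_nonneg _) h1

end Implement

end DilationData

end Dilation
end

noncomputable section

open scoped nonZeroDivisors CStarAlgebra ZeroAtInfty
open NumberField

theorem FreeStarAlg.map_lift {X M N : Type*} [Ring M] [StarRing M] [Algebra ℂ M] [StarModule ℂ M]
    [Ring N] [StarRing N] [Algebra ℂ N] [StarModule ℂ N] (Φ : M →⋆ₐ[ℂ] N) (f : X → M)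
    (a : FreeStarAlg X) : Φ (FreeStarAlg.lift f a) = FreeStarAlg.lift (fun x => Φ (f x)) a := by
  induction a using FreeStarAlg.induction_gen with
  | h1 => simp
  | hg x => simp
  | hs a ih => simp only [map_star, ih]
  | hz z a ih => simp only [map_smul, ih]
  | ha a b iha ihb => simp only [map_add, iha, ihb]
  | hm a b iha ihb => simp only [map_mul, iha, ihb]

/-! ### The isometric embedding into the crossed product. -/

section Corner

variable {K : Type*} [Field K] [NumberField K]

theorem restrictHom_extendZero_one_smul (t : AxB (𝓞 K)) :
    restrictHom K (omegaAction K (AxB.map (𝓞 K) K t) (extendZero 1)) =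
      omegaSemigroupAction K t 1 := by
  rw [← extendZero_omegaSemigroupAction, restrictHom_extendZero]

variable (K) in
/-- The restriction to `Ω_R`, as a covariant map to the semigroup crossed product. -/
def omegaDilationData : DilationData C₀(OmegaA K, ℂ) (AxB (𝓞 K)) (AxB K)
    (SemigroupCrossedProduct (omegaSemigroupAction K)) where
  incl := AxB.map (𝓞 K) K
  incl_injective := AxB.map_injective
  exists_incl_mul_eq := AxB.exists_map_mul_eq
  act := omegaAction K
  isom := SemigroupCrossedProduct.isom (omegaSemigroupAction K)
  star_isom_mul := SemigroupCrossedProduct.star_isom_mul _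
  isom_mul := SemigroupCrossedProduct.isom_mul _
  hom := (SemigroupCrossedProduct.ofAlgHom (omegaSemigroupAction K) :
    C(OmegaR K, ℂ) →⋆ₙₐ[ℂ] _).comp (restrictHom K)
  isom_mul_hom := isom_mul_ofAlg_restrictHom

theorem isStarProjection_omegaProjection : IsStarProjection (omegaProjection K) := by
  refine ⟨?_, ?_⟩
  · rw [IsIdempotentElem, omegaProjection, ← CrossedProduct.ofAlg_mul, ← extendZeroHom_apply,
      ← map_mul, mul_one]
  · rw [isSelfAdjoint_iff, omegaProjection, CrossedProduct.star_ofAlg, ← extendZeroHom_apply,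
      ← map_star, star_one]

theorem omegaProjection_mul_ofAlg_extendZero (f : C(OmegaR K, ℂ)) :
    omegaProjection K * CrossedProduct.ofAlg (omegaAction K) (extendZero f) =
      CrossedProduct.ofAlg (omegaAction K) (extendZero f) := by
  rw [omegaProjection, ← CrossedProduct.ofAlg_mul, ← extendZeroHom_apply, ← extendZeroHom_apply,
    ← map_mul, one_mul]

theorem ofAlg_extendZero_mul_omegaProjection (f : C(OmegaR K, ℂ)) :
    CrossedProduct.ofAlg (omegaAction K) (extendZero f) * omegaProjection K =
      CrossedProduct.ofAlg (omegaAction K) (extendZero f) := by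
  rw [omegaProjection, ← CrossedProduct.ofAlg_mul, ← extendZeroHom_apply, ← extendZeroHom_apply,
    ← map_mul, mul_one]

/-- Since tΩ_R is contained in Ω_R, the element U_t p already lies in the corner and equals p U_t p.
-/
theorem omegaProjection_mul_unit_mul (t : AxB (𝓞 K)) :
    omegaProjection K * (CrossedProduct.unit (omegaAction K) (AxB.map (𝓞 K) K t) *
      omegaProjection K) =
      CrossedProduct.unit (omegaAction K) (AxB.map (𝓞 K) K t) * omegaProjection K := by
  rw [show CrossedProduct.unit (omegaAction K) (AxB.map (𝓞 K) K t) * omegaProjection K = _ from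
    CrossedProduct.unit_mul_ofAlg _ _ _, ← mul_assoc, ← extendZero_omegaSemigroupAction,
    omegaProjection_mul_ofAlg_extendZero]

/-- The semigroup crossed product embeds isometrically into the crossed product. -/
theorem exists_semigroupCrossedProduct_to_crossedProduct :
    ∃ Ψ : SemigroupCrossedProduct (omegaSemigroupAction K) →⋆ₙₐ[ℂ]
        CrossedProduct.Ambient (omegaAction K),
      Ψ 1 = omegaProjection K ∧
      (∀ f, Ψ (SemigroupCrossedProduct.ofAlg _ f) =
        CrossedProduct.ofAlg (omegaAction K) (extendZero f)) ∧
      (∀ t, Ψ (SemigroupCrossedProduct.isom _ t) =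
        CrossedProduct.unit (omegaAction K) (AxB.map (𝓞 K) K t) * omegaProjection K) ∧
      ∀ x, ‖x‖ ≤ ‖Ψ x‖ := by
  set α := omegaSemigroupAction K with hα
  set p := omegaProjection K with hp
  have hpp : p * p = p := isStarProjection_omegaProjection.isIdempotentElem
  have hps : star p = p := isStarProjection_omegaProjection.isSelfAdjoint
  let v : C(OmegaR K, ℂ) ⊕ AxB (𝓞 K) → CrossedProduct.Ambient (omegaAction K) :=
    Sum.elim (fun f => CrossedProduct.ofAlg (omegaAction K) (extendZero f))
      (fun t => CrossedProduct.unit (omegaAction K) (AxB.map (𝓞 K) K t) * p)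
  let φ := FreeStarAlg.liftCorner v p isStarProjection_omegaProjection
    (by
      rintro (f | t)
      · exact omegaProjection_mul_ofAlg_extendZero f
      · exact omegaProjection_mul_unit_mul t)
    (by
      rintro (f | t)
      · exact ofAlg_extendZero_mul_omegaProjection f
      · exact (mul_assoc _ _ _).trans (congrArg _ hpp))
  have hφl : ∀ f, φ (.gen (.inl f)) = CrossedProduct.ofAlg (omegaAction K) (extendZero f) :=
    fun f => FreeStarAlg.liftCorner_gen v p _ _ _ (.inl f)
  have hφr : ∀ t, φ (.gen (.inr t)) =
      CrossedProduct.unit (omegaAction K) (AxB.map (𝓞 K) K t) * p :=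
    fun t => FreeStarAlg.liftCorner_gen v p _ _ _ (.inr t)
  have hφ1 : φ 1 = p := FreeStarAlg.liftCorner_one v p _ _ _
  have hE : ∀ f, CrossedProduct.ofAlg (omegaAction K) (extendZero f) =
      (CrossedProduct.ofAlgHom (omegaAction K)).comp (extendZeroHom K) f := fun _ => rfl
  obtain ⟨Ψ, hΨ⟩ := (semigroupCrossedPresentation α).exists_lift φ (by
    rintro a b (⟨h⟩ | _)
    · cases h with
      | add f g => simp only [map_add, hφl, hE]
      | smul z f => simp only [map_smul, hφl, hE]
      | mul f g => simp only [map_mul, hφl, hE]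
      | star f => simp only [map_star, hφl, hE]
      | isometry t =>
        rw [map_mul, map_star, hφr, hφ1, star_mul, hps, mul_assoc,
          ← mul_assoc (star (CrossedProduct.unit _ _)), CrossedProduct.star_unit_mul, one_mul, hpp]
      | semigroup t t' =>
        rw [map_mul, hφr, hφr, hφr, map_mul, CrossedProduct.unit_mul, mul_assoc, mul_assoc,
          omegaProjection_mul_unit_mul]
      | covariant t f =>
        rw [map_mul, map_mul, map_star, hφr, hφl, hφl, star_mul, hps, mul_assoc, mul_assoc,
          ← mul_assoc (CrossedProduct.ofAlg _ _), ofAlg_extendZero_mul_omegaProjection,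
          ← mul_assoc p, omegaProjection_mul_ofAlg_extendZero, ← mul_assoc,
          CrossedProduct.unit_mul_ofAlg_mul_star, extendZero_omegaSemigroupAction]
    · rw [hφl, hφ1]
      rfl)
  refine ⟨Ψ, ?_, fun f => ?_, fun t => ?_, fun x => ?_⟩
  · rw [← map_one (semigroupCrossedPresentation α).toUniversal, hΨ, hφ1]
  · exact (hΨ (.gen (.inl f))).trans (hφl f)
  · exact (hΨ (.gen (.inr t))).trans (hφr t)
  · refine (semigroupCrossedPresentation α).denseRange_toUniversal.induction_on x
      (isClosed_le continuous_norm (map_continuous Ψ).norm) fun a => ?_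
    let D := omegaDilationData K
    let σ : FreeStarAlg (C(OmegaR K, ℂ) ⊕ AxB (𝓞 K)) →⋆ₐ[ℂ]
        FreeStarAlg (C₀(OmegaA K, ℂ) ⊕ AxB K) :=
      FreeStarAlg.lift (Sum.elim (fun f => .gen (.inl (extendZero f)))
        (fun t => .gen (.inr (AxB.map (𝓞 K) K t)) * .gen (.inl (extendZero 1))))
    -- `σ` writes the images of the generators as words in the covariant pair, so that they can act
    -- on the dilation space.
    have hσl : ∀ f, σ (.gen (.inl f)) = .gen (.inl (extendZero f)) :=
      fun f => FreeStarAlg.lift_gen _ _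
    have hσr : ∀ t, σ (.gen (.inr t)) =
        .gen (.inr (AxB.map (𝓞 K) K t)) * .gen (.inl (extendZero 1)) :=
      fun t => FreeStarAlg.lift_gen _ _
    have hD : ∀ f, D.hom (extendZero f) = SemigroupCrossedProduct.ofAlg α f := fun f =>
      congrArg (SemigroupCrossedProduct.ofAlg α) (restrictHom_extendZero f)
    have hD1 : D.hom (extendZero 1) = 1 := (hD 1).trans (SemigroupCrossedProduct.ofAlg_one α)
    have hD2 : ∀ t, D.hom (D.act (D.incl t) (extendZero 1)) = D.isom t * star (D.isom t) :=
      fun t => (congrArg (SemigroupCrossedProduct.ofAlg α)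
        (restrictHom_extendZero_one_smul t)).trans (SemigroupCrossedProduct.isom_mul_star α t).symm
    -- It must be checked that U_t p and its adjoint p U_t* preserve the embedded copy of the
    -- semigroup crossed product and act there as v_t and v_t*.
    have key := D.norm_le_norm_toUniversal (τ := (semigroupCrossedPresentation α).toUniversal)
      (σ := σ)
      (by
        rintro (f | t) z
        · rw [hσl, DilationData.Space.rep_gen_inl, D.multiply_embed, hD]
          rfl
        · rw [hσr, map_mul, mul_apply_eq_comp, DilationData.Space.rep_gen_inl, D.multiply_embed,
            hD1, one_mul, DilationData.Space.rep_gen_inr]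
          exact D.translate_incl_embed t z)
      (by
        rintro (f | t) z
        · rw [hσl, DilationData.Space.rep_star_gen_inl, D.multiply_embed, map_star, hD]
          rfl
        · rw [hσr, star_mul, map_mul, mul_apply_eq_comp, DilationData.Space.rep_star_gen_inl,
            DilationData.Space.rep_star_gen_inr, ← extendZeroHom_apply, ← map_star, star_one]
          exact D.multiply_translate_inv_embed hD1 hD2 t z) hD1 a
    refine key.trans (le_of_eq ?_)
    rw [hΨ, map_mul]
    -- The leading factor p is the one built into `liftCorner`; after it, both sides are unital
    -- lifts which agree on generators.
    change ‖p * (covariantPresentation (omegaAction K)).toUniversal (FreeStarAlg.lift _ a)‖ =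
      ‖p * FreeStarAlg.lift v a‖
    rw [FreeStarAlg.map_lift]
    congr 4
    funext x
    obtain f | t := x
    · rfl
    · exact map_mul (covariantPresentation (omegaAction K)).toUniversal _ _

end Corner
end

noncomputable section

open scoped nonZeroDivisors CStarAlgebra ZeroAtInfty
open NumberField

/-! ### Fullness of the projection and the range of the embedding. -/

section Corner

variable {K : Type*} [Field K] [NumberField K]

omit [NumberField K] in
theorem AxB.mk_zero_mul (d d' : (𝓞 K)⁰) : (⟨0, d * d'⟩ : AxB (𝓞 K)) = ⟨0, d⟩ * ⟨0, d'⟩ := by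
  change _ = (⟨0 + d * 0, d * d'⟩ : AxB (𝓞 K))
  rw [mul_zero, add_zero]

/-- Every compact subset of `Ω` is mapped into `Ω_R` by some nonzero integer. -/
theorem exists_smul_mem_OmegaR {s : Set (OmegaA K)} (hs : IsCompact s) :
    ∃ d : (𝓞 K)⁰, ∀ x ∈ s, AxB.map (𝓞 K) K ⟨0, d⟩ • x ∈ OmegaR K := by
  -- The open sets d⁻¹Ω_R cover Ω because adeles have integer denominators. They are directed
  -- because (dd')⁻¹Ω_R contains both d⁻¹Ω_R and d'⁻¹Ω_R.
  refine hs.elim_directed_cover (fun d : (𝓞 K)⁰ => {x | AxB.map (𝓞 K) K ⟨0, d⟩ • x ∈ OmegaR K})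
    (fun d => isClopen_OmegaR.isOpen.preimage (continuous_const_smul _)) ?_ ?_
  · intro x _
    obtain ⟨r, a, rfl⟩ := exists_eq_omega x
    obtain ⟨d, hd⟩ := exists_mul_mem_integralAdeles r
    obtain ⟨d', hd'⟩ := exists_mul_mem_integralAdeles a
    have h : ∀ y : 𝓞 K, algebraMap K (FinAdele K) (algebraMap (𝓞 K) K y) ∈ integralAdeles K :=
      fun y v => IsDedekindDomain.HeightOneSpectrum.coe_algebraMap_mem (𝓞 K) K v y
    refine Set.mem_iUnion.2 ⟨d * d', ?_⟩
    change AxB.map (𝓞 K) K ⟨0, d * d'⟩ • omega r a ∈ OmegaR K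
    rw [smul_omega, omega_mem_OmegaR]
    change algebraMap K (FinAdele K) (algebraMap (𝓞 K) K 0) +
      algebraMap K (FinAdele K) (algebraMap (𝓞 K) K ((d : 𝓞 K) * d')) * r ∈ _ ∧
      algebraMap K (FinAdele K) (algebraMap (𝓞 K) K ((d : 𝓞 K) * d')) * a ∈ _
    rw [map_mul, map_mul, map_zero, map_zero, zero_add]
    constructor
    · rw [mul_right_comm]
      exact mul_mem hd (h _)
    · rw [mul_assoc]
      exact mul_mem (h _) hd'
  · intro d d'
    refine ⟨d * d', fun x hx => ?_, fun x hx => ?_⟩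
    · change AxB.map (𝓞 K) K ⟨0, d * d'⟩ • x ∈ OmegaR K
      rw [mul_comm, AxB.mk_zero_mul, map_mul, mul_smul]
      exact smul_mem_OmegaR _ hx
    · change AxB.map (𝓞 K) K ⟨0, d * d'⟩ • x ∈ OmegaR K
      rw [AxB.mk_zero_mul, map_mul, mul_smul]
      exact smul_mem_OmegaR _ hx

/-- f is small off a compact set, which lies in some d⁻¹Ω_R; cutting f down to that set changes it
little. -/
theorem mem_closure_range_mul_translate (f : C₀(OmegaA K, ℂ)) :
    f ∈ closure (Set.range fun g : AxB K => f * omegaAction K g (extendZero 1)) := by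
  rw [Metric.mem_closure_range_iff]
  intro ε hε
  have h0 := f.zero_at_infty'.norm
  rw [norm_zero] at h0
  have h1 := h0.eventually_lt_const (half_pos hε)
  obtain ⟨s, hs, hs'⟩ := Filter.mem_cocompact.1 h1
  obtain ⟨d, hd⟩ := exists_smul_mem_OmegaR hs
  refine ⟨(AxB.map (𝓞 K) K ⟨0, d⟩)⁻¹, ?_⟩
  refine lt_of_le_of_lt ?_ (half_lt_self hε)
  rw [dist_eq_norm, ← ZeroAtInftyContinuousMap.norm_toBCF_eq_norm,
    BoundedContinuousFunction.norm_le (half_pos hε).le]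
  intro x
  change ‖f x - f x * extendZero 1 ((AxB.map (𝓞 K) K ⟨0, d⟩)⁻¹⁻¹ • x)‖ ≤ ε / 2
  rw [inv_inv]
  by_cases hx : AxB.map (𝓞 K) K ⟨0, d⟩ • x ∈ OmegaR K
  · rw [extendZero_apply 1 ⟨_, hx⟩]
    simp [(half_pos hε).le]
  · rw [extendZero_of_notMem _ hx, mul_zero, sub_zero]
    have : x ∈ sᶜ := fun h => hx (hd x h)
    exact le_of_lt (hs' this)

theorem isFullProjection_omegaProjection :
    IsFullProjection (CrossedProduct (omegaAction K)) (omegaProjection K) where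
  mem := CrossedProduct.ofAlg_mem _ _
  isStarProjection := isStarProjection_omegaProjection
  full := by
    set B := CrossedProduct (omegaAction K)
    have hp : omegaProjection K ∈ B := CrossedProduct.ofAlg_mem _ _
    have hpp : omegaProjection K * omegaProjection K = omegaProjection K :=
      isStarProjection_omegaProjection.isIdempotentElem
    set W := Submodule.span ℂ {x | ∃ b ∈ B, ∃ c ∈ B, x = b * omegaProjection K * c} with hW
    refine Set.Subset.antisymm ?_ ?_
    · refine closure_minimal ?_ (CrossedProduct.isClosed_coe _)
      have : W ≤ B.toSubmodule := Submodule.span_le.2 (by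
        rintro _ ⟨b, hb, c, hc, rfl⟩
        exact B.mul_mem (B.mul_mem hb hp) hc)
      exact this
    · intro b hb
      refine CrossedProduct.mem_of_closed_span (omegaAction K) (V := W.topologicalClosure)
        W.isClosed_topologicalClosure (fun f g => ?_) hb
      have hc : Continuous fun h : C₀(OmegaA K, ℂ) => CrossedProduct.ofAlg (omegaAction K) h *
          CrossedProduct.unit (omegaAction K) g :=
        (map_continuous (CrossedProduct.ofAlgHom (omegaAction K))).mul continuous_const
      refine map_mem_closure (f := fun h => CrossedProduct.ofAlg (omegaAction K) h *
        CrossedProduct.unit (omegaAction K) g) hc (mem_closure_range_mul_translate f) ?_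
      rintro _ ⟨h, rfl⟩
      -- The factorization is f α_h(p) U_g = (f U_h) p (p U_{h⁻¹g}).
      refine Submodule.subset_span ⟨_, CrossedProduct.ofAlg_mul_unit_mem _ f h, _,
        CrossedProduct.ofAlg_mul_unit_mem _ (extendZero 1) (h⁻¹ * g), ?_⟩
      change CrossedProduct.ofAlg (omegaAction K) (f * omegaAction K h (extendZero 1)) *
          CrossedProduct.unit (omegaAction K) g =
        CrossedProduct.ofAlg (omegaAction K) f * CrossedProduct.unit (omegaAction K) h *
        omegaProjection K * (omegaProjection K * CrossedProduct.unit (omegaAction K) (h⁻¹ * g))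
      rw [mul_assoc _ (omegaProjection K), ← mul_assoc (omegaProjection K), hpp, mul_assoc,
        ← mul_assoc (CrossedProduct.unit _ h), omegaProjection, CrossedProduct.unit_mul_ofAlg,
        mul_assoc _ (CrossedProduct.unit _ h), ← CrossedProduct.unit_mul, mul_inv_cancel_left,
        CrossedProduct.ofAlg_mul, mul_assoc]

theorem range_eq_corner {Ψ : SemigroupCrossedProduct (omegaSemigroupAction K) →⋆ₙₐ[ℂ]
        CrossedProduct.Ambient (omegaAction K)}
    (h1 : Ψ 1 = omegaProjection K)
    (hf : ∀ f, Ψ (SemigroupCrossedProduct.ofAlg _ f) =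
        CrossedProduct.ofAlg (omegaAction K) (extendZero f))
    (ht : ∀ t, Ψ (SemigroupCrossedProduct.isom _ t) =
        CrossedProduct.unit (omegaAction K) (AxB.map (𝓞 K) K t) * omegaProjection K)
    (hn : ∀ x, ‖x‖ ≤ ‖Ψ x‖) :
    Set.range Ψ = corner (CrossedProduct (omegaAction K)) (omegaProjection K) := by
  have hps : star (omegaProjection K) = omegaProjection K :=
    isStarProjection_omegaProjection.isSelfAdjoint
  refine Set.Subset.antisymm ?_ ?_
  · rintro _ ⟨x, rfl⟩
    refine ⟨Ψ x, ?_, by rw [← h1, ← map_mul, ← map_mul, one_mul, mul_one]⟩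
    induction x using CStarPresentation.induction with
    | hc => exact (CrossedProduct.isClosed_coe _).preimage (map_continuous Ψ)
    | h1 => rw [h1]; exact CrossedProduct.ofAlg_mem _ _
    | hg x =>
      obtain f | t := x
      · exact (hf f).symm ▸ CrossedProduct.ofAlg_mem _ _
      · exact (ht t).symm ▸ CrossedProduct.unit_mul_ofAlg_mem _ _ _
    | hs a ih => rw [map_star]; exact star_mem ih
    | hz z a ih => rw [map_smul]; exact SMulMemClass.smul_mem z ih
    | ha a b iha ihb => rw [map_add]; exact add_mem iha ihb
    | hm a b iha ihb => rw [map_mul]; exact mul_mem iha ihb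
  · rintro _ ⟨b, hb, rfl⟩
    -- The lower norm bound makes `Ψ` isometric on a complete space. With closed range it suffices
    -- to treat the spanning elements f U_g.
    have hcl : IsClosed (Set.range Ψ) := by
      refine (AddMonoidHomClass.isometry_of_norm Ψ fun x => ?_).isClosedEmbedding.isClosed_range
      exact le_antisymm (NonUnitalStarAlgHom.norm_apply_le Ψ x) (hn x)
    let V : Submodule ℂ (CrossedProduct.Ambient (omegaAction K)) :=
      { carrier := {b | omegaProjection K * b * omegaProjection K ∈ Set.range Ψ}
        zero_mem' := ⟨0, by simp⟩
        add_mem' := by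
          rintro b c ⟨x, hx⟩ ⟨y, hy⟩
          exact ⟨x + y, by rw [map_add, hx, hy, mul_add, add_mul]⟩
        smul_mem' := by
          rintro z b ⟨x, hx⟩
          exact ⟨z • x, by rw [map_smul, hx, mul_smul_comm, smul_mul_assoc]⟩ }
    refine CrossedProduct.mem_of_closed_span (omegaAction K) (V := V)
      (hcl.preimage ((continuous_const.mul continuous_id).mul continuous_const)) (fun f g => ?_) hb
    obtain ⟨t, b, hg⟩ := AxB.exists_map_mul_eq g
    -- With g = t⁻¹b, the preimage of p f U_g p is f|Ω_R v_t* v_b, because U_g = U_t* U_b and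
    -- extending the restriction by zero gives p f.
    refine ⟨SemigroupCrossedProduct.ofAlg _ (restrictHom K f) *
      (star (SemigroupCrossedProduct.isom _ t) * SemigroupCrossedProduct.isom _ b), ?_⟩
    have hu : star (CrossedProduct.unit (omegaAction K) (AxB.map (𝓞 K) K t)) *
        CrossedProduct.unit (omegaAction K) (AxB.map (𝓞 K) K b) =
        CrossedProduct.unit (omegaAction K) g := by
      rw [CrossedProduct.star_unit, ← CrossedProduct.unit_mul, ← hg, inv_mul_cancel_left]
    rw [map_mul, map_mul, map_star, hf, ht, ht, star_mul, hps, ← mul_assoc, ← mul_assoc,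
      ← mul_assoc, ofAlg_extendZero_mul_omegaProjection, mul_assoc (CrossedProduct.ofAlg _ _), hu,
      extendZero_restrictHom, CrossedProduct.ofAlg_mul, ← mul_assoc]
    rfl

end Corner

end

theorem proposition5p2 (K : Type*) [Field K] [NumberField K] :
    (∃ Φ : ToeplitzAlgebra (𝓞 K) ≃⋆ₐ[ℂ] SemigroupCrossedProduct (omegaSemigroupAction K),
      (∀ x : 𝓞 K, Φ (ToeplitzAlgebra.u x) =
        SemigroupCrossedProduct.isom (omegaSemigroupAction K) ⟨x, 1⟩) ∧
      (∀ k : (𝓞 K)⁰, Φ (ToeplitzAlgebra.s k) =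
        SemigroupCrossedProduct.isom (omegaSemigroupAction K) ⟨0, k⟩) ∧
      (∀ I : NonzeroIdeal (𝓞 K), Φ (ToeplitzAlgebra.e I) =
        SemigroupCrossedProduct.ofAlg (omegaSemigroupAction K) (idealFunction I))) ∧
    (IsFullProjection (CrossedProduct (omegaAction K)) (omegaProjection K) ∧
      ∃ Ψ : ToeplitzAlgebra (𝓞 K) →⋆ₙₐ[ℂ] CrossedProduct.Ambient (omegaAction K),
        Function.Injective Ψ ∧
        Set.range Ψ = corner (CrossedProduct (omegaAction K)) (omegaProjection K) ∧
        (∀ x : 𝓞 K, Ψ (ToeplitzAlgebra.u x) = omegaProjection K *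
          CrossedProduct.unit (omegaAction K) (AxB.map (𝓞 K) K ⟨x, 1⟩) * omegaProjection K) ∧
        (∀ k : (𝓞 K)⁰, Ψ (ToeplitzAlgebra.s k) = omegaProjection K *
          CrossedProduct.unit (omegaAction K) (AxB.map (𝓞 K) K ⟨0, k⟩) * omegaProjection K) ∧
        (∀ I : NonzeroIdeal (𝓞 K), Ψ (ToeplitzAlgebra.e I) =
          CrossedProduct.ofAlg (omegaAction K) (extendZero (idealFunction I)))) := by
  obtain ⟨Φ, hu, hs, he⟩ := exists_toeplitz_equiv_semigroupCrossedProduct K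
  obtain ⟨Ψ, h1, hf, ht, hn⟩ := exists_semigroupCrossedProduct_to_crossedProduct (K := K)
  have hinj : Function.Injective Ψ := by
    rw [injective_iff_map_eq_zero]
    intro x hx
    have := hn x
    rwa [hx, norm_zero, norm_le_zero_iff] at this
  refine ⟨⟨Φ, hu, hs, he⟩, isFullProjection_omegaProjection,
    Ψ.comp (Φ : ToeplitzAlgebra (𝓞 K) →⋆ₙₐ[ℂ] _), ?_, ?_,
    fun x => ?_, fun k => ?_, fun I => ?_⟩
  · exact Function.Injective.comp (g := Ψ) (f := Φ) hinj (EquivLike.injective Φ)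
  · rw [← range_eq_corner h1 hf ht hn]
    exact Function.Surjective.range_comp (f := Φ) (EquivLike.surjective Φ) Ψ
  · change Ψ (Φ _) = _
    rw [hu, ht, mul_assoc, omegaProjection_mul_unit_mul]
  · change Ψ (Φ _) = _
    rw [hs, ht, mul_assoc, omegaProjection_mul_unit_mul]
  · change Ψ (Φ _) = _
    rw [he, hf]
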